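/- **Setting.** Let $\{1,\dots,N\}$ be the disjoint union of nonempty sets $C_1,\dots,C_n$, and write $\mathbb R^N=\mathbb R^{C_1}\oplus\cdots\oplus\mathbb R^{C_n}$, $\mathbf x=(\mathbf x_1,\dots,\mathbf x_n)$. Let $d_1,\dots,d_N>0$, put $\lambda\cdot\mathbf x=(\lambda^{d_1}x_1,\dots,\lambda^{d_N}x_N)$ and $Q_j=\sum_{l\in C_j}d_l$, and let $n_j$ be a homogeneous norm on $\mathbb R^{C_j}$: smooth away from $0$, with $n_j(\lambda\cdot\mathbf x_j)=\lambda n_j(\mathbf x_j)$ for $\lambda>0$ and $n_j(\mathbf x_j)\approx\sum_{l\in C_j}|x_l|^{1/d_l}$. For a multi-index $\boldsymbol\gamma=(\boldsymbol\gamma_1,\dots,\boldsymbol\gamma_n)\in\mathbb N^{C_1}\times\cdots\times\mathbb N^{C_n}$ put $[\boldsymbol\gamma_j]=\sum_{l\in C_j}\gamma_l d_l$. Let $\mathbf E=(e(j,k))$ be an $n\times n$ matrix with entries in $(0,\infty)$ such that $e(j,j)=1$ and $e(j,l)\le e(j,k)e(k,l)$ for all $j,k,l$. For $L\subseteq\{1,\dots,n\}$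 let $\mathbb R^L=\bigoplus_{j\in L}\mathbb R^{C_j}$ and put $$N_j(\mathbf x)=\sum_{k=1}^n n_k(\mathbf x_k)^{e(j,k)},\qquad \widehat N_j(\boldsymbol\xi)=\sum_{k=1}^n n_k(\boldsymbol\xi_k)^{1/e(k,j)},\qquad N_j^L(\mathbf x_L)=\sum_{k\in L}n_k(\mathbf x_k)^{e(j,k)}\quad(j\in L).$$ The unit ball of $\mathbb R^L$ is $\{\mathbf x_L: n_j(\mathbf x_j)<1,\ j\in L\}$. For a test function $\psi\in\mathcal C_0^\infty$ let $\|\psi\|_{(p)}=\sup\{|\partial^{\boldsymbol\gamma}\psi(\mathbf x)|:\mathbf x,\ |\boldsymbol\gamma|\le p\}$, and for positive numbers $R=(R_j)$ let $\psi_R(\mathbf x)=\psi\big((R_j\cdot\mathbf x_j)_j\big)$. **Multipliers.** $\mathcal M_\infty(\mathbf E)$ is the set of $m\in\mathcal C^\infty(\mathbb R^N)$ (complex valued) such that for every $\boldsymbol\gamma$ there is a constant $C_{\boldsymbol\gamma}$ with $$|\partial^{\boldsymbol\gamma}m(\boldsymbol\xi)|\le C_{\boldsymbol\gamma}\prod_{j=1}^n\big(1+\widehat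 N_j(\boldsymbol\xi)\big)^{-[\boldsymbol\gamma_j]}\qquad(\boldsymbol\xi\in\mathbb R^N).$$ **Kernels.** A distribution $\mathcal K$ on $\mathbb R^N$ belongs to $\mathcal P(\mathbf E)$ if: (a) away from the origin $\mathcal K$ is given by integration against a smooth function $K$ such that for every $\boldsymbol\gamma$ there is $C_{\boldsymbol\gamma}$ with $|\partial^{\boldsymbol\gamma}K(\mathbf x)|\le C_{\boldsymbol\gamma}\prod_{j=1}^nN_j(\mathbf x)^{-(Q_j+[\boldsymbol\gamma_j])}$ for $\mathbf x\ne0$; (b) for every pair of complementary subsets $L,M$ of $\{1,\dots,n\}$, every $\psi\in\mathcal C_0^\infty(\mathbb R^M)$ supported in the unit ball and every $R=(R_j)$ with $R_j>0$, the distribution $\langle\mathcal K_{\psi,R},\varphi\rangle=\langle\mathcal K,\varphi\otimes\psi_R\rangle$ on $\mathbb R^L$ is given away from the origin by integration against a smooth function $K_{\psi,R}$ with $$|\partial^{\boldsymbol\gamma}K_{\psi,R}(\mathbf x)|\le C'_{\boldsymbol\gamma}\prod_{j\in L}N_j^L(\mathbf x)^{-(Q_j+[\boldsymbol\gamma_j])}\qquad(0\ne\mathbf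 x\in\mathbb R^L),$$ where $C'_{\boldsymbol\gamma}$ is independent of $R$ and depends on $\psi$ only through its norms: $C'_{\boldsymbol\gamma}=C''_{L,\boldsymbol\gamma}\|\psi\|_{(p)}$ with $C''_{L,\boldsymbol\gamma}$ and $p=p(L,\boldsymbol\gamma)$ independent of $\psi$ and $R$; when $L=\emptyset$, the condition is that $|\langle\mathcal K,\psi_R\rangle|\le C\|\psi\|_{(p)}$ with $C$ and $p$ independent of $\psi$ and $R$. $\mathcal K$ belongs to $\mathcal P_0(\mathbf E)$ if it belongs to $\mathcal P(\mathbf E)$ and, for every $M'\in\mathbb N$, the inequalities in (a) and (b) also hold with an additional factor $(1+|\mathbf x|)^{-M'}$ on the right (with constants, and orders $p$ of the norms of $\psi$, that may also depend on $M'$). **Theorem.** If $m\in\mathcal M_\infty(\mathbf E)$, then its Fourier transform, i.e. the tempered distribution $\mathcal K=\widehat m$ given by $\langle\mathcal K,\varphi\rangle=\int_{\mathbb R^N}m(\boldsymbol\xi)\widehat\varphi(\boldsymbol\xi)\,d\boldsymbol\xi$ for $\varphi\in\mathcal S(\mathbb R^N)$, where $\widehat\varphi(\boldsymbol\xi)=\int_{\mathbb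 R^N} e^{2\pi i\langle\mathbf x,\boldsymbol\xi\rangle}\varphi(\mathbf x)\,d\mathbf x$, belongs to $\mathcal P_0(\mathbf E)$. -/

import Mathlib

open MeasureTheory SchwartzMap TopologicalSpace
open scoped Distributions ContDiff Real

noncomputable section

/-! ### Multi-indices and partial derivatives -/

/-- The list of coordinate directions in which every `l` occurs `γ l` times. -/
def directions {α : Type*} [Fintype α] (γ : α → ℕ) : List α :=
  (Finset.univ : Finset α).toList.flatMap fun l => List.replicate (γ l) l

/-- The mixed partial derivative `∂^γ f (x) = (∏_l ∂_{x_l}^{γ_l}) f (x)`, written as the total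
derivative of order `|γ|` applied to standard basis vectors, the `l`-th one taken `γ l` times. -/
def multiDeriv {α : Type*} [Fintype α] {F : Type*} [NormedAddCommGroup F] [NormedSpace ℝ F]
    (γ : α → ℕ) (f : EuclideanSpace ℝ α → F) (x : EuclideanSpace ℝ α) : F :=
  iteratedFDeriv ℝ (directions γ).length f x
    fun i => EuclideanSpace.basisFun α ℝ ((directions γ).get i)

/-- The norm `‖ψ‖_(p) = sup {|∂^γ ψ (x)| : x, |γ| ≤ p}` of a (real) test function. -/
def testNorm {α : Type*} [Fintype α] (p : ℕ)
    (ψ : 𝓓((⊤ : Opens (EuclideanSpace ℝ α)), ℝ)) : ℝ :=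
  sSup {r : ℝ | ∃ γ : α → ℕ, ∑ l, γ l ≤ p ∧ ∃ x, r = |multiDeriv γ ψ x|}

/-! ### Distributions -/

/-- A real test function, seen as a complex Schwartz function. -/
def testToSchwartz {V : Type*} [NormedAddCommGroup V] [NormedSpace ℝ V]
    (φ : 𝓓((⊤ : Opens V), ℝ)) : 𝓢(V, ℂ) :=
  HasCompactSupport.toSchwartzMap (f := fun x => (φ x : ℂ))
    (φ.hasCompactSupport.comp_left (g := fun r : ℝ => (r : ℂ)) Complex.ofReal_zero)
    (Complex.ofRealCLM.contDiff.comp φ.contDiff)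

theorem continuous_testToSchwartz_ofSupportedIn {V : Type*} [NormedAddCommGroup V]
    [NormedSpace ℝ V] (K : Compacts V) (hK : (K : Set V) ⊆ (⊤ : Opens V)) :
    Continuous (fun f : 𝓓_{K}(V, ℝ) =>
      testToSchwartz (TestFunction.ofSupportedIn hK f)) := by
  let A : 𝓓_{K}(V, ℝ) →ₗ[ℝ] 𝓢(V, ℂ) :=
    { toFun := fun f => testToSchwartz (TestFunction.ofSupportedIn hK f)
      map_add' := fun f g => by
        ext x
        exact Complex.ofReal_add _ _
      map_smul' := fun c f => by
        ext x
        exact Complex.ofReal_mul _ _ }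
  obtain ⟨R, hR⟩ := K.isCompact.isBounded.exists_norm_le
  change Continuous A
  refine WithSeminorms.continuous_of_isBounded
    (ContDiffMapSupportedIn.withSeminorms ℝ V ℝ ⊤ K) (schwartz_withSeminorms ℝ V ℂ) _ ?_
  rintro ⟨k, n⟩
  refine ⟨{n}, ⟨(max R 0) ^ k, pow_nonneg (le_max_right _ _) _⟩, fun f => ?_⟩
  refine SchwartzMap.seminorm_le_bound ℝ k n _ ?_ ?_
  · exact mul_nonneg (pow_nonneg (le_max_right _ _) _) (apply_nonneg _ _)
  intro x
  have h1 : ‖iteratedFDeriv ℝ n (A f) x‖ = ‖iteratedFDeriv ℝ n f x‖ :=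
    LinearIsometry.norm_iteratedFDeriv_comp_left (f := f) Complex.ofRealLI
      (f.contDiff.contDiffAt) (by exact_mod_cast le_top)
  rw [h1]
  by_cases hx : x ∈ K
  · have h2 := ContDiffMapSupportedIn.norm_iteratedFDeriv_apply_le_seminorm_top
      (𝕜 := ℝ) (f := f) (i := n) (x := x)
    have h3 : ‖x‖ ≤ max R 0 := (hR x hx).trans (le_max_left _ _)
    simp only [Finset.sup_singleton]
    exact mul_le_mul (pow_le_pow_left₀ (norm_nonneg _) h3 _) h2 (norm_nonneg _)
      (pow_nonneg (le_max_right _ _) _)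
  · have h2 : iteratedFDeriv ℝ n f x = 0 :=
      ContDiffMapSupportedIn.iteratedFDeriv_zero_on_compl f hx
    rw [h2, norm_zero, mul_zero]
    exact mul_nonneg (pow_nonneg (le_max_right _ _) _) (apply_nonneg _ _)

/-- The distribution obtained by restricting a tempered distribution to test functions. -/
def temperedToDistribution {V : Type*} [NormedAddCommGroup V] [NormedSpace ℝ V]
    (T : 𝓢'(V, ℂ)) : 𝓓'((⊤ : Opens V), ℂ) :=
  let A : 𝓓((⊤ : Opens V), ℝ) →L[ℝ] ℂ := TestFunction.mkCLM ℝ (fun φ => T (testToSchwartz φ))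
    (fun φ χ => by
      have h : testToSchwartz (φ + χ) = testToSchwartz φ + testToSchwartz χ := by
        ext x
        exact Complex.ofReal_add _ _
      rw [h, map_add])
    (fun c φ => by
      have h : testToSchwartz (c • φ) = (c : ℂ) • testToSchwartz φ := by
        ext x
        exact Complex.ofReal_mul _ _
      rw [h, map_smul]
      exact Complex.coe_smul c _)
    (fun K hK => by
      have hT : Continuous fun φ : 𝓢(V, ℂ) => T φ := T.continuous
      exact hT.comp (continuous_testToSchwartz_ofSupportedIn K hK))
  { toFun := A
    map_add' := A.map_add
    map_smul' := A.map_smul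
    cont := A.cont }

theorem temperedToDistribution_apply {V : Type*} [NormedAddCommGroup V] [NormedSpace ℝ V]
    (T : 𝓢'(V, ℂ)) (φ : 𝓓((⊤ : Opens V), ℝ)) :
    temperedToDistribution T φ = T (testToSchwartz φ) := rfl

/-- Away from the origin the functional `T` on test functions is given by integration against
`k`, which is smooth away from the origin. -/
def GivenOffOriginBy {α : Type*} [Fintype α]
    (T : 𝓓((⊤ : Opens (EuclideanSpace ℝ α)), ℝ) → ℂ) (k : EuclideanSpace ℝ α → ℂ) : Prop :=
  ContDiffOn ℝ ∞ k {0}ᶜ ∧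
    ∀ φ : 𝓓((⊤ : Opens (EuclideanSpace ℝ α)), ℝ), (0 : EuclideanSpace ℝ α) ∉ tsupport φ →
      T φ = ∫ x, (φ x : ℂ) * k x

/-! ### The decomposition of the space, dilations and homogeneous norms -/

/-- A decomposition `ℝ^ι = ⨁_{j : κ} ℝ^{C_j}` into nonempty blocks of coordinates
`C_j = {l | block l = j}`, dilation exponents `d_l > 0`, and on each `ℝ^{C_j}` a smooth
homogeneous norm `n j` for the dilations `(λ ^ d_l * x_l)_l`. -/
structure BlockSpace (ι κ : Type*) [Fintype ι] [DecidableEq κ] where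
  /-- the index of the block containing a coordinate -/
  block : ι → κ
  block_surjective : Function.Surjective block
  /-- the exponents of the dilations -/
  d : ι → ℝ
  d_pos : ∀ l, 0 < d l
  /-- the homogeneous norms -/
  n : (j : κ) → EuclideanSpace ℝ {l // block l = j} → ℝ
  n_smooth : ∀ j, ContDiffOn ℝ ∞ (n j) {0}ᶜ
  n_homogeneous : ∀ j (r : ℝ), 0 < r → ∀ x,
    n j (WithLp.toLp 2 fun l => r ^ d l.1 * x l) = r * n j x
  n_equiv : ∀ j, ∃ A : ℝ, 0 < A ∧ ∀ x,
    (∑ l : {l // block l = j}, |x l| ^ (1 / d l.1)) ≤ A * n j x ∧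
      n j x ≤ A * ∑ l : {l // block l = j}, |x l| ^ (1 / d l.1)

/-- The basic hypothesis on a matrix `E = (e(j,k))` with positive entries:
`e(j,j) = 1` and `e(j,l) ≤ e(j,k) e(k,l)`. -/
structure BasicHypothesis {κ : Type*} (E : Matrix κ κ ℝ) : Prop where
  pos : ∀ j k, 0 < E j k
  diag : ∀ j, E j j = 1
  submul : ∀ j k l, E j l ≤ E j k * E k l

namespace BlockSpace

variable {ι κ : Type*} [Fintype ι] [DecidableEq κ] (S : BlockSpace ι κ)

/-- The whole space `ℝ^N`. -/
abbrev Space (_S : BlockSpace ι κ) : Type _ := EuclideanSpace ℝ ι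

/-- The subspace `ℝ^L = ⨁_{j ∈ L} ℝ^{C_j}`. -/
abbrev SubSpace (L : Finset κ) : Type _ := EuclideanSpace ℝ {l // S.block l ∈ L}

/-- The component `x_j` of `x ∈ ℝ^N`. -/
def comp (j : κ) (x : S.Space) : EuclideanSpace ℝ {l // S.block l = j} :=
  WithLp.toLp 2 fun l => x l.1

/-- The component `x_j` of `x ∈ ℝ^L`, for `j ∈ L`. -/
def subComp (L : Finset κ) (j : {j // j ∈ L}) (x : S.SubSpace L) :
    EuclideanSpace ℝ {l // S.block l = j.1} :=
  WithLp.toLp 2 fun l => x ⟨l.1, l.2.symm ▸ j.2⟩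

/-- The component `x_L ∈ ℝ^L` of `x ∈ ℝ^N`. -/
def restr (L : Finset κ) (x : S.Space) : S.SubSpace L :=
  WithLp.toLp 2 fun l => x l.1

/-- The homogeneous dimension `Q_j` of `ℝ^{C_j}`. -/
def Q (j : κ) : ℝ := ∑ l with S.block l = j, S.d l

/-- The weighted length `⟦γ_j⟧` of the `j`-th part of a multi-index `γ` on `ℝ^N`. -/
def wlen (γ : ι → ℕ) (j : κ) : ℝ := ∑ l with S.block l = j, γ l * S.d l

/-- The weighted length `⟦γ_j⟧` of the `j`-th part of a multi-index `γ` on `ℝ^L`. -/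
def subWlen (L : Finset κ) (γ : {l // S.block l ∈ L} → ℕ) (j : κ) : ℝ :=
  ∑ l with S.block l.1 = j, γ l * S.d l.1

/-- The `n`-parameter dilation `x ↦ (R_j · x_j)_j` of `ℝ^N`. -/
def dilate (R : κ → ℝ) (x : S.Space) : S.Space :=
  WithLp.toLp 2 fun l => R (S.block l) ^ S.d l * x l

theorem exists_dilate_clm (R : κ → ℝ) (hR : ∀ j, 0 < R j) :
    ∃ A : S.Space →L[ℝ] S.Space, Topology.IsClosedEmbedding A ∧ ⇑A = S.dilate R := by
  let B : S.Space →ₗ[ℝ] S.Space :=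
    { toFun := S.dilate R
      map_add' := fun x y => by ext l; simp [dilate, mul_add]
      map_smul' := fun c x => by ext l; simp [dilate]; ring }
  have hB : Function.Injective B := by
    intro x y h
    ext l
    have h1 : R (S.block l) ^ S.d l * x l = R (S.block l) ^ S.d l * y l :=
      congrArg (fun z : S.Space => z l) h
    exact mul_left_cancel₀ (Real.rpow_pos_of_pos (hR _) _).ne' h1
  exact ⟨LinearMap.toContinuousLinearMap B,
    LinearMap.isClosedEmbedding_of_injective (LinearMap.ker_eq_bot.2 hB), rfl⟩

variable [Fintype κ]

/-- `N_j(x) = ∑_k n_k(x_k)^{e(j,k)}`. -/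
def N (E : Matrix κ κ ℝ) (j : κ) (x : S.Space) : ℝ :=
  ∑ k, S.n k (S.comp k x) ^ E j k

/-- `N̂_j(ξ) = ∑_k n_k(ξ_k)^{1/e(k,j)}`. -/
def dualN (E : Matrix κ κ ℝ) (j : κ) (ξ : S.Space) : ℝ :=
  ∑ k, S.n k (S.comp k ξ) ^ (1 / E k j)

/-- `N_j(x_L) = ∑_{k ∈ L} n_k(x_k)^{e(j,k)}` on `ℝ^L`. -/
def subN (E : Matrix κ κ ℝ) (L : Finset κ) (j : κ) (x : S.SubSpace L) : ℝ :=
  ∑ k : {k // k ∈ L}, S.n k.1 (S.subComp L k x) ^ E j k.1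

/-- The unit ball `𝔹(1)` of `ℝ^N`. -/
def unitBall : Set S.Space := {x | ∀ j, S.n j (S.comp j x) < 1}

/-- The unit ball `𝔹(1)` of `ℝ^L`. -/
def subUnitBall (L : Finset κ) : Set (S.SubSpace L) :=
  {x | ∀ j : {j // j ∈ L}, S.n j.1 (S.subComp L j x) < 1}

/-- The dilation `x ↦ (R_j · x_j)_{j ∈ L}` of `ℝ^L`. -/
def subDilate (R : κ → ℝ) (L : Finset κ) (x : S.SubSpace L) : S.SubSpace L :=
  WithLp.toLp 2 fun l => R (S.block l.1) ^ S.d l.1 * x l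

theorem exists_split_clm (L : Finset κ) (R : κ → ℝ) (hR : ∀ j, 0 < R j) :
    ∃ A : S.Space →L[ℝ] S.SubSpace L × S.SubSpace Lᶜ, Topology.IsClosedEmbedding A ∧
      ∀ x, A x = (S.restr L x, S.subDilate R Lᶜ (S.restr Lᶜ x)) := by
  let B : S.Space →ₗ[ℝ] S.SubSpace L × S.SubSpace Lᶜ :=
    { toFun := fun x => (S.restr L x, S.subDilate R Lᶜ (S.restr Lᶜ x))
      map_add' := fun x y => by
        ext l
        · simp [restr]
        · simp [restr, subDilate, mul_add]
      map_smul' := fun c x => by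
        ext l
        · simp [restr]
        · simp [restr, subDilate]; ring }
  have hB : Function.Injective B := by
    intro x y h
    ext l
    by_cases hl : S.block l ∈ L
    · exact congrArg (fun z : S.SubSpace L × S.SubSpace Lᶜ => z.1 ⟨l, hl⟩) h
    · have h1 : R (S.block l) ^ S.d l * x l = R (S.block l) ^ S.d l * y l :=
        congrArg (fun z : S.SubSpace L × S.SubSpace Lᶜ =>
          z.2 ⟨l, Finset.mem_compl.2 hl⟩) h
      exact mul_left_cancel₀ (Real.rpow_pos_of_pos (hR _) _).ne' h1
  exact ⟨LinearMap.toContinuousLinearMap B,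
    LinearMap.isClosedEmbedding_of_injective (LinearMap.ker_eq_bot.2 hB), fun _ => rfl⟩

/-- The dilated test function `ψ_R(x) = ψ(R · x)` on `ℝ^N`. -/
def dilateTest (R : κ → ℝ) (hR : ∀ j, 0 < R j)
    (ψ : 𝓓((⊤ : Opens S.Space), ℝ)) : 𝓓((⊤ : Opens S.Space), ℝ) where
  toFun := fun x => ψ (S.dilate R x)
  contDiff' := by
    obtain ⟨A, -, hA⟩ := S.exists_dilate_clm R hR
    rw [← hA]
    exact ψ.contDiff.comp A.contDiff
  hasCompactSupport' := by
    obtain ⟨A, hA', hA⟩ := S.exists_dilate_clm R hR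
    rw [← hA]
    exact ψ.hasCompactSupport.comp_isClosedEmbedding hA'
  tsupport_subset' := Set.subset_univ _

/-- The test function `(φ ⊗ ψ_R)(x) = φ(x_L) ψ(R · x_M)` on `ℝ^N`, where `M` is the complement
of `L`, for test functions `φ` on `ℝ^L` and `ψ` on `ℝ^M`. -/
def tensorTest (L : Finset κ) (R : κ → ℝ) (hR : ∀ j, 0 < R j)
    (ψ : 𝓓((⊤ : Opens (S.SubSpace Lᶜ)), ℝ)) (φ : 𝓓((⊤ : Opens (S.SubSpace L)), ℝ)) :
    𝓓((⊤ : Opens S.Space), ℝ) where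
  toFun := fun x => φ (S.restr L x) * ψ (S.subDilate R Lᶜ (S.restr Lᶜ x))
  contDiff' := by
    obtain ⟨A, -, hA⟩ := S.exists_split_clm L R hR
    have h : ContDiff ℝ ∞ fun x => φ (A x).1 * ψ (A x).2 :=
      (φ.contDiff.comp (contDiff_fst.comp A.contDiff)).mul
        (ψ.contDiff.comp (contDiff_snd.comp A.contDiff))
    simpa only [hA] using h
  hasCompactSupport' := by
    obtain ⟨A, hA', hA⟩ := S.exists_split_clm L R hR
    have h : HasCompactSupport fun z : S.SubSpace L × S.SubSpace Lᶜ => φ z.1 * ψ z.2 := by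
      refine HasCompactSupport.of_support_subset_isCompact
        (φ.hasCompactSupport.isCompact.prod ψ.hasCompactSupport.isCompact) ?_
      intro z hz
      exact ⟨subset_tsupport _ (left_ne_zero_of_mul hz),
        subset_tsupport _ (right_ne_zero_of_mul hz)⟩
    have h' := h.comp_isClosedEmbedding hA'
    simpa only [Function.comp_def, hA] using h'
  tsupport_subset' := Set.subset_univ _

/-! ### The classes of distributions and multipliers -/

/-- The class `𝓟(E)`. The first part consists of the differential inequalities. The second and
third parts are the cancellation conditions for complementary sets `L`, `M` of blocks: the
quotient distribution `φ ↦ ⟨K, φ ⊗ ψ_R⟩` on `ℝ^L` is given off the origin by a smooth function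
obeying the differential inequalities on `ℝ^L`, with constants that do not depend on `R` and
depend on `ψ` only through its norms `‖ψ‖_(p)`; if `L = ∅`, then `⟨K, ψ_R⟩` is bounded in the
same way. -/
def InP (E : Matrix κ κ ℝ) (K : 𝓓'((⊤ : Opens S.Space), ℂ)) : Prop :=
  (∃ k : S.Space → ℂ, GivenOffOriginBy K k ∧
    ∀ γ : ι → ℕ, ∃ C : ℝ, ∀ x : S.Space, x ≠ 0 →
      ‖multiDeriv γ k x‖ ≤ C * ∏ j, S.N E j x ^ (-(S.Q j + S.wlen γ j))) ∧
  (∀ L : Finset κ, ∃ (C : ({l // S.block l ∈ L} → ℕ) → ℝ) (p : ({l // S.block l ∈ L} → ℕ) → ℕ),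
    ∀ ψ : 𝓓((⊤ : Opens (S.SubSpace Lᶜ)), ℝ), tsupport ψ ⊆ S.subUnitBall Lᶜ →
    ∀ (R : κ → ℝ) (hR : ∀ j, 0 < R j),
      ∃ k : S.SubSpace L → ℂ, GivenOffOriginBy (fun φ => K (S.tensorTest L R hR ψ φ)) k ∧
        ∀ (γ : {l // S.block l ∈ L} → ℕ) (x : S.SubSpace L), x ≠ 0 →
          ‖multiDeriv γ k x‖ ≤ C γ * testNorm (p γ) ψ *
            ∏ j ∈ L, S.subN E L j x ^ (-(S.Q j + S.subWlen L γ j))) ∧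
  (∃ (C : ℝ) (p : ℕ), ∀ ψ : 𝓓((⊤ : Opens S.Space), ℝ), tsupport ψ ⊆ S.unitBall →
    ∀ (R : κ → ℝ) (hR : ∀ j, 0 < R j), ‖K (S.dilateTest R hR ψ)‖ ≤ C * testNorm p ψ)

/-- The class `𝓟₀(E)`: distributions in `𝓟(E)` for which the differential inequalities, both of
the distribution and of its quotient distributions, hold with an extra factor `(1 + |x|)^{-M}`,
for every `M`. -/
def InP0 (E : Matrix κ κ ℝ) (K : 𝓓'((⊤ : Opens S.Space), ℂ)) : Prop :=
  S.InP E K ∧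
  (∃ k : S.Space → ℂ, GivenOffOriginBy K k ∧
    ∀ (M : ℕ) (γ : ι → ℕ), ∃ C : ℝ, ∀ x : S.Space, x ≠ 0 →
      ‖multiDeriv γ k x‖ ≤
        C * (∏ j, S.N E j x ^ (-(S.Q j + S.wlen γ j))) * (1 + ‖x‖) ^ (-(M : ℝ))) ∧
  (∀ L : Finset κ, ∃ (D : ℕ → ({l // S.block l ∈ L} → ℕ) → ℝ)
      (p : ℕ → ({l // S.block l ∈ L} → ℕ) → ℕ),
    ∀ ψ : 𝓓((⊤ : Opens (S.SubSpace Lᶜ)), ℝ), tsupport ψ ⊆ S.subUnitBall Lᶜ →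
    ∀ (R : κ → ℝ) (hR : ∀ j, 0 < R j),
      ∃ k : S.SubSpace L → ℂ, GivenOffOriginBy (fun φ => K (S.tensorTest L R hR ψ φ)) k ∧
        ∀ (M : ℕ) (γ : {l // S.block l ∈ L} → ℕ) (x : S.SubSpace L), x ≠ 0 →
          ‖multiDeriv γ k x‖ ≤ D M γ * testNorm (p M γ) ψ * (1 + ‖x‖) ^ (-(M : ℝ)) *
            ∏ j ∈ L, S.subN E L j x ^ (-(S.Q j + S.subWlen L γ j)))

/-- The class `𝓜_∞(E)` of multipliers. -/
def InMInfty (E : Matrix κ κ ℝ) (m : S.Space → ℂ) : Prop :=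
  ContDiff ℝ ∞ m ∧
    ∀ γ : ι → ℕ, ∃ C : ℝ, ∀ ξ : S.Space,
      ‖multiDeriv γ m ξ‖ ≤ C * ∏ j, (1 + S.dualN E j ξ) ^ (-S.wlen γ j)

end BlockSpace

/-- The tempered distribution `T` is the Fourier transform of the function `m`:
`⟨T, φ⟩ = ∫ m(ξ) φ̂(ξ) dξ` for Schwartz functions `φ`, where `φ̂(ξ) = ∫ e^{2πi⟨x, ξ⟩} φ(x) dx`. -/
def IsFourierTransformOf {α : Type*} [Fintype α] (T : 𝓢'(EuclideanSpace ℝ α, ℂ))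
    (m : EuclideanSpace ℝ α → ℂ) : Prop :=
  ∀ φ : 𝓢(EuclideanSpace ℝ α, ℂ),
    T φ = ∫ ξ, m ξ * ∫ x, Complex.exp (2 * π * Complex.I * (inner ℝ x ξ : ℝ)) * φ x

end

/-!
The kernel is estimated in coordinates. With `a(l,l') = e(j,j') d_l / d_{l'}`, where `j`, `j'` are
the blocks of `l`, `l'`, the matrix `a` satisfies the basic hypothesis again, `N_j(x)^{d_l}` is
comparable to `P_l(x) = ∑_k |x_k|^{a(l,k)}`, and `(1 + N̂_j(ξ))^{d_l}` to `1 + P̂_l(ξ)` with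
`P̂_l(ξ) = ∑_k |ξ_k|^{1/a(k,l)}`. So one may take all blocks of size one and all `d_l = 1`: the
multiplier satisfies `|∂^L m| ≤ C_L ∏_{l ∈ L} (1 + P̂_l)⁻¹` (`exists_symbolBound`), and bounds by
products of the `P_l⁻¹` are what is needed (`exists_decay_le`).

No dyadic decomposition is used. For fixed `x ≠ 0` let `D` be the set of coordinates `k` for which
`|x_k|` dominates `P_k(x)` (or a single coordinate, if `x` is large), and for `l ∈ D` put
`u_l = ξ_l - i sgn(x_l) A_l`, where `A_l` is `1` plus the part of `P̂_l` in the coordinates outside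
`D`. Since `A_l` does not depend on the coordinates in `D`, one has
`∂_l (u_l e^{2πi⟨ξ, x⟩}) = w_l e^{2πi⟨ξ, x⟩}` with `w_l = 1 + 2πi x_l u_l`, which never vanishes
because of the complex shift. Integration by parts in the directions of `D` yields a recurrence
(`integral_term_recurrence`) in which each step gains a factor `w_l⁻¹` and replaces `m` by
`u_l ∂_l m`, which satisfies the same bounds. The point is `exists_gain`: by the basic hypothesis a
power of `∏_{l ∈ D} |w_l|` dominates every `|ξ_j| P_j(x)`, every `(1 + P̂_l(ξ)) P_l(x)`, and
`1 + |x|`. Hence the integrand becomes at most a constant times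
`∏_j (1 + (ξ_j P_j(x))²)⁻¹`, whose integral is `∏_j π / P_j(x)`; the derivatives of the kernel and
the decay in `|x|` come out of further powers (`exists_norm_osc_le`).

This holds for compactly supported symbols with constants independent of the support. Cutoffs to
anisotropic boxes satisfy uniform symbol bounds, and differences of cutoffs are small with one more
power of a weight, so that the truncated kernels converge with all derivatives, locally uniformly
off the origin; the limit is the kernel (`exists_kernel`).

For the cancellation conditions, testing `m̂` on `φ ⊗ ψ_R` amounts to testing the Fourier transform
of the averaged multiplier `ξ ↦ ∫ m(ξ, η) ψ̂_R(η) dη` on `φ` (`integral_mul_osc_tensor`). It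
satisfies the symbol bounds on `ℝ^L` with constants multiplied by the `L¹` norm of `ψ̂_R`, which
does not depend on `R` and is bounded by a norm `‖ψ‖_(p)` (`exists_integral_norm_osc_dilate_le`),
and the estimate of the kernel is linear in these constants.
-/

open Filter Topology

namespace MultiNorm

/-! ### Iterated partial derivatives along lists of coordinates -/

section Calculus

variable {ι : Type*} [Fintype ι] {F : Type*} [NormedAddCommGroup F] [NormedSpace ℝ F]

theorem basisFun_coord [DecidableEq ι] (l i : ι) :
    (EuclideanSpace.basisFun ι ℝ l) i = if i = l then 1 else 0 := by
  rw [EuclideanSpace.basisFun_apply, PiLp.single_apply]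

theorem sum_proj_smulRight_basisFun (g : ι → F) (l : ι) :
    (∑ i, (EuclideanSpace.proj i : EuclideanSpace ℝ ι →L[ℝ] ℝ).smulRight (g i))
      (EuclideanSpace.basisFun ι ℝ l) = g l := by
  classical
  simp

/-- The iterated partial derivative `∂_{l₁} ⋯ ∂_{l_r} f` along a list `[l₁, …, l_r]` of coordinate
directions; the head of the list is applied last. -/
noncomputable def pd : List ι → (EuclideanSpace ℝ ι → F) → EuclideanSpace ℝ ι → F
  | [], f => f
  | l :: L, f => fun x => fderiv ℝ (pd L f) x (EuclideanSpace.basisFun ι ℝ l)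

@[simp] theorem pd_nil (f : EuclideanSpace ℝ ι → F) : pd [] f = f := rfl

theorem pd_cons (l : ι) (L : List ι) (f : EuclideanSpace ℝ ι → F) (x : EuclideanSpace ℝ ι) :
    pd (l :: L) f x = fderiv ℝ (pd L f) x (EuclideanSpace.basisFun ι ℝ l) := rfl

theorem pd_append (L L' : List ι) (f : EuclideanSpace ℝ ι → F) :
    pd (L ++ L') f = pd L (pd L' f) := by
  induction L with
  | nil => rfl
  | cons l L ih => funext x; rw [List.cons_append, pd_cons, pd_cons, ih]

theorem contDiff_pd {f : EuclideanSpace ℝ ι → F} (hf : ContDiff ℝ ∞ f) (L : List ι) :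
    ContDiff ℝ ∞ (pd L f) := by
  induction L with
  | nil => exact hf
  | cons l L ih =>
    exact ((contDiff_infty_iff_fderiv.1 ih).2).clm_apply contDiff_const

theorem differentiable_pd {f : EuclideanSpace ℝ ι → F} (hf : ContDiff ℝ ∞ f) (L : List ι) :
    Differentiable ℝ (pd L f) := (contDiff_pd hf L).differentiable (by simp)

theorem pd_swap {f : EuclideanSpace ℝ ι → F} (hf : ContDiff ℝ ∞ f) (a b : ι) :
    pd [a, b] f = pd [b, a] f := by
  have h2 : Differentiable ℝ (fderiv ℝ f) :=
    (contDiff_infty_iff_fderiv.1 hf).2.differentiable (by simp)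
  have key : ∀ (a b : ι) x, pd [a, b] f x = fderiv ℝ (fderiv ℝ f) x
      (EuclideanSpace.basisFun ι ℝ a) (EuclideanSpace.basisFun ι ℝ b) := by
    intro a b x
    have : pd [b] f = fun y => fderiv ℝ f y (EuclideanSpace.basisFun ι ℝ b) := rfl
    rw [pd_cons, this, fderiv_clm_apply (h2 x) (differentiableAt_const _)]
    simp
  funext x
  rw [key, key]
  exact (((contDiff_infty.1 hf 2).contDiffAt).isSymmSndFDerivAt (by simp)).eq _ _

theorem pd_perm {f : EuclideanSpace ℝ ι → F} (hf : ContDiff ℝ ∞ f) {L L' : List ι}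
    (h : L.Perm L') : pd L f = pd L' f := by
  induction h with
  | nil => rfl
  | cons a _ ih => funext x; rw [pd_cons, pd_cons, ih]
  | swap a b L =>
    have := pd_swap (contDiff_pd hf L) b a
    rwa [← pd_append, ← pd_append] at this
  | trans _ _ ih1 ih2 => exact ih1.trans ih2

theorem pd_cons_inner {f : EuclideanSpace ℝ ι → F} (hf : ContDiff ℝ ∞ f) (l : ι) (L : List ι) :
    pd (l :: L) f = pd L (pd [l] f) := by
  rw [← pd_append]
  exact pd_perm hf (List.perm_append_singleton l L).symm

theorem pd_congr_of_eventuallyEq {f g : EuclideanSpace ℝ ι → F} {x : EuclideanSpace ℝ ι}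
    (h : f =ᶠ[𝓝 x] g) (L : List ι) : pd L f =ᶠ[𝓝 x] pd L g := by
  induction L with
  | nil => exact h
  | cons l L ih =>
    filter_upwards [ih.eventuallyEq_nhds] with y hy
    rw [pd_cons, pd_cons, hy.fderiv_eq]

theorem pd_add {f g : EuclideanSpace ℝ ι → F} (hf : ContDiff ℝ ∞ f) (hg : ContDiff ℝ ∞ g)
    (L : List ι) : pd L (fun x => f x + g x) = fun x => pd L f x + pd L g x := by
  induction L with
  | nil => rfl
  | cons l L ih =>
    funext x
    rw [pd_cons, ih, fderiv_fun_add (differentiable_pd hf L x) (differentiable_pd hg L x)]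
    rfl

theorem pd_sub {f g : EuclideanSpace ℝ ι → F} (hf : ContDiff ℝ ∞ f) (hg : ContDiff ℝ ∞ g)
    (L : List ι) : pd L (fun x => f x - g x) = fun x => pd L f x - pd L g x := by
  induction L with
  | nil => rfl
  | cons l L ih =>
    funext x
    rw [pd_cons, ih, fderiv_fun_sub (differentiable_pd hf L x) (differentiable_pd hg L x)]
    rfl

theorem pd_const (c : F) (l : ι) (L : List ι) :
    pd (l :: L) (fun _ : EuclideanSpace ℝ ι => c) = fun _ => 0 := by
  induction L generalizing l with
  | nil => funext x; rw [pd_cons]; simp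
  | cons a L ih => funext x; rw [pd_cons, ih]; simp

theorem pd_zero (L : List ι) :
    pd L (fun _ : EuclideanSpace ℝ ι => (0 : F)) = fun _ => 0 := by
  cases L with
  | nil => rfl
  | cons l L => exact pd_const _ _ _

theorem hasCompactSupport_pd {f : EuclideanSpace ℝ ι → F} (hf : HasCompactSupport f) (L : List ι) :
    HasCompactSupport (pd L f) := by
  induction L with
  | nil => exact hf
  | cons l L ih => exact ih.fderiv_apply ℝ _

theorem fderiv_eq_sum_pd {f : EuclideanSpace ℝ ι → F} (x : EuclideanSpace ℝ ι) :
    fderiv ℝ f x = ∑ l, (EuclideanSpace.proj l : EuclideanSpace ℝ ι →L[ℝ] ℝ).smulRight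
      (fderiv ℝ f x (EuclideanSpace.basisFun ι ℝ l)) := by
  ext v
  conv_lhs => rw [← (EuclideanSpace.basisFun ι ℝ).sum_repr v]
  simp

/-- A family `g` indexed by lists of coordinate directions is a jet on `U` if
`∂_l (g L) = g (l :: L)` on `U`, so that `g L` is the iterated partial derivative of `g []`. -/
def IsJet (U : Set (EuclideanSpace ℝ ι)) (g : List ι → EuclideanSpace ℝ ι → F) : Prop :=
  ∀ L, ∀ x ∈ U, HasFDerivAt (g L)
    (∑ l, (EuclideanSpace.proj l : EuclideanSpace ℝ ι →L[ℝ] ℝ).smulRight (g (l :: L) x)) x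

theorem isJet_pd {f : EuclideanSpace ℝ ι → F} (hf : ContDiff ℝ ∞ f) (U) :
    IsJet U fun L => pd L f := by
  intro L x _
  have := (differentiable_pd hf L x).hasFDerivAt
  rwa [fderiv_eq_sum_pd] at this

theorem IsJet.contDiffOn {U : Set (EuclideanSpace ℝ ι)} (hU : IsOpen U)
    {g : List ι → EuclideanSpace ℝ ι → F} (h : IsJet U g) (L : List ι) :
    ContDiffOn ℝ ∞ (g L) U := by
  rw [contDiffOn_infty]
  intro n
  induction n generalizing L with
  | zero =>
    exact contDiffOn_zero.2 fun x hx => (h L x hx).continuousAt.continuousWithinAt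
  | succ n ih =>
    have := contDiffOn_succ_iff_fderiv_of_isOpen (𝕜 := ℝ) (n := n) (f := g L) hU
    push_cast
    rw [this]
    refine ⟨fun x hx => (h L x hx).differentiableAt.differentiableWithinAt, by simp, ?_⟩
    have h2 : ContDiffOn ℝ n (fun x => ∑ l, (EuclideanSpace.proj l :
        EuclideanSpace ℝ ι →L[ℝ] ℝ).smulRight (g (l :: L) x)) U := by
      refine ContDiffOn.sum fun l _ => ?_
      exact contDiffOn_const.smulRight (ih (l :: L))
    exact h2.congr fun x hx => (h L x hx).fderiv

theorem IsJet.contDiff {g : List ι → EuclideanSpace ℝ ι → F} (h : IsJet Set.univ g) (L : List ι) :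
    ContDiff ℝ ∞ (g L) := contDiffOn_univ.1 (h.contDiffOn isOpen_univ L)

theorem IsJet.iteratedFDeriv_eq {U : Set (EuclideanSpace ℝ ι)} (hU : IsOpen U)
    {g : List ι → EuclideanSpace ℝ ι → F} (h : IsJet U g) (L : List ι) :
    ∀ x ∈ U, iteratedFDeriv ℝ L.length (g []) x
      (fun i => EuclideanSpace.basisFun ι ℝ (L.get i)) = g L x := by
  induction L with
  | nil => intro x _; simp
  | cons l L ih =>
    intro x hx
    have hc : ContDiffAt ℝ ∞ (g []) x := (h.contDiffOn hU []).contDiffAt (hU.mem_nhds hx)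
    have hd : DifferentiableAt ℝ (iteratedFDeriv ℝ L.length (g [])) x :=
      hc.differentiableAt_iteratedFDeriv (by exact_mod_cast ENat.natCast_lt_top _)
    change iteratedFDeriv ℝ (L.length + 1) (g []) x _ = _
    rw [iteratedFDeriv_succ_apply_left]
    have e1 : (fun y => iteratedFDeriv ℝ L.length (g []) y
        (fun i => EuclideanSpace.basisFun ι ℝ (L.get i))) =ᶠ[𝓝 x] g L :=
      Filter.eventuallyEq_of_mem (hU.mem_nhds hx) ih
    have e2 := e1.fderiv_eq (𝕜 := ℝ)
    have e3 : fderiv ℝ (fun y => iteratedFDeriv ℝ L.length (g []) y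
        (fun i => EuclideanSpace.basisFun ι ℝ (L.get i))) x
        (EuclideanSpace.basisFun ι ℝ l) =
        fderiv ℝ (iteratedFDeriv ℝ L.length (g [])) x (EuclideanSpace.basisFun ι ℝ l)
          (fun i => EuclideanSpace.basisFun ι ℝ (L.get i)) := by
      have := (hd.hasFDerivAt.continuousMultilinear_apply_const
        (fun i => EuclideanSpace.basisFun ι ℝ (L.get i))).fderiv
      rw [this]; rfl
    rw [e2, (h L x hx).fderiv] at e3
    refine Eq.trans e3.symm ?_
    exact sum_proj_smulRight_basisFun (fun i => g (i :: L) x) l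

theorem IsJet.multiDeriv_eq {U : Set (EuclideanSpace ℝ ι)} (hU : IsOpen U)
    {g : List ι → EuclideanSpace ℝ ι → F} (h : IsJet U g) (γ : ι → ℕ) {x} (hx : x ∈ U) :
    multiDeriv γ (g []) x = g (directions γ) x :=
  h.iteratedFDeriv_eq hU (directions γ) x hx

theorem IsJet.pd_eq {g : List ι → EuclideanSpace ℝ ι → F} (h : IsJet Set.univ g) (L : List ι) :
    pd L (g []) = g L := by
  induction L with
  | nil => rfl
  | cons l L ih =>
    funext x
    rw [pd_cons, ih, (h L x trivial).fderiv]
    exact sum_proj_smulRight_basisFun (fun i => g (i :: L) x) l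

theorem multiDeriv_eq_pd {f : EuclideanSpace ℝ ι → F} (hf : ContDiff ℝ ∞ f) (γ : ι → ℕ)
    (x : EuclideanSpace ℝ ι) : multiDeriv γ f x = pd (directions γ) f x :=
  (isJet_pd hf Set.univ).multiDeriv_eq isOpen_univ γ (Set.mem_univ x)

theorem count_directions [DecidableEq ι] (γ : ι → ℕ) (l : ι) : (directions γ).count l = γ l := by
  have : ∀ s : List ι, s.Nodup →
      (s.flatMap fun l => List.replicate (γ l) l).count l = if l ∈ s then γ l else 0 := by
    intro s
    induction s with
    | nil => simp
    | cons a s ih =>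
      intro hs
      rw [List.nodup_cons] at hs
      rw [List.flatMap_cons, List.count_append, ih hs.2, List.count_replicate]
      by_cases h : a = l
      · subst h; simp [hs.1]
      · simp [h, Ne.symm h]
  rw [directions, this _ (Finset.nodup_toList _)]
  simp

theorem directions_count_perm [DecidableEq ι] (L : List ι) :
    (directions fun l => L.count l).Perm L := by
  rw [List.perm_iff_count]
  intro a
  rw [count_directions]

theorem pd_eq_multiDeriv [DecidableEq ι] {f : EuclideanSpace ℝ ι → F} (hf : ContDiff ℝ ∞ f)
    (L : List ι) (x : EuclideanSpace ℝ ι) : pd L f x = multiDeriv (fun l => L.count l) f x := by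
  rw [multiDeriv_eq_pd hf, pd_perm hf (directions_count_perm L)]

theorem prod_map_directions {M : Type*} [CommMonoid M] (γ : ι → ℕ) (c : ι → M) :
    ((directions γ).map c).prod = ∏ l, c l ^ γ l := by
  have : ∀ s : List ι, ((s.flatMap fun l => List.replicate (γ l) l).map c).prod =
      (s.map fun l => c l ^ γ l).prod := by
    intro s
    induction s with
    | nil => simp
    | cons a s ih => simp [ih]
  rw [directions, this, Finset.prod_map_toList]

/-- A locally uniform limit of jets is a jet. Uniformity is expressed through a bound that is
continuous on `U` and multiplied by a factor tending to `0`. -/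
theorem IsJet.of_tendsto {U : Set (EuclideanSpace ℝ ι)} (hU : IsOpen U)
    {G : ℕ → List ι → EuclideanSpace ℝ ι → F} {g : List ι → EuclideanSpace ℝ ι → F}
    (hG : ∀ n, IsJet U (G n)) (b : List ι → EuclideanSpace ℝ ι → ℝ)
    (hb : ∀ L, ContinuousOn (b L) U) (ε : ℕ → ℝ) (hε : Tendsto ε atTop (𝓝 0))
    (hε0 : ∀ n, 0 ≤ ε n)
    (h : ∀ n L, ∀ x ∈ U, ‖G n L x - g L x‖ ≤ ε n * b L x) : IsJet U g := by
  intro L x hx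
  refine hasFDerivAt_of_tendstoLocallyUniformlyOn (l := atTop) hU (f := fun n => G n L)
    (f' := fun n x => ∑ l, (EuclideanSpace.proj l : EuclideanSpace ℝ ι →L[ℝ] ℝ).smulRight
      (G n (l :: L) x))
    (g' := fun x => ∑ l, (EuclideanSpace.proj l : EuclideanSpace ℝ ι →L[ℝ] ℝ).smulRight
      (g (l :: L) x)) ?_ (fun n y hy => hG n L y hy) ?_ hx
  · rw [Metric.tendstoLocallyUniformlyOn_iff]
    intro δ hδ y hy
    set B : EuclideanSpace ℝ ι → ℝ := fun y =>
      ∑ l, ‖(EuclideanSpace.proj l : EuclideanSpace ℝ ι →L[ℝ] ℝ)‖ * b (l :: L) y with hB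
    have hBc : ContinuousOn B U := by
      refine continuousOn_finsetSum _ fun l _ => continuousOn_const.mul (hb _)
    refine ⟨{z | B z < B y + 1} ∩ U, ?_, ?_⟩
    · refine Filter.inter_mem ?_ self_mem_nhdsWithin
      exact (hBc y hy).eventually_lt_const (lt_add_one _)
    · have hε' : Tendsto (fun n => ε n * (B y + 1)) atTop (𝓝 0) := by
        simpa using hε.mul_const (B y + 1)
      filter_upwards [hε'.eventually_lt_const hδ] with n hn z hz
      rw [dist_comm, dist_eq_norm, ← Finset.sum_sub_distrib]
      refine lt_of_le_of_lt (norm_sum_le _ _) (lt_of_le_of_lt (Finset.sum_le_sum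
        (g := fun l => ε n * (‖(EuclideanSpace.proj l : EuclideanSpace ℝ ι →L[ℝ] ℝ)‖
          * b (l :: L) z)) fun l _ => ?_) ?_)
      · have e : ∀ c c' : F, (EuclideanSpace.proj l : EuclideanSpace ℝ ι →L[ℝ] ℝ).smulRight c -
            (EuclideanSpace.proj l : EuclideanSpace ℝ ι →L[ℝ] ℝ).smulRight c' =
            (EuclideanSpace.proj l : EuclideanSpace ℝ ι →L[ℝ] ℝ).smulRight (c - c') := by
          intro c c'; ext v; simp [smul_sub]
        rw [e, ContinuousLinearMap.norm_smulRight_apply]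
        calc _ ≤ ‖(EuclideanSpace.proj l : EuclideanSpace ℝ ι →L[ℝ] ℝ)‖ *
              (ε n * b (l :: L) z) := by gcongr; exact h n (l :: L) z hz.2
          _ = _ := by ring
      · rw [← Finset.mul_sum]
        exact lt_of_le_of_lt (mul_le_mul_of_nonneg_left hz.1.le (hε0 n)) hn
  · intro y hy
    rw [tendsto_iff_norm_sub_tendsto_zero]
    refine squeeze_zero (fun _ => norm_nonneg _) (fun n => h n L y hy) ?_
    simpa using hε.mul_const (b L y)

end Calculus

/-! ### Coordinate norms and the weights of the integration by parts -/

section Weights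

variable {ι : Type*} [Fintype ι]

/-- The coordinate version `P_l(x) = ∑_k |x_k|^{a(l,k)}` of the norms `N_j`. -/
noncomputable def P (a : Matrix ι ι ℝ) (l : ι) (x : EuclideanSpace ℝ ι) : ℝ :=
  ∑ k, |x k| ^ a l k

/-- The coordinate version `P̂_l(ξ) = ∑_k |ξ_k|^{1/a(k,l)}` of the dual norms `N̂_j`. -/
noncomputable def Ph (a : Matrix ι ι ℝ) (l : ι) (ξ : EuclideanSpace ℝ ι) : ℝ :=
  ∑ k, |ξ k| ^ (1 / a k l)

theorem P_nonneg (a : Matrix ι ι ℝ) (l : ι) (x : EuclideanSpace ℝ ι) : 0 ≤ P a l x :=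
  Finset.sum_nonneg fun _ _ => Real.rpow_nonneg (abs_nonneg _) _

theorem Ph_nonneg (a : Matrix ι ι ℝ) (l : ι) (ξ : EuclideanSpace ℝ ι) : 0 ≤ Ph a l ξ :=
  Finset.sum_nonneg fun _ _ => Real.rpow_nonneg (abs_nonneg _) _

theorem one_add_Ph_pos (a : Matrix ι ι ℝ) (l : ι) (ξ : EuclideanSpace ℝ ι) : 0 < 1 + Ph a l ξ := by
  linarith [Ph_nonneg a l ξ]

theorem P_pos (a : Matrix ι ι ℝ) (l : ι) {x : EuclideanSpace ℝ ι} (hx : x ≠ 0) : 0 < P a l x := by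
  obtain ⟨k, hk⟩ : ∃ k, x k ≠ 0 := by
    by_contra! h
    exact hx (by ext k; exact h k)
  exact Finset.sum_pos' (fun _ _ => Real.rpow_nonneg (abs_nonneg _) _)
    ⟨k, Finset.mem_univ _, Real.rpow_pos_of_pos (abs_pos.2 hk) _⟩

theorem rpow_le_P (a : Matrix ι ι ℝ) (l k : ι) (x : EuclideanSpace ℝ ι) :
    |x k| ^ a l k ≤ P a l x :=
  Finset.single_le_sum (f := fun k => |x k| ^ a l k)
    (fun _ _ => Real.rpow_nonneg (abs_nonneg _) _) (Finset.mem_univ k)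

theorem rpow_le_Ph (a : Matrix ι ι ℝ) (l k : ι) (ξ : EuclideanSpace ℝ ι) :
    |ξ k| ^ (1 / a k l) ≤ Ph a l ξ :=
  Finset.single_le_sum (f := fun k => |ξ k| ^ (1 / a k l))
    (fun _ _ => Real.rpow_nonneg (abs_nonneg _) _) (Finset.mem_univ k)

theorem abs_le_Ph {a : Matrix ι ι ℝ} (ha : BasicHypothesis a) (l : ι) (ξ : EuclideanSpace ℝ ι) :
    |ξ l| ≤ Ph a l ξ := by
  have := rpow_le_Ph a l l ξ
  rwa [ha.diag, one_div_one, Real.rpow_one] at this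

theorem continuous_P {a : Matrix ι ι ℝ} (ha : BasicHypothesis a) (l : ι) : Continuous (P a l) := by
  refine continuous_finsetSum _ fun k _ => ?_
  exact Continuous.rpow_const (by fun_prop) fun _ => Or.inr (ha.pos _ _).le

theorem norm_le_sum_abs (x : EuclideanSpace ℝ ι) : ‖x‖ ≤ ∑ k, |x k| := by
  conv_lhs => rw [← (EuclideanSpace.basisFun ι ℝ).sum_repr x]
  refine (norm_sum_le _ _).trans (Finset.sum_le_sum fun k _ => ?_)
  rw [norm_smul, (EuclideanSpace.basisFun ι ℝ).orthonormal.1 k]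
  simp

/-- A single integer exponent dominating all `a(j,k)` and `1/a(j,k)`. -/
theorem exists_exponent_bound (a : Matrix ι ι ℝ) :
    ∃ m : ℕ, 1 ≤ m ∧ ∀ j k, a j k ≤ m ∧ 1 / a j k ≤ m := by
  obtain ⟨m, hm⟩ := exists_nat_ge (1 + ∑ j, ∑ k, (|a j k| + |1 / a j k|))
  have h0 : ∀ j k, |a j k| + |1 / a j k| ≤ ∑ j, ∑ k, (|a j k| + |1 / a j k|) := fun j k =>
    (Finset.single_le_sum (f := fun k => |a j k| + |1 / a j k|) (fun _ _ => by positivity)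
      (Finset.mem_univ k)).trans
    (Finset.single_le_sum (f := fun j => ∑ k, (|a j k| + |1 / a j k|))
      (fun _ _ => Finset.sum_nonneg fun _ _ => by positivity) (Finset.mem_univ j))
  refine ⟨m, ?_, fun j k => ?_⟩
  · have : (1 : ℝ) ≤ m := by
      refine le_trans (le_add_of_nonneg_right ?_) hm
      exact Finset.sum_nonneg fun _ _ => Finset.sum_nonneg fun _ _ => by positivity
    exact_mod_cast this
  · have h1 := h0 j k
    have h2 := le_abs_self (a j k)
    have h3 := le_abs_self (1 / a j k)
    have h4 := abs_nonneg (a j k)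
    have h5 := abs_nonneg (1 / a j k)
    constructor <;> linarith

theorem rpow_le_pow_of_one_le {y t : ℝ} {m : ℕ} (hy : 1 ≤ y) (ht : t ≤ m) : y ^ t ≤ y ^ m := by
  rw [← Real.rpow_natCast]
  exact Real.rpow_le_rpow_of_exponent_le hy ht

variable [DecidableEq ι]

/-- The part `1 + ∑_{k ∉ D} |ξ_k|^{1/a(k,l)}` of the weight `1 + P̂_l(ξ)` which does not depend on
the coordinates in `D`. -/
noncomputable def A (a : Matrix ι ι ℝ) (D : Finset ι) (l : ι) (ξ : EuclideanSpace ℝ ι) : ℝ :=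
  1 + ∑ k with k ∉ D, |ξ k| ^ (1 / a k l)

/-- The coordinate `ξ_l`, shifted into the complex plane by the weight `A`, on the side that
depends on the sign of `x_l`. -/
noncomputable def u (a : Matrix ι ι ℝ) (D : Finset ι) (x : EuclideanSpace ℝ ι) (l : ι)
    (ξ : EuclideanSpace ℝ ι) : ℂ :=
  ξ l - Complex.I * (SignType.sign (x l) : ℝ) * A a D l ξ

/-- The factor `1 + 2πi x_l u_l`, of size `≈ 1 + |x_l| (|ξ_l| + A)`, with
`∂_l (u_l e^{2πi⟨ξ, x⟩}) = w_l e^{2πi⟨ξ, x⟩}`. -/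
noncomputable def w (a : Matrix ι ι ℝ) (D : Finset ι) (x : EuclideanSpace ℝ ι) (l : ι)
    (ξ : EuclideanSpace ℝ ι) : ℂ :=
  1 + 2 * π * Complex.I * x l * u a D x l ξ

theorem one_le_A (a : Matrix ι ι ℝ) (D : Finset ι) (l : ι) (ξ : EuclideanSpace ℝ ι) :
    1 ≤ A a D l ξ :=
  le_add_of_nonneg_right (Finset.sum_nonneg fun _ _ => Real.rpow_nonneg (abs_nonneg _) _)

theorem rpow_le_A (a : Matrix ι ι ℝ) (D : Finset ι) (l k : ι) (hk : k ∉ D)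
    (ξ : EuclideanSpace ℝ ι) : |ξ k| ^ (1 / a k l) ≤ A a D l ξ := by
  have := Finset.single_le_sum (s := Finset.univ.filter (· ∉ D))
    (f := fun k => |ξ k| ^ (1 / a k l))
    (fun _ _ => Real.rpow_nonneg (abs_nonneg _) _) (Finset.mem_filter.2 ⟨Finset.mem_univ k, hk⟩)
  rw [A]; linarith

theorem continuous_A {a : Matrix ι ι ℝ} (ha : BasicHypothesis a) (D : Finset ι) (l : ι) :
    Continuous (A a D l) := by
  refine continuous_const.add (continuous_finsetSum _ fun k _ => ?_)
  exact Continuous.rpow_const (by fun_prop) fun _ => Or.inr (one_div_pos.2 (ha.pos _ _)).le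

theorem norm_u_le {a : Matrix ι ι ℝ} (ha : BasicHypothesis a) (D : Finset ι)
    (x : EuclideanSpace ℝ ι) {l : ι} (hl : l ∈ D) (ξ : EuclideanSpace ℝ ι) :
    ‖u a D x l ξ‖ ≤ 1 + Ph a l ξ := by
  have h1 : |ξ l| + ∑ k with k ∉ D, |ξ k| ^ (1 / a k l) ≤ Ph a l ξ := by
    have h2 : l ∉ Finset.univ.filter (· ∉ D) := by simp [hl]
    have h3 := Finset.sum_insert (f := fun k => |ξ k| ^ (1 / a k l)) h2
    simp only [ha.diag, one_div_one, Real.rpow_one] at h3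
    rw [← h3]
    exact Finset.sum_le_sum_of_subset_of_nonneg (Finset.subset_univ _)
      fun _ _ _ => Real.rpow_nonneg (abs_nonneg _) _
  have h4 : ‖((SignType.sign (x l) : ℝ) : ℂ)‖ ≤ 1 := by
    rcases lt_trichotomy (x l) 0 with h | h | h <;> simp [h]
  calc ‖u a D x l ξ‖ ≤ ‖(ξ l : ℂ)‖ + ‖Complex.I * (SignType.sign (x l) : ℝ) * A a D l ξ‖ :=
        norm_sub_le _ _
    _ ≤ |ξ l| + 1 * 1 * A a D l ξ := by
        rw [norm_mul, norm_mul, Complex.norm_I, Complex.norm_real, Complex.norm_real (A a D l ξ),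
          Real.norm_eq_abs, Real.norm_eq_abs (A a D l ξ),
          abs_of_nonneg (zero_le_one.trans (one_le_A a D l ξ))]
        have := one_le_A a D l ξ
        gcongr
    _ ≤ 1 + Ph a l ξ := by rw [A]; linarith

theorem w_eq (a : Matrix ι ι ℝ) (D : Finset ι) (x : EuclideanSpace ℝ ι) (l : ι)
    (ξ : EuclideanSpace ℝ ι) :
    w a D x l ξ = ⟨1 + 2 * π * (|x l| * A a D l ξ), 2 * π * (x l * ξ l)⟩ := by
  have h : ((x l : ℝ) : ℂ) * ((SignType.sign (x l) : ℝ) : ℂ) = (|x l| : ℝ) := by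
    rw [← Complex.ofReal_mul, self_mul_sign]
  rw [Complex.mk_eq_add_mul_I, w, u]
  push_cast
  linear_combination (-2 * π * Complex.I ^ 2 * A a D l ξ) * h +
    (-2 * π * (|x l| : ℝ) * A a D l ξ) * Complex.I_sq

theorem norm_w_bounds (a : Matrix ι ι ℝ) (D : Finset ι) (x : EuclideanSpace ℝ ι) (l : ι)
    (ξ : EuclideanSpace ℝ ι) : 1 ≤ ‖w a D x l ξ‖ ∧ |x l| * A a D l ξ ≤ ‖w a D x l ξ‖ ∧
      |x l| * |ξ l| ≤ ‖w a D x l ξ‖ := by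
  have hp : 1 ≤ 2 * π := by linarith [Real.pi_gt_three]
  have hA : 0 ≤ |x l| * A a D l ξ :=
    mul_nonneg (abs_nonneg _) (zero_le_one.trans (one_le_A a D l ξ))
  have h1 := Complex.abs_re_le_norm (w a D x l ξ)
  have h2 := Complex.abs_im_le_norm (w a D x l ξ)
  rw [w_eq] at h1 h2 ⊢
  simp only at h1 h2
  rw [abs_mul, abs_of_nonneg (zero_le_one.trans hp), abs_mul] at h2
  have h3 := (le_abs_self _).trans h1
  have h4 := mul_le_mul_of_nonneg_right hp hA
  have h5 := mul_le_mul_of_nonneg_right hp (mul_nonneg (abs_nonneg (x l)) (abs_nonneg (ξ l)))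
  refine ⟨?_, ?_, ?_⟩ <;> linarith

theorem w_ne_zero (a : Matrix ι ι ℝ) (D : Finset ι) (x : EuclideanSpace ℝ ι) (l : ι)
    (ξ : EuclideanSpace ℝ ι) : w a D x l ξ ≠ 0 :=
  norm_pos_iff.1 (zero_lt_one.trans_le (norm_w_bounds a D x l ξ).1)

/-- The total gain `∏_{l ∈ D} |w_l|` of one integration by parts in each direction of `D`. -/
noncomputable def G (a : Matrix ι ι ℝ) (D : Finset ι) (x ξ : EuclideanSpace ℝ ι) : ℝ :=
  ∏ l ∈ D, ‖w a D x l ξ‖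

theorem one_le_G (a : Matrix ι ι ℝ) (D : Finset ι) (x ξ : EuclideanSpace ℝ ι) :
    1 ≤ G a D x ξ := by
  have := Finset.prod_le_prod (s := D) (f := fun _ => (1 : ℝ)) (g := fun l => ‖w a D x l ξ‖)
    (fun _ _ => zero_le_one) fun l _ => (norm_w_bounds a D x l ξ).1
  simpa [G] using this

theorem norm_w_le_G (a : Matrix ι ι ℝ) (D : Finset ι) (x ξ : EuclideanSpace ℝ ι) {l : ι}
    (hl : l ∈ D) : ‖w a D x l ξ‖ ≤ G a D x ξ := by
  rw [G, ← Finset.mul_prod_erase D _ hl]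
  refine le_mul_of_one_le_right (norm_nonneg _) ?_
  have := Finset.prod_le_prod (s := D.erase l) (f := fun _ => (1 : ℝ))
    (g := fun l => ‖w a D x l ξ‖)
    (fun _ _ => zero_le_one) fun l _ => (norm_w_bounds a D x l ξ).1
  simpa using this

/-- The gain in the region `|x_k| ≤ 1`. Integration by parts takes place in the coordinates `k`
for which `|x_k|` is the largest term of `P_k(x)`; by the basic hypothesis they include every `k`
for which `|x_k|^{a(j,k)}` is the largest term of some `P_j(x)`. -/
theorem gain_of_le_one {a : Matrix ι ι ℝ} (ha : BasicHypothesis a) {m : ℕ} (hm1 : 1 ≤ m)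
    (hm : ∀ j k, a j k ≤ m ∧ 1 / a j k ≤ m) (x : EuclideanSpace ℝ ι) (hx : x ≠ 0)
    (h1 : ∀ k, |x k| ≤ 1) :
    ∃ D : Finset ι, (∀ l ∈ D, x l ≠ 0) ∧ ∀ ξ,
      (∀ j, |ξ j| * P a j x ≤ Fintype.card ι * G a D x ξ ^ m) ∧
      (∀ l, (1 + Ph a l ξ) * P a l x ≤ Fintype.card ι +
        Fintype.card ι ^ 2 * (Fintype.card ι * G a D x ξ ^ m) ^ m) ∧
      1 + ‖x‖ ≤ 1 + Fintype.card ι := by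
  obtain ⟨k₀, hk₀⟩ : ∃ k, x k ≠ 0 := by
    by_contra! h
    exact hx (by ext k; exact h k)
  have : Nonempty ι := ⟨k₀⟩
  have hn0 : ∀ k, 0 ≤ |x k| := fun k => abs_nonneg _
  have hN : (1 : ℝ) ≤ Fintype.card ι := by exact_mod_cast Fintype.card_pos
  -- `κ j` is the coordinate of the largest term of `P_j(x)`
  choose κ hκ using fun j => Finite.exists_max fun k => |x k| ^ a j k
  have hκ0 : ∀ j, x (κ j) ≠ 0 := by
    intro j h
    have := hκ j k₀
    rw [h, abs_zero, Real.zero_rpow (ha.pos _ _).ne'] at this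
    exact absurd this (not_le.2 (Real.rpow_pos_of_pos (abs_pos.2 hk₀) _))
  have hκD : ∀ j l, |x l| ^ a (κ j) l ≤ |x (κ j)| := by
    intro j l
    have h2 : (|x l| ^ a (κ j) l) ^ a j (κ j) ≤ |x (κ j)| ^ a j (κ j) := by
      rw [← Real.rpow_mul (hn0 l), mul_comm]
      refine le_trans ?_ (hκ j l)
      rcases (hn0 l).eq_or_lt with h | h
      · rw [← h, Real.zero_rpow (mul_pos (ha.pos _ _) (ha.pos _ _)).ne',
          Real.zero_rpow (ha.pos _ _).ne']
      · exact Real.rpow_le_rpow_of_exponent_ge h (h1 l) (ha.submul _ _ _)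
    exact (Real.rpow_le_rpow_iff (Real.rpow_nonneg (hn0 l) _) (hn0 _) (ha.pos _ _)).1 h2
  have hPle : ∀ j, P a j x ≤ Fintype.card ι * |x (κ j)| ^ a j (κ j) := by
    intro j
    refine (Finset.sum_le_sum fun k _ => hκ j k).trans ?_
    simp
  set D : Finset ι := Finset.univ.filter fun k => x k ≠ 0 ∧ ∀ l, |x l| ^ a k l ≤ |x k| with hD
  have hmem : ∀ j, κ j ∈ D := fun j => by simp [hD, hκ0 j, hκD j]
  refine ⟨D, fun l hl => (Finset.mem_filter.1 hl).2.1, fun ξ => ?_⟩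
  have hG := one_le_G a D x ξ
  have hG0 : 0 ≤ G a D x ξ := zero_le_one.trans hG
  have A1 : ∀ j, |ξ j| * P a j x ≤ Fintype.card ι * G a D x ξ ^ m := by
    intro j
    by_cases hj : j ∈ D
    · have h2 : P a j x ≤ Fintype.card ι * |x j| := by
        refine (Finset.sum_le_sum fun k _ => (Finset.mem_filter.1 hj).2.2 k).trans ?_
        simp
      calc |ξ j| * P a j x ≤ |ξ j| * (Fintype.card ι * |x j|) := by gcongr
        _ = Fintype.card ι * (|x j| * |ξ j|) := by ring
        _ ≤ Fintype.card ι * G a D x ξ ^ m := by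
          gcongr
          exact ((norm_w_bounds a D x j ξ).2.2.trans (norm_w_le_G a D x ξ hj)).trans
            (le_self_pow₀ hG (by omega))
    · -- for `j ∉ D` the frequency `ξ_j` occurs in the weight `A` of the direction `κ j ∈ D`
      have h2 : |x (κ j)| * |ξ j| ^ (1 / a j (κ j)) ≤ G a D x ξ :=
        (mul_le_mul_of_nonneg_left (rpow_le_A a D (κ j) j hj ξ) (hn0 _)).trans
          ((norm_w_bounds a D x (κ j) ξ).2.1.trans (norm_w_le_G a D x ξ (hmem j)))
      have h3 : |x (κ j)| ^ a j (κ j) * |ξ j| ≤ G a D x ξ ^ m := by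
        refine le_trans ?_ (rpow_le_pow_of_one_le hG (hm j (κ j)).1)
        refine le_trans (le_of_eq ?_) (Real.rpow_le_rpow
          (mul_nonneg (hn0 _) (Real.rpow_nonneg (abs_nonneg _) _)) h2 (ha.pos j (κ j)).le)
        rw [Real.mul_rpow (hn0 _) (Real.rpow_nonneg (abs_nonneg _) _), ← Real.rpow_mul
          (abs_nonneg _), one_div_mul_cancel (ha.pos _ _).ne', Real.rpow_one]
      calc |ξ j| * P a j x ≤ |ξ j| * (Fintype.card ι * |x (κ j)| ^ a j (κ j)) := by
            gcongr; exact hPle j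
        _ = Fintype.card ι * (|x (κ j)| ^ a j (κ j) * |ξ j|) := by ring
        _ ≤ _ := by gcongr
  refine ⟨A1, fun l => ?_, ?_⟩
  · have hT1 : 1 ≤ Fintype.card ι * G a D x ξ ^ m :=
      one_le_mul_of_one_le_of_one_le hN (one_le_pow₀ hG)
    -- the bound on `|ξ_j| P_j(x)` suffices, since `|x_k|^{a(l,k) a(j,l)} ≤ |x_k|^{a(j,k)} ≤ P_j(x)`
    -- for `k = κ l`, by the basic hypothesis
    have h2 : ∀ j, P a l x * |ξ j| ^ (1 / a j l) ≤
        Fintype.card ι * (Fintype.card ι * G a D x ξ ^ m) ^ m := by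
      intro j
      have h3 : |x (κ l)| ^ (a l (κ l) * a j l) ≤ P a j x := by
        refine le_trans ?_ (rpow_le_P a j (κ l) x)
        refine Real.rpow_le_rpow_of_exponent_ge (abs_pos.2 (hκ0 l)) (h1 _) ?_
        rw [mul_comm]; exact ha.submul _ _ _
      have h4 : |x (κ l)| ^ (a l (κ l)) * |ξ j| ^ (1 / a j l) ≤
          (Fintype.card ι * G a D x ξ ^ m) ^ m := by
        refine le_trans ?_ (rpow_le_pow_of_one_le hT1 (hm j l).2)
        refine le_trans (le_of_eq ?_) (Real.rpow_le_rpow (mul_nonneg (Real.rpow_nonneg (hn0 _) _)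
          (abs_nonneg _)) ((mul_le_mul_of_nonneg_right h3 (abs_nonneg (ξ j))).trans
          ((mul_comm _ _).trans_le (A1 j))) (one_div_pos.2 (ha.pos j l)).le)
        rw [Real.mul_rpow (Real.rpow_nonneg (hn0 _) _) (abs_nonneg _), ← Real.rpow_mul (hn0 _),
          mul_assoc, mul_one_div_cancel (ha.pos _ _).ne', mul_one]
      calc P a l x * |ξ j| ^ (1 / a j l) ≤
            (Fintype.card ι * |x (κ l)| ^ a l (κ l)) * |ξ j| ^ (1 / a j l) :=
            mul_le_mul_of_nonneg_right (hPle l) (Real.rpow_nonneg (abs_nonneg _) _)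
        _ = Fintype.card ι * (|x (κ l)| ^ a l (κ l) * |ξ j| ^ (1 / a j l)) := by ring
        _ ≤ _ := by gcongr
    have h5 : P a l x ≤ Fintype.card ι := by
      refine (hPle l).trans (mul_le_of_le_one_right (Nat.cast_nonneg _) ?_)
      exact Real.rpow_le_one (hn0 _) (h1 _) (ha.pos _ _).le
    have h6 : P a l x * Ph a l ξ ≤ Fintype.card ι ^ 2 * (Fintype.card ι * G a D x ξ ^ m) ^ m := by
      rw [Ph, Finset.mul_sum]
      refine (Finset.sum_le_sum fun j _ => h2 j).trans (le_of_eq ?_)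
      simp; ring
    linarith
  · have h2 := norm_le_sum_abs x
    have h3 : ∑ k, |x k| ≤ Fintype.card ι := (Finset.sum_le_sum fun k _ => h1 k).trans (by simp)
    linarith

/-- The gain in the region where some `|x_k| > 1`: one direction of integration by parts, that of
the largest coordinate, is enough. -/
theorem gain_of_one_lt {a : Matrix ι ι ℝ} (ha : BasicHypothesis a) {m : ℕ} (hm1 : 1 ≤ m)
    (hm : ∀ j k, a j k ≤ m ∧ 1 / a j k ≤ m) (x : EuclideanSpace ℝ ι) {k₀ : ι}
    (h1 : 1 < |x k₀|) :
    ∃ D : Finset ι, (∀ l ∈ D, x l ≠ 0) ∧ ∀ ξ,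
      (∀ j, |ξ j| * P a j x ≤ G a D x ξ ^ m * (Fintype.card ι * G a D x ξ ^ m)) ∧
      (∀ l, (1 + Ph a l ξ) * P a l x ≤ (1 + Fintype.card ι * (G a D x ξ ^ m) ^ m) *
        (Fintype.card ι * G a D x ξ ^ m)) ∧
      1 + ‖x‖ ≤ 1 + Fintype.card ι * G a D x ξ := by
  have : Nonempty ι := ⟨k₀⟩
  have hn0 : ∀ k, 0 ≤ |x k| := fun k => abs_nonneg _
  obtain ⟨l₀, hl₀⟩ := Finite.exists_max fun k => |x k|
  have h1' : 1 < |x l₀| := h1.trans_le (hl₀ k₀)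
  refine ⟨{l₀}, ?_, fun ξ => ?_⟩
  · intro l hl
    rw [Finset.mem_singleton.1 hl, ← abs_pos]
    exact zero_lt_one.trans h1'
  set g := G a {l₀} x ξ with hg
  have hG : 1 ≤ g := one_le_G a _ x ξ
  have hG0 : 0 ≤ g := zero_le_one.trans hG
  have hgm : 1 ≤ g ^ m := one_le_pow₀ hG
  have hwg : ‖w a {l₀} x l₀ ξ‖ ≤ g := norm_w_le_G a _ x ξ (Finset.mem_singleton_self _)
  obtain ⟨-, hw2, hw3⟩ := norm_w_bounds a {l₀} x l₀ ξ
  have hA1 := one_le_A a {l₀} l₀ ξ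
  have hxg : |x l₀| ≤ g := (le_mul_of_one_le_right (hn0 _) hA1).trans (hw2.trans hwg)
  have hAg : A a {l₀} l₀ ξ ≤ g :=
    (le_mul_of_one_le_left (zero_le_one.trans hA1) h1'.le).trans (hw2.trans hwg)
  have hξ : ∀ j, |ξ j| ≤ g ^ m := by
    intro j
    by_cases hj : j = l₀
    · subst hj
      exact ((le_mul_of_one_le_left (abs_nonneg _) h1'.le).trans (hw3.trans hwg)).trans
        (le_self_pow₀ hG (by omega))
    · have h2 := (rpow_le_A a {l₀} l₀ j (by simpa using hj) ξ).trans hAg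
      have h3 := Real.rpow_le_rpow (Real.rpow_nonneg (abs_nonneg _) _) h2 (ha.pos j l₀).le
      rw [← Real.rpow_mul (abs_nonneg _), one_div_mul_cancel (ha.pos _ _).ne',
        Real.rpow_one] at h3
      exact h3.trans (rpow_le_pow_of_one_le hG (hm _ _).1)
  have hP : ∀ j, P a j x ≤ Fintype.card ι * g ^ m := by
    intro j
    refine (Finset.sum_le_sum (g := fun _ => g ^ m) fun k _ => ?_).trans (by simp)
    exact (Real.rpow_le_rpow (hn0 k) ((hl₀ k).trans hxg) (ha.pos _ _).le).trans
      (rpow_le_pow_of_one_le hG (hm _ _).1)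
  have hPh : ∀ l, Ph a l ξ ≤ Fintype.card ι * (g ^ m) ^ m := by
    intro l
    refine (Finset.sum_le_sum (g := fun _ => (g ^ m) ^ m) fun k _ => ?_).trans (by simp)
    exact (Real.rpow_le_rpow (abs_nonneg _) (hξ k) (one_div_pos.2 (ha.pos _ _)).le).trans
      (rpow_le_pow_of_one_le hgm (hm _ _).2)
  refine ⟨fun j => mul_le_mul (hξ j) (hP j) (P_nonneg _ _ _) (zero_le_one.trans hgm),
    fun l => mul_le_mul (by linarith [hPh l]) (hP l) (P_nonneg _ _ _) (by positivity), ?_⟩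
  have h2 := norm_le_sum_abs x
  have h3 : ∑ k, |x k| ≤ Fintype.card ι * g :=
    (Finset.sum_le_sum fun k _ => (hl₀ k).trans hxg).trans (by simp)
  linarith

/-- For every `x ≠ 0` there is a set `D` of directions such that a power of the gain `G` of
integration by parts in these directions controls all frequencies on the scale `1 / P_j(x)`, the
symbol weights `1 + P̂_l`, and `1 + |x|`. -/
theorem exists_gain {a : Matrix ι ι ℝ} (ha : BasicHypothesis a) :
    ∃ (C : ℝ) (c : ℕ), 1 ≤ C ∧ ∀ x : EuclideanSpace ℝ ι, x ≠ 0 →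
      ∃ D : Finset ι, (∀ l ∈ D, x l ≠ 0) ∧ ∀ ξ,
        (∀ j, |ξ j| * P a j x ≤ C * G a D x ξ ^ c) ∧
        (∀ l, (1 + Ph a l ξ) * P a l x ≤ C * G a D x ξ ^ c) ∧
        1 + ‖x‖ ≤ C * G a D x ξ ^ c := by
  obtain ⟨m, hm1, hm⟩ := exists_exponent_bound a
  set n : ℝ := ((Fintype.card ι : ℕ) : ℝ) with hn
  have hn0 : 0 ≤ n := Nat.cast_nonneg _
  refine ⟨1 + n + n ^ 2 + n ^ 2 * n ^ m, m * m + m, ?_, fun x hx => ?_⟩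
  · have : 0 ≤ n ^ 2 * n ^ m := by positivity
    nlinarith [sq_nonneg n]
  have hmm : m ≤ m * m := Nat.le_mul_of_pos_left m hm1
  by_cases h1 : ∀ k, |x k| ≤ 1
  · obtain ⟨D, hD, h⟩ := gain_of_le_one ha hm1 hm x hx h1
    refine ⟨D, hD, fun ξ => ?_⟩
    obtain ⟨e1, e2, e3⟩ := h ξ
    have hG := one_le_G a D x ξ
    set g := G a D x ξ
    have hg0 : 0 ≤ g := zero_le_one.trans hG
    have p1 : g ^ m ≤ g ^ (m * m + m) := pow_le_pow_right₀ hG (by omega)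
    have p2 : g ^ (m * m) ≤ g ^ (m * m + m) := pow_le_pow_right₀ hG (by omega)
    have p3 : 1 ≤ g ^ (m * m + m) := one_le_pow₀ hG
    have q1 := mul_le_mul_of_nonneg_left p1 hn0
    have q2 := mul_le_mul_of_nonneg_left p2 (show 0 ≤ n ^ 2 * n ^ m by positivity)
    have q3 := mul_le_mul_of_nonneg_left p3 hn0
    have q4 := mul_le_mul_of_nonneg_left p3 (show 0 ≤ n ^ 2 by positivity)
    have q5 := mul_le_mul_of_nonneg_left p3 (show 0 ≤ n ^ 2 * n ^ m by positivity)
    have q6 : 0 ≤ n ^ 2 * n ^ m := by positivity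
    have q7 : 0 ≤ n ^ 2 := by positivity
    refine ⟨fun j => (e1 j).trans ?_, fun l => (e2 l).trans ?_, e3.trans ?_⟩
    · linarith
    · rw [← hn, mul_pow, ← pow_mul]; linarith
    · rw [← hn]; linarith
  · push Not at h1
    obtain ⟨k₀, hk₀⟩ := h1
    obtain ⟨D, hD, h⟩ := gain_of_one_lt ha hm1 hm x hk₀
    refine ⟨D, hD, fun ξ => ?_⟩
    obtain ⟨e1, e2, e3⟩ := h ξ
    have hG := one_le_G a D x ξ
    set g := G a D x ξ
    have hg0 : 0 ≤ g := zero_le_one.trans hG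
    have p0 : g ≤ g ^ (m * m + m) := le_self_pow₀ hG (by omega)
    have p1 : g ^ m ≤ g ^ (m * m + m) := pow_le_pow_right₀ hG (by omega)
    have p2 : g ^ (m + m) ≤ g ^ (m * m + m) := pow_le_pow_right₀ hG (by omega)
    have p3 : 1 ≤ g ^ (m * m + m) := one_le_pow₀ hG
    have q0 := mul_le_mul_of_nonneg_left p0 hn0
    have q1 := mul_le_mul_of_nonneg_left p1 hn0
    have q2 := mul_le_mul_of_nonneg_left p2 hn0
    have q3 := mul_le_mul_of_nonneg_left p3 hn0
    have q4 : 0 ≤ n ^ 2 * g ^ (m * m + m) := by positivity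
    have q5 : 0 ≤ n ^ 2 * n ^ m * g ^ (m * m + m) := by positivity
    refine ⟨fun j => (e1 j).trans ?_, fun l => (e2 l).trans ?_, e3.trans ?_⟩
    · have : g ^ m * (n * g ^ m) = n * g ^ (m + m) := by rw [pow_add]; ring
      rw [this]; linarith
    · have : (1 + n * (g ^ m) ^ m) * (n * g ^ m) = n * g ^ m + n ^ 2 * g ^ (m * m + m) := by
        rw [pow_add, pow_mul]; ring
      rw [this]; linarith
    · rw [← hn]; linarith

end Weights

section Recurrence

variable {ι : Type*} [DecidableEq ι]

/-- Iterating the recurrence that an integration by parts in a direction `l ∈ D` yields, until all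
the exponents `p l` are at least `M`. -/
theorem exists_bound_of_recurrence (D : Finset ι) (M : ℕ) (C : List ι → ℝ) :
    ∃ K : ℝ, 0 ≤ K ∧ ∀ (I : List ι → (ι → ℕ) → ℂ) (B : ℝ), 0 ≤ B →
      (∀ L p, ∀ l ∈ D, (∀ k ∈ L, k ∈ D) →
        I L p = ((p l : ℂ) + 1 - L.count l) * I L (p + Pi.single l 1)
          - ((p l : ℂ) + 1) * I L (p + Pi.single l 2) - I (l :: L) (p + Pi.single l 1)) →
      (∀ L p, (∀ k ∈ L, k ∈ D) → (∀ l ∈ D, M ≤ p l) → ‖I L p‖ ≤ C L * B) →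
      ‖I [] 0‖ ≤ K * B := by
  -- induction on the total deficit `∑ (M - p l)`, which each use of the recurrence lowers
  have key : ∀ (n : ℕ) (L : List ι) (p : ι → ℕ), (∀ k ∈ L, k ∈ D) → ∑ l ∈ D, (M - p l) ≤ n →
      ∃ K : ℝ, 0 ≤ K ∧ ∀ (I : List ι → (ι → ℕ) → ℂ) (B : ℝ), 0 ≤ B →
      (∀ L p, ∀ l ∈ D, (∀ k ∈ L, k ∈ D) →
        I L p = ((p l : ℂ) + 1 - L.count l) * I L (p + Pi.single l 1)
          - ((p l : ℂ) + 1) * I L (p + Pi.single l 2) - I (l :: L) (p + Pi.single l 1)) →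
      (∀ L p, (∀ k ∈ L, k ∈ D) → (∀ l ∈ D, M ≤ p l) → ‖I L p‖ ≤ C L * B) →
      ‖I L p‖ ≤ K * B := by
    intro n
    induction n with
    | zero =>
      intro L p hL h
      have h0 : ∀ l ∈ D, M ≤ p l := by
        intro l hl
        have := (Finset.sum_eq_zero_iff.1 (Nat.le_zero.1 h)) l hl
        omega
      refine ⟨|C L|, abs_nonneg _, fun I B hB _ h2 => (h2 L p hL h0).trans ?_⟩
      gcongr
      exact le_abs_self _
    | succ n ih =>
      intro L p hL h
      by_cases h0 : ∀ l ∈ D, M ≤ p l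
      · refine ⟨|C L|, abs_nonneg _, fun I B hB _ h2 => (h2 L p hL h0).trans ?_⟩
        gcongr
        exact le_abs_self _
      push Not at h0
      obtain ⟨l, hl, hpl⟩ := h0
      have hdec : ∀ r, 1 ≤ r → ∑ k ∈ D, (M - (p + Pi.single l r : ι → ℕ) k) ≤ n := by
        intro r hr
        refine Nat.lt_succ_iff.1 (lt_of_lt_of_le (Finset.sum_lt_sum (fun k _ => ?_)
          ⟨l, hl, ?_⟩) h)
        · simp only [Pi.add_apply]; omega
        · simp only [Pi.add_apply, Pi.single_eq_same]; omega
      have hL' : ∀ k ∈ l :: L, k ∈ D := by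
        intro k hk
        rcases List.mem_cons.1 hk with rfl | hk
        exacts [hl, hL k hk]
      obtain ⟨K1, hK1, H1⟩ := ih L (p + Pi.single l 1) hL (hdec 1 le_rfl)
      obtain ⟨K2, hK2, H2⟩ := ih L (p + Pi.single l 2) hL (hdec 2 (by norm_num))
      obtain ⟨K3, hK3, H3⟩ := ih (l :: L) (p + Pi.single l 1) hL' (hdec 1 le_rfl)
      refine ⟨‖((p l : ℂ) + 1 - L.count l)‖ * K1 + ‖((p l : ℂ) + 1)‖ * K2 + K3, by positivity,
        fun I B hB h1 h2 => ?_⟩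
      rw [h1 L p l hl hL]
      refine (norm_sub_le _ _).trans ?_
      have e := norm_sub_le (((p l : ℂ) + 1 - L.count l) * I L (p + Pi.single l 1))
        (((p l : ℂ) + 1) * I L (p + Pi.single l 2))
      rw [norm_mul, norm_mul] at e
      have g1 := mul_le_mul_of_nonneg_left (H1 I B hB h1 h2)
        (norm_nonneg ((p l : ℂ) + 1 - L.count l))
      have g2 := mul_le_mul_of_nonneg_left (H2 I B hB h1 h2) (norm_nonneg ((p l : ℂ) + 1))
      have g3 := H3 I B hB h1 h2
      nlinarith
  exact key _ [] 0 (by simp) le_rfl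

end Recurrence

/-! ### Integration by parts for oscillatory integrals -/

section Oscillatory

variable {ι : Type*} [Fintype ι]

/-- The oscillatory integral `x ↦ ∫ e^{2πi⟨ξ, x⟩} f(ξ) dξ`. -/
noncomputable def osc (f : EuclideanSpace ℝ ι → ℂ) (x : EuclideanSpace ℝ ι) : ℂ :=
  ∫ ξ, Complex.exp (2 * π * Complex.I * (inner ℝ ξ x : ℝ)) * f ξ

theorem norm_exp_inner (ξ x : EuclideanSpace ℝ ι) :
    ‖Complex.exp (2 * π * Complex.I * (inner ℝ ξ x : ℝ))‖ = 1 := by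
  have : (2 * π * Complex.I * (inner ℝ ξ x : ℝ) : ℂ) =
      ((2 * π * inner ℝ ξ x : ℝ) : ℂ) * Complex.I := by
    push_cast; ring
  rw [this, Complex.norm_exp_ofReal_mul_I]

/-- The symbol bounds `|∂^L f| ≤ C_L W ∏_{l ∈ L} (1 + P̂_l)⁻¹` with weight `W`. -/
def SymbolBound (a : Matrix ι ι ℝ) (C : List ι → ℝ) (W : EuclideanSpace ℝ ι → ℝ)
    (f : EuclideanSpace ℝ ι → ℂ) : Prop :=
  ∀ L ξ, ‖pd L f ξ‖ ≤ C L * W ξ / (L.map fun l => 1 + Ph a l ξ).prod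

/-- The bound `∏_j P_j(x)⁻¹ ∏_{l ∈ Γ} P_l(x)⁻¹ (1 + |x|)^{-M}` for the derivative `∂^Γ` of a
kernel. -/
noncomputable def decay (a : Matrix ι ι ℝ) (Γ : List ι) (M : ℕ) (x : EuclideanSpace ℝ ι) : ℝ :=
  (∏ j, (P a j x)⁻¹) * (Γ.map fun l => (P a l x)⁻¹).prod * ((1 + ‖x‖) ^ M)⁻¹

theorem prod_map_one_add_Ph_pos (a : Matrix ι ι ℝ) (L : List ι) (ξ : EuclideanSpace ℝ ι) :
    0 < (L.map fun l => 1 + Ph a l ξ).prod := by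
  refine List.prod_pos fun y hy => ?_
  obtain ⟨l, -, rfl⟩ := List.mem_map.1 hy
  exact one_add_Ph_pos a l ξ

theorem decay_nonneg (a : Matrix ι ι ℝ) (Γ : List ι) (M : ℕ) (x : EuclideanSpace ℝ ι) :
    0 ≤ decay a Γ M x := by
  refine mul_nonneg (mul_nonneg (Finset.prod_nonneg fun _ _ => inv_nonneg.2 (P_nonneg _ _ _))
    (List.prod_nonneg fun y hy => ?_)) (by positivity)
  obtain ⟨l, -, rfl⟩ := List.mem_map.1 hy
  exact inv_nonneg.2 (P_nonneg _ _ _)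

theorem continuousOn_decay {a : Matrix ι ι ℝ} (ha : BasicHypothesis a) (Γ : List ι) (M : ℕ) :
    ContinuousOn (decay a Γ M) {0}ᶜ := by
  have h : ∀ l, ContinuousOn (fun x => (P a l x)⁻¹) {0}ᶜ := fun l =>
    (continuous_P ha l).continuousOn.inv₀ fun x hx => (P_pos a l hx).ne'
  refine ((continuousOn_finsetProd _ fun j _ => h j).mul ?_).mul ?_
  · induction Γ with
    | nil => exact continuousOn_const
    | cons l Γ ih =>
      simp only [List.map_cons, List.prod_cons]
      exact (h l).mul ih
  · refine Continuous.continuousOn (Continuous.inv₀ (by fun_prop) fun x => ?_)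
    positivity

theorem integral_prod_inv_one_add_sq {c : ι → ℝ} (hc : ∀ j, 0 < c j) :
    Integrable (fun ξ : EuclideanSpace ℝ ι => ∏ j, (1 + (c j * ξ j) ^ 2)⁻¹) ∧
    ∫ ξ : EuclideanSpace ℝ ι, ∏ j, (1 + (c j * ξ j) ^ 2)⁻¹ = ∏ j, (π * (c j)⁻¹) := by
  have hmp := EuclideanSpace.volume_preserving_symm_measurableEquiv_toLp ι
  have h1 : ∀ j, Integrable fun t : ℝ => (1 + (c j * t) ^ 2)⁻¹ := fun j =>
    integrable_inv_one_add_sq.comp_mul_left' (hc j).ne'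
  have h2 : ∀ j, ∫ t : ℝ, (1 + (c j * t) ^ 2)⁻¹ = π * (c j)⁻¹ := by
    intro j
    rw [Measure.integral_comp_mul_left (fun t : ℝ => (1 + t ^ 2)⁻¹), integral_univ_inv_one_add_sq,
      abs_of_pos (inv_pos.2 (hc j)), smul_eq_mul, mul_comm]
  constructor
  · have := Integrable.fintype_prod (f := fun (j : ι) (t : ℝ) => (1 + (c j * t) ^ 2)⁻¹)
      (μ := fun _ => volume) h1
    exact (hmp.integrable_comp_emb (MeasurableEquiv.measurableEmbedding _)).2 this
  · have := hmp.integral_comp (MeasurableEquiv.measurableEmbedding _)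
      (fun y : ι → ℝ => ∏ j, (1 + (c j * y j) ^ 2)⁻¹)
    refine this.trans ?_
    rw [integral_fintype_prod_volume_eq_prod (fun (j : ι) (t : ℝ) => (1 + (c j * t) ^ 2)⁻¹)]
    exact Finset.prod_congr rfl fun j _ => h2 j

theorem hasLineDerivAt_exp_inner (x ξ : EuclideanSpace ℝ ι) (l : ι) :
    HasLineDerivAt ℝ (fun ξ => Complex.exp (2 * π * Complex.I * (inner ℝ ξ x : ℝ)))
      (2 * π * Complex.I * x l * Complex.exp (2 * π * Complex.I * (inner ℝ ξ x : ℝ))) ξ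
      (EuclideanSpace.basisFun ι ℝ l) := by
  have e : ∀ t : ℝ, inner ℝ (ξ + t • EuclideanSpace.basisFun ι ℝ l) x = inner ℝ ξ x + t * x l := by
    intro t
    rw [inner_add_left, inner_smul_left, EuclideanSpace.basisFun_inner]
    simp
  unfold HasLineDerivAt
  simp_rw [e]
  have h := (((((Complex.ofRealCLM.hasDerivAt (x := (0 : ℝ))).mul_const
    (x l : ℂ)).const_add ((inner ℝ ξ x : ℝ) : ℂ))).const_mul (2 * π * Complex.I)).cexp
  simp only [Complex.ofRealCLM_apply, Complex.ofReal_one, one_mul, Complex.ofReal_zero, zero_mul,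
    add_zero] at h
  push_cast
  refine h.congr_deriv ?_
  ring

variable [DecidableEq ι]

/-- The integrands that arise from `f(ξ) e^{2πi⟨ξ, x⟩}` through repeated integration by parts. -/
noncomputable def term (a : Matrix ι ι ℝ) (D : Finset ι) (x : EuclideanSpace ℝ ι)
    (f : EuclideanSpace ℝ ι → ℂ) (L : List ι) (p : ι → ℕ) (ξ : EuclideanSpace ℝ ι) : ℂ :=
  (L.map fun l => u a D x l ξ).prod * (∏ l ∈ D, (w a D x l ξ)⁻¹ ^ p l) * pd L f ξ *
    Complex.exp (2 * π * Complex.I * (inner ℝ ξ x : ℝ))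

theorem continuous_u {a : Matrix ι ι ℝ} (ha : BasicHypothesis a) (D : Finset ι)
    (x : EuclideanSpace ℝ ι) (l : ι) : Continuous (u a D x l) := by
  have := continuous_A ha D l
  unfold u
  fun_prop

theorem continuous_w {a : Matrix ι ι ℝ} (ha : BasicHypothesis a) (D : Finset ι)
    (x : EuclideanSpace ℝ ι) (l : ι) : Continuous (w a D x l) := by
  have := continuous_u ha D x l
  unfold w
  fun_prop

theorem continuous_list_prod_u {a : Matrix ι ι ℝ} (ha : BasicHypothesis a) (D : Finset ι)
    (x : EuclideanSpace ℝ ι) (L : List ι) :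
    Continuous fun ξ => (L.map fun l => u a D x l ξ).prod := by
  induction L with
  | nil => exact continuous_const
  | cons l L ih =>
    simp only [List.map_cons, List.prod_cons]
    exact (continuous_u ha D x l).mul ih

theorem integrable_term {a : Matrix ι ι ℝ} (ha : BasicHypothesis a) (D : Finset ι)
    (x : EuclideanSpace ℝ ι) {f : EuclideanSpace ℝ ι → ℂ} (hf : ContDiff ℝ ∞ f)
    (hf' : HasCompactSupport f) (L : List ι) (p : ι → ℕ) :
    Integrable (term a D x f L p) := by
  refine Continuous.integrable_of_hasCompactSupport ?_ ?_
  · have h1 := continuous_list_prod_u ha D x L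
    have h2 := (contDiff_pd hf L).continuous
    have h3 : Continuous fun ξ => ∏ l ∈ D, (w a D x l ξ)⁻¹ ^ p l :=
      continuous_finsetProd _ fun l _ =>
        ((continuous_w ha D x l).inv₀ fun ξ => w_ne_zero a D x l ξ).pow _
    unfold term
    fun_prop
  · exact ((hasCompactSupport_pd hf' L).mul_left).mul_right

theorem A_add_smul (a : Matrix ι ι ℝ) {D : Finset ι} {l : ι} (hl : l ∈ D) (k : ι)
    (ξ : EuclideanSpace ℝ ι) (t : ℝ) :
    A a D k (ξ + t • EuclideanSpace.basisFun ι ℝ l) = A a D k ξ := by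
  unfold A
  congr 1
  refine Finset.sum_congr rfl fun i hi => ?_
  have h : i ≠ l := fun h => (Finset.mem_filter.1 hi).2 (h ▸ hl)
  rw [PiLp.add_apply, PiLp.smul_apply, basisFun_coord, if_neg h]
  simp

theorem u_add_smul (a : Matrix ι ι ℝ) {D : Finset ι} {l : ι} (hl : l ∈ D)
    (x : EuclideanSpace ℝ ι) (k : ι) (ξ : EuclideanSpace ℝ ι) (t : ℝ) :
    u a D x k (ξ + t • EuclideanSpace.basisFun ι ℝ l) =
      u a D x k ξ + t * (if k = l then 1 else 0) := by
  rw [u, A_add_smul a hl, u, PiLp.add_apply, PiLp.smul_apply, basisFun_coord]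
  push_cast
  simp only [smul_eq_mul, Complex.ofReal_mul]
  split_ifs <;> push_cast <;> ring

theorem hasLineDerivAt_u (a : Matrix ι ι ℝ) {D : Finset ι} {l : ι} (hl : l ∈ D)
    (x : EuclideanSpace ℝ ι) (k : ι) (ξ : EuclideanSpace ℝ ι) :
    HasLineDerivAt ℝ (u a D x k) (if k = l then 1 else 0) ξ (EuclideanSpace.basisFun ι ℝ l) := by
  unfold HasLineDerivAt
  simp_rw [u_add_smul a hl]
  have := ((Complex.ofRealCLM.hasDerivAt (x := (0 : ℝ))).mul_const
    (if k = l then (1 : ℂ) else 0)).const_add (u a D x k ξ)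
  simpa using this

theorem u_ne_zero (a : Matrix ι ι ℝ) (D : Finset ι) (x : EuclideanSpace ℝ ι) {l : ι}
    (hx : x l ≠ 0) (ξ : EuclideanSpace ℝ ι) : u a D x l ξ ≠ 0 := by
  intro h
  have h1 := congrArg Complex.im h
  have h2 := one_le_A a D l ξ
  have h3 : (SignType.sign (x l) : ℝ) * A a D l ξ = 0 := by
    simpa [u] using h1
  rcases mul_eq_zero.1 h3 with h4 | h4
  · rcases lt_or_gt_of_ne hx with h | h <;> simp [h] at h4
  · linarith

theorem hasLineDerivAt_prod_u (a : Matrix ι ι ℝ) {D : Finset ι} {l : ι} (hl : l ∈ D)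
    (x : EuclideanSpace ℝ ι) (hx : x l ≠ 0) (L : List ι) (ξ : EuclideanSpace ℝ ι) :
    HasLineDerivAt ℝ (fun ξ => (L.map fun k => u a D x k ξ).prod)
      (L.count l * (u a D x l ξ)⁻¹ * (L.map fun k => u a D x k ξ).prod) ξ
      (EuclideanSpace.basisFun ι ℝ l) := by
  have hu := u_ne_zero a D x hx ξ
  induction L with
  | nil =>
    simp only [List.map_nil, List.prod_nil, List.count_nil, Nat.cast_zero, zero_mul]
    exact hasDerivAt_const _ _
  | cons k L ih =>
    have h := HasDerivAt.fun_mul (hasLineDerivAt_u a hl x k ξ) ih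
    unfold HasLineDerivAt
    simp only [List.map_cons, List.prod_cons]
    refine h.congr_deriv ?_
    simp only [zero_smul, add_zero]
    by_cases hk : k = l
    · subst hk
      simp only [if_true, List.count_cons_self]
      push_cast
      field_simp
      ring
    · simp only [hk, if_false, List.count_cons_of_ne hk]
      ring

theorem hasLineDerivAt_w (a : Matrix ι ι ℝ) {D : Finset ι} {l : ι} (hl : l ∈ D)
    (x : EuclideanSpace ℝ ι) (k : ι) (ξ : EuclideanSpace ℝ ι) :
    HasLineDerivAt ℝ (w a D x k) (if k = l then 2 * π * Complex.I * x l else 0) ξ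
      (EuclideanSpace.basisFun ι ℝ l) := by
  have h := ((hasLineDerivAt_u a hl x k ξ : HasDerivAt _ _ _).const_mul
    (2 * π * Complex.I * x k)).const_add 1
  refine HasDerivAt.congr_deriv h ?_
  by_cases hk : k = l
  · subst hk; simp
  · simp [hk]

theorem hasLineDerivAt_prod_w (a : Matrix ι ι ℝ) {D : Finset ι} {l : ι} (hl : l ∈ D)
    (x : EuclideanSpace ℝ ι) (p : ι → ℕ) (ξ : EuclideanSpace ℝ ι) :
    HasLineDerivAt ℝ (fun ξ => ∏ k ∈ D, (w a D x k ξ)⁻¹ ^ p k)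
      (-(p l * (2 * π * Complex.I * x l) * (w a D x l ξ)⁻¹ * ∏ k ∈ D, (w a D x k ξ)⁻¹ ^ p k)) ξ
      (EuclideanSpace.basisFun ι ℝ l) := by
  have hw := w_ne_zero a D x l ξ
  have h1 : ∀ k ∈ D, HasDerivAt (fun t : ℝ =>
      (w a D x k (ξ + t • EuclideanSpace.basisFun ι ℝ l))⁻¹ ^ p k)
      (if k = l then -(p l * (2 * π * Complex.I * x l) * (w a D x l ξ)⁻¹) *
        (w a D x k ξ)⁻¹ ^ p k else 0) 0 := by
    intro k _
    have h := (HasDerivAt.fun_inv (hasLineDerivAt_w a hl x k ξ)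
      (by simpa using w_ne_zero a D x k ξ)).fun_pow (p k)
    refine h.congr_deriv ?_
    simp only [zero_smul, add_zero]
    by_cases hk : k = l
    · subst hk
      simp only [if_true]
      rcases Nat.eq_zero_or_pos (p k) with h0 | h0
      · simp [h0]
      · obtain ⟨q, hq⟩ := Nat.exists_eq_succ_of_ne_zero h0.ne'
        rw [hq]
        simp only [Nat.succ_eq_add_one, Nat.add_sub_cancel, pow_succ]
        field_simp
    · simp [hk]
  have h2 := HasDerivAt.fun_finsetProd h1
  refine HasDerivAt.congr_deriv h2 ?_
  rw [Finset.sum_eq_single l (fun k _ hk => by simp [hk]) (fun h => absurd hl h)]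
  simp only [zero_smul, add_zero, if_true, smul_eq_mul]
  rw [← Finset.mul_prod_erase D (fun k => (w a D x k ξ)⁻¹ ^ p k) hl]
  ring

/-- The recurrence expressing that the integral of the derivative
`∂_l (u_l w_l⁻¹ ⋯ e^{2πi⟨ξ, x⟩})` vanishes. -/
theorem integral_term_recurrence {a : Matrix ι ι ℝ} (ha : BasicHypothesis a) {D : Finset ι}
    {x : EuclideanSpace ℝ ι} {f : EuclideanSpace ℝ ι → ℂ} (hf : ContDiff ℝ ∞ f)
    (hf' : HasCompactSupport f) (L : List ι) (p : ι → ℕ) {l : ι} (hl : l ∈ D) (hx : x l ≠ 0) :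
    ∫ ξ, term a D x f L p ξ =
      ((p l : ℂ) + 1 - L.count l) * (∫ ξ, term a D x f L (p + Pi.single l 1) ξ)
      - ((p l : ℂ) + 1) * (∫ ξ, term a D x f L (p + Pi.single l 2) ξ)
      - ∫ ξ, term a D x f (l :: L) (p + Pi.single l 1) ξ := by
  have hV : ∀ (r : ℕ) ξ, ∏ k ∈ D, (w a D x k ξ)⁻¹ ^ (p + Pi.single l r : ι → ℕ) k =
      (∏ k ∈ D, (w a D x k ξ)⁻¹ ^ p k) * (w a D x l ξ)⁻¹ ^ r := by
    intro r ξ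
    rw [← Finset.mul_prod_erase D _ hl, ← Finset.mul_prod_erase D (fun k => (w a D x k ξ)⁻¹ ^ p k)
      hl, Pi.add_apply, Pi.single_eq_same, pow_add]
    have : ∏ k ∈ D.erase l, (w a D x k ξ)⁻¹ ^ (p + Pi.single l r : ι → ℕ) k =
        ∏ k ∈ D.erase l, (w a D x k ξ)⁻¹ ^ p k := by
      refine Finset.prod_congr rfl fun k hk => ?_
      rw [Pi.add_apply, Pi.single_eq_of_ne (Finset.ne_of_mem_erase hk), add_zero]
    rw [this]; ring
  set Φ' : EuclideanSpace ℝ ι → ℂ := fun ξ => term a D x f L p ξ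
    - ((p l : ℂ) + 1 - L.count l) * term a D x f L (p + Pi.single l 1) ξ
    + ((p l : ℂ) + 1) * term a D x f L (p + Pi.single l 2) ξ
    + term a D x f (l :: L) (p + Pi.single l 1) ξ with hΦ'
  set Φ : EuclideanSpace ℝ ι → ℂ := fun ξ =>
    u a D x l ξ * term a D x f L (p + Pi.single l 1) ξ with hΦ
  have hderiv : ∀ ξ, HasLineDerivAt ℝ Φ (Φ' ξ) ξ (EuclideanSpace.basisFun ι ℝ l) := by
    intro ξ
    have h1 := hasLineDerivAt_u a hl x l ξ
    have h2 := hasLineDerivAt_prod_u a hl x hx L ξ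
    have h3 := hasLineDerivAt_prod_w a hl x (p + Pi.single l 1) ξ
    have h4 : HasLineDerivAt ℝ (pd L f) (pd (l :: L) f ξ) ξ (EuclideanSpace.basisFun ι ℝ l) :=
      (differentiable_pd hf L ξ).hasFDerivAt.hasLineDerivAt _
    have h5 := hasLineDerivAt_exp_inner x ξ l
    have h := HasDerivAt.fun_mul h1 (HasDerivAt.fun_mul (HasDerivAt.fun_mul
      (HasDerivAt.fun_mul h2 h3) h4) h5)
    refine HasDerivAt.congr_deriv h ?_
    simp only [zero_smul, add_zero, if_true]
    have hu := u_ne_zero a D x hx ξ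
    have hw := w_ne_zero a D x l ξ
    have hwu : 2 * π * Complex.I * x l * u a D x l ξ = w a D x l ξ - 1 := by rw [w]; ring
    simp only [hΦ', term, hV]
    simp only [List.map_cons, List.prod_cons, Pi.add_apply, Pi.single_eq_same]
    set U := (L.map fun k => u a D x k ξ).prod
    set V := ∏ k ∈ D, (w a D x k ξ)⁻¹ ^ p k
    set e := Complex.exp (2 * π * Complex.I * (inner ℝ ξ x : ℝ))
    set v := w a D x l ξ
    have hv : v⁻¹ * v = 1 := inv_mul_cancel₀ hw
    have hui : u a D x l ξ * (u a D x l ξ)⁻¹ = 1 := mul_inv_cancel₀ hu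
    push_cast
    simp only [pow_one]
    linear_combination (L.count l * U * V * v⁻¹ * pd L f ξ * e) * hui
      + (U * V * v⁻¹ * pd L f ξ * e - (p l + 1) * U * V * v⁻¹ ^ 2 * pd L f ξ * e) * hwu
      + (U * V * pd L f ξ * e - (p l + 1) * U * V * v⁻¹ * pd L f ξ * e) * hv
  have hint : ∀ L p, Integrable (term a D x f L p) := integrable_term ha D x hf hf'
  have hΦ'i : Integrable Φ' :=
    (((hint _ _).sub ((hint _ _).const_mul _)).add ((hint _ _).const_mul _)).add (hint _ _)
  have hΦi : Integrable Φ := by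
    have h := hint (l :: L) (p + Pi.single l 1)
    refine Continuous.integrable_of_hasCompactSupport ?_ ?_
    · have h1 := continuous_list_prod_u ha D x L
      have h2 := (contDiff_pd hf L).continuous
      have h3 : Continuous fun ξ => ∏ k ∈ D, (w a D x k ξ)⁻¹ ^ (p + Pi.single l 1 : ι → ℕ) k :=
        continuous_finsetProd _ fun k _ =>
          ((continuous_w ha D x k).inv₀ fun ξ => w_ne_zero a D x k ξ).pow _
      have h4 := continuous_u ha D x l
      simp only [hΦ]
      unfold term
      fun_prop
    · exact (((hasCompactSupport_pd hf' L).mul_left).mul_right).mul_left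
  have h0 := integral_bilinear_hasLineDerivAt_right_eq_neg_left_of_integrable
    (μ := (volume : Measure (EuclideanSpace ℝ ι))) (f := Φ) (f' := Φ') (g := fun _ => (1 : ℂ))
    (g' := fun _ => 0) (v := EuclideanSpace.basisFun ι ℝ l) (B := ContinuousLinearMap.mul ℝ ℂ)
    (by simpa using hΦ'i) (by simp) (by simpa using hΦi) (fun ξ _ => hderiv ξ)
    (fun ξ _ => hasDerivAt_const _ _)
  simp only [ContinuousLinearMap.mul_apply', mul_zero, integral_zero, mul_one] at h0
  have h1 : ∫ ξ, Φ' ξ = (∫ ξ, term a D x f L p ξ)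
      - ((p l : ℂ) + 1 - L.count l) * (∫ ξ, term a D x f L (p + Pi.single l 1) ξ)
      + ((p l : ℂ) + 1) * (∫ ξ, term a D x f L (p + Pi.single l 2) ξ)
      + ∫ ξ, term a D x f (l :: L) (p + Pi.single l 1) ξ := by
    rw [← integral_const_mul, ← integral_const_mul, ← integral_sub (hint _ _)
      ((hint _ _).const_mul _), ← integral_add, ← integral_add]
    · exact ((hint _ _).sub ((hint _ _).const_mul _)).add ((hint _ _).const_mul _)
    · exact hint _ _
    · exact (hint _ _).sub ((hint _ _).const_mul _)
    · exact (hint _ _).const_mul _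
  linear_combination h0 - h1

end Oscillatory

/-! ### The pointwise kernel estimate for compactly supported symbols -/

section KeyEstimate

variable {ι : Type*} [Fintype ι]

/-- Where a power of the gain controls frequencies, weights and `1 + |x|`, a higher power of it
turns the weight `∏_{l ∈ Γ} (1 + P̂_l)` into an integrable function of `ξ` with the right
normalization. -/
theorem weight_mul_gain_le {a : Matrix ι ι ℝ} {C : ℝ} {c : ℕ} (hC : 1 ≤ C)
    {x ξ : EuclideanSpace ℝ ι} (hx : x ≠ 0) {g : ℝ} (hg : 1 ≤ g)
    (h1 : ∀ j, |ξ j| * P a j x ≤ C * g ^ c) (h2 : ∀ l, (1 + Ph a l ξ) * P a l x ≤ C * g ^ c)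
    (h3 : 1 + ‖x‖ ≤ C * g ^ c) (Γ : List ι) (M : ℕ) :
    (Γ.map fun l => 1 + Ph a l ξ).prod *
        (g ^ (c * (Γ.length + M + 2 * Fintype.card ι)))⁻¹ ≤
      2 ^ Fintype.card ι * C ^ (Γ.length + M + 2 * Fintype.card ι) *
        ((Γ.map fun l => (P a l x)⁻¹).prod * ((1 + ‖x‖) ^ M)⁻¹) *
        ∏ j, (1 + (P a j x * ξ j) ^ 2)⁻¹ := by
  set T := C * g ^ c with hT
  have hg0 : 0 < g := zero_lt_one.trans_le hg
  have hT1 : 1 ≤ T := one_le_mul_of_one_le_of_one_le hC (one_le_pow₀ hg)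
  have hT0 : 0 ≤ T := zero_le_one.trans hT1
  have e1 : (Γ.map fun l => 1 + Ph a l ξ).prod ≤
      T ^ Γ.length * (Γ.map fun l => (P a l x)⁻¹).prod := by
    induction Γ with
    | nil => simp
    | cons l Γ ih =>
      simp only [List.map_cons, List.prod_cons, List.length_cons, pow_succ]
      have hP := P_pos a l hx
      have : 1 + Ph a l ξ ≤ T * (P a l x)⁻¹ := by
        rw [← div_eq_mul_inv, le_div_iff₀ hP]; exact h2 l
      calc _ ≤ (T * (P a l x)⁻¹) * (T ^ Γ.length * (Γ.map fun l => (P a l x)⁻¹).prod) :=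
            mul_le_mul this ih (prod_map_one_add_Ph_pos a Γ ξ).le (by positivity)
        _ = _ := by ring
  have e2 : 1 ≤ T ^ M * ((1 + ‖x‖) ^ M)⁻¹ := by
    rw [← div_eq_mul_inv, one_le_div₀ (by positivity)]
    exact pow_le_pow_left₀ (by positivity) h3 M
  have e3 : 1 ≤ (2 ^ Fintype.card ι * T ^ (2 * Fintype.card ι)) *
      ∏ j, (1 + (P a j x * ξ j) ^ 2)⁻¹ := by
    have : 2 ^ Fintype.card ι * T ^ (2 * Fintype.card ι) = ∏ _j : ι, (2 * T ^ 2) := by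
      rw [Finset.prod_const, Finset.card_univ, pow_mul T, ← mul_pow]
    rw [this, ← Finset.prod_mul_distrib]
    have := Finset.prod_le_prod (s := Finset.univ) (f := fun _ : ι => (1 : ℝ))
      (g := fun j => 2 * T ^ 2 * (1 + (P a j x * ξ j) ^ 2)⁻¹) (fun _ _ => zero_le_one)
      fun j _ => ?_
    · simpa using this
    · rw [← div_eq_mul_inv, one_le_div₀ (by positivity)]
      have h4 : (P a j x * ξ j) ^ 2 ≤ T ^ 2 := by
        rw [← sq_abs, abs_mul, abs_of_nonneg (P_nonneg a j x), mul_comm]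
        exact pow_le_pow_left₀ (mul_nonneg (abs_nonneg _) (P_nonneg _ _ _)) (h1 j) 2
      have h5 : 1 ≤ T ^ 2 := one_le_pow₀ hT1
      linarith
  have hΓ : 0 ≤ (Γ.map fun l => (P a l x)⁻¹).prod := by
    refine List.prod_nonneg fun y hy => ?_
    obtain ⟨l, -, rfl⟩ := List.mem_map.1 hy
    exact inv_nonneg.2 (P_nonneg _ _ _)
  have hTg : T ^ (Γ.length + M + 2 * Fintype.card ι) *
      (g ^ (c * (Γ.length + M + 2 * Fintype.card ι)))⁻¹ =
      C ^ (Γ.length + M + 2 * Fintype.card ι) := by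
    rw [hT, mul_pow, ← pow_mul, mul_assoc, mul_inv_cancel₀ (by positivity), mul_one]
  rw [← hTg]
  set Pr := ∏ j, (1 + (P a j x * ξ j) ^ 2)⁻¹
  have hPr : 0 ≤ Pr := Finset.prod_nonneg fun _ _ => by positivity
  set Γp := (Γ.map fun l => (P a l x)⁻¹).prod
  calc (Γ.map fun l => 1 + Ph a l ξ).prod * (g ^ (c * (Γ.length + M + 2 * Fintype.card ι)))⁻¹
      ≤ (T ^ Γ.length * Γp) * (T ^ M * ((1 + ‖x‖) ^ M)⁻¹) *
        ((2 ^ Fintype.card ι * T ^ (2 * Fintype.card ι)) * Pr) *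
        (g ^ (c * (Γ.length + M + 2 * Fintype.card ι)))⁻¹ := by
        gcongr
        calc _ ≤ _ := e1
          _ ≤ (T ^ Γ.length * Γp) * (T ^ M * ((1 + ‖x‖) ^ M)⁻¹) :=
            le_mul_of_one_le_right (by positivity) e2
          _ ≤ _ := le_mul_of_one_le_right (by positivity) e3
    _ = _ := by ring

variable [DecidableEq ι]

theorem norm_list_prod_u_le {a : Matrix ι ι ℝ} (ha : BasicHypothesis a) (D : Finset ι)
    (x ξ : EuclideanSpace ℝ ι) {L : List ι} (hL : ∀ k ∈ L, k ∈ D) :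
    ‖(L.map fun l => u a D x l ξ).prod‖ ≤ (L.map fun l => 1 + Ph a l ξ).prod := by
  induction L with
  | nil => simp
  | cons l L ih =>
    simp only [List.map_cons, List.prod_cons, norm_mul]
    exact mul_le_mul (norm_u_le ha D x (hL l List.mem_cons_self) ξ)
      (ih fun k hk => hL k (List.mem_cons_of_mem _ hk)) (norm_nonneg _) (one_add_Ph_pos a l ξ).le

theorem norm_term_le {a : Matrix ι ι ℝ} (ha : BasicHypothesis a) (D : Finset ι)
    (x ξ : EuclideanSpace ℝ ι) {f : EuclideanSpace ℝ ι → ℂ} {C : List ι → ℝ}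
    {W : EuclideanSpace ℝ ι → ℝ} (h : SymbolBound a C W f) {L : List ι} (hL : ∀ k ∈ L, k ∈ D)
    {p : ι → ℕ} {M : ℕ} (hp : ∀ l ∈ D, M ≤ p l) :
    ‖term a D x f L p ξ‖ ≤ C L * W ξ * (G a D x ξ ^ M)⁻¹ := by
  have hpos := prod_map_one_add_Ph_pos a L ξ
  have h1 : ‖∏ l ∈ D, (w a D x l ξ)⁻¹ ^ p l‖ ≤ (G a D x ξ ^ M)⁻¹ := by
    rw [norm_prod, G, ← Finset.prod_pow, ← Finset.prod_inv_distrib]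
    refine Finset.prod_le_prod (fun _ _ => norm_nonneg _) fun l hl => ?_
    have hw := (norm_w_bounds a D x l ξ).1
    rw [norm_pow, norm_inv, ← inv_pow]
    exact pow_le_pow_of_le_one (by positivity) (inv_le_one_of_one_le₀ hw) (hp l hl)
  have h2 := h L ξ
  rw [le_div_iff₀ hpos] at h2
  rw [term, norm_mul, norm_mul, norm_mul, norm_exp_inner, mul_one]
  calc ‖(L.map fun l => u a D x l ξ).prod‖ * ‖∏ l ∈ D, (w a D x l ξ)⁻¹ ^ p l‖ * ‖pd L f ξ‖
      ≤ (L.map fun l => 1 + Ph a l ξ).prod * (G a D x ξ ^ M)⁻¹ * ‖pd L f ξ‖ := by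
        gcongr
        exact norm_list_prod_u_le ha D x ξ hL
    _ = ‖pd L f ξ‖ * (L.map fun l => 1 + Ph a l ξ).prod * (G a D x ξ ^ M)⁻¹ := by ring
    _ ≤ C L * W ξ * (G a D x ξ ^ M)⁻¹ := by
        have := one_le_G a D x ξ
        gcongr

/-- The kernel estimate for compactly supported symbols, with constants that do not depend on the
support. -/
theorem exists_norm_osc_le {a : Matrix ι ι ℝ} (ha : BasicHypothesis a) (Γ : List ι)
    (C : List ι → ℝ) (M : ℕ) :
    ∃ K : ℝ, 0 ≤ K ∧ ∀ f : EuclideanSpace ℝ ι → ℂ, ContDiff ℝ ∞ f → HasCompactSupport f →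
      ∀ t : ℝ, 0 ≤ t → SymbolBound a C (fun ξ => t * (Γ.map fun l => 1 + Ph a l ξ).prod) f →
      ∀ x : EuclideanSpace ℝ ι, x ≠ 0 → ‖osc f x‖ ≤ K * t * decay a Γ M x := by
  obtain ⟨C₀, c, hC₀, hgain⟩ := exists_gain ha
  -- powers of the gain pay for the weights of `Γ`, for the decay of order `M`, and for two powers
  -- of each `|ξ_j| P_j(x)`, which make the integrand integrable
  set M' := c * (Γ.length + M + 2 * Fintype.card ι) with hM'
  choose K hK0 hK using fun D : Finset ι => exists_bound_of_recurrence D M' (fun L => |C L|)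
  set κ : ℝ := 2 ^ Fintype.card ι * C₀ ^ (Γ.length + M + 2 * Fintype.card ι) with hκ
  have hκ0 : 0 ≤ κ := by positivity
  -- the set `D` depends on `x`, but there are finitely many such sets
  refine ⟨(∑ D, K D) * (κ * π ^ Fintype.card ι), mul_nonneg
    (Finset.sum_nonneg fun D _ => hK0 D) (by positivity),
    fun f hf hf' t ht hsym x hx => ?_⟩
  obtain ⟨D, hDx, hD⟩ := hgain x hx
  obtain ⟨hi1, hi2⟩ := integral_prod_inv_one_add_sq (c := fun j => P a j x) fun j => P_pos a j hx
  set R : ℝ := (Γ.map fun l => (P a l x)⁻¹).prod * ((1 + ‖x‖) ^ M)⁻¹ with hR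
  have hR0 : 0 ≤ R := by
    refine mul_nonneg (List.prod_nonneg fun y hy => ?_) (by positivity)
    obtain ⟨l, -, rfl⟩ := List.mem_map.1 hy
    exact inv_nonneg.2 (P_nonneg _ _ _)
  set B : ℝ := t * (κ * R * ∏ j, (π * (P a j x)⁻¹)) with hB
  have hB0 : 0 ≤ B := by
    refine mul_nonneg ht (mul_nonneg (mul_nonneg hκ0 hR0) (Finset.prod_nonneg fun j _ => ?_))
    exact mul_nonneg Real.pi_pos.le (inv_nonneg.2 (P_nonneg _ _ _))
  have key := hK D (fun L p => ∫ ξ, term a D x f L p ξ) B hB0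
    (fun L p l hl _ => integral_term_recurrence ha hf hf' L p hl (hDx l hl)) ?_
  · have e0 : ∫ ξ, term a D x f [] 0 ξ = osc f x := by
      simp only [term, osc, List.map_nil, List.prod_nil, Pi.zero_apply, pow_zero,
        Finset.prod_const_one, one_mul, pd_nil]
      exact integral_congr_ae (Eventually.of_forall fun ξ => mul_comm _ _)
    rw [e0] at key
    have hKle : K D ≤ ∑ D, K D :=
      Finset.single_le_sum (f := K) (fun D _ => hK0 D) (Finset.mem_univ D)
    refine key.trans ((mul_le_mul_of_nonneg_right hKle hB0).trans (le_of_eq ?_))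
    rw [hB, hR, decay, Finset.prod_mul_distrib, Finset.prod_const, Finset.card_univ]
    ring
  · intro L p hL hp
    have hle : ∀ ξ, ‖term a D x f L p ξ‖ ≤
        |C L| * (t * (κ * R)) * ∏ j, (1 + (P a j x * ξ j) ^ 2)⁻¹ := by
      intro ξ
      have hG := one_le_G a D x ξ
      obtain ⟨h1, h2, h3⟩ := hD ξ
      have hw := weight_mul_gain_le hC₀ hx hG h1 h2 h3 Γ M
      rw [← hM', ← hκ, ← hR] at hw
      have hG0 : 0 ≤ (G a D x ξ ^ M')⁻¹ := by positivity
      calc ‖term a D x f L p ξ‖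
          ≤ C L * (t * (Γ.map fun l => 1 + Ph a l ξ).prod) * (G a D x ξ ^ M')⁻¹ :=
            norm_term_le ha D x ξ hsym hL hp
        _ ≤ |C L| * (t * (Γ.map fun l => 1 + Ph a l ξ).prod) * (G a D x ξ ^ M')⁻¹ := by
            have := (prod_map_one_add_Ph_pos a Γ ξ).le
            gcongr
            exact le_abs_self _
        _ = |C L| * t * ((Γ.map fun l => 1 + Ph a l ξ).prod * (G a D x ξ ^ M')⁻¹) := by ring
        _ ≤ |C L| * t * (κ * R * ∏ j, (1 + (P a j x * ξ j) ^ 2)⁻¹) := by gcongr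
        _ = _ := by ring
    refine (norm_integral_le_of_norm_le (hi1.const_mul _) (Eventually.of_forall hle)).trans ?_
    rw [integral_const_mul, hi2, hB]
    exact le_of_eq (by ring)

end KeyEstimate

/-! ### Products of symbols -/

section Monomials

variable {ι : Type*}

/-- The Fourier multiplier `2πi ξ_l` of the derivative `∂_l`. -/
noncomputable def mono (l : ι) (ξ : EuclideanSpace ℝ ι) : ℂ := 2 * π * Complex.I * ξ l

/-- The product of `f` with the Fourier multiplier of `∂^Γ`. -/
noncomputable def monoMul (f : EuclideanSpace ℝ ι → ℂ) : List ι → EuclideanSpace ℝ ι → ℂ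
  | [], ξ => f ξ
  | l :: Γ, ξ => mono l ξ * monoMul f Γ ξ

theorem hasCompactSupport_monoMul {f : EuclideanSpace ℝ ι → ℂ} (hf : HasCompactSupport f)
    (Γ : List ι) : HasCompactSupport (monoMul f Γ) := by
  induction Γ with
  | nil => exact hf
  | cons l Γ ih => exact ih.mul_left

theorem monoMul_sub (f g : EuclideanSpace ℝ ι → ℂ) (Γ : List ι) (ξ : EuclideanSpace ℝ ι) :
    monoMul (fun ξ => f ξ - g ξ) Γ ξ = monoMul f Γ ξ - monoMul g Γ ξ := by
  induction Γ with
  | nil => rfl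
  | cons l Γ ih => simp only [monoMul, ih]; ring

end Monomials

section Symbols

variable {ι : Type*} [Fintype ι]

/-- The Leibniz rule in the form of a pointwise estimate with arbitrary positive scales `s l`: the
weights of the factors multiply. -/
theorem exists_norm_pd_mul_le (L : List ι) (C C' : List ι → ℝ) :
    ∃ K : ℝ, 0 ≤ K ∧ ∀ f g : EuclideanSpace ℝ ι → ℂ, ContDiff ℝ ∞ f → ContDiff ℝ ∞ g →
      ∀ (ξ : EuclideanSpace ℝ ι) (s : ι → ℝ), (∀ l, 0 < s l) → ∀ W W' : ℝ,
      (∀ L, ‖pd L f ξ‖ ≤ C L * W / (L.map s).prod) →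
      (∀ L, ‖pd L g ξ‖ ≤ C' L * W' / (L.map s).prod) → 0 ≤ W → 0 ≤ W' →
      ‖pd L (fun ξ => f ξ * g ξ) ξ‖ ≤ K * (W * W') / (L.map s).prod := by
  induction L generalizing C C' with
  | nil =>
    refine ⟨|C [] * C' []|, abs_nonneg _, fun f g _ _ ξ s _ W W' hf hg hW hW' => ?_⟩
    have h1 := hf []
    have h2 := hg []
    simp only [pd_nil, List.map_nil, List.prod_nil, div_one] at h1 h2 ⊢
    rw [norm_mul]
    calc ‖f ξ‖ * ‖g ξ‖ ≤ (C [] * W) * (C' [] * W') :=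
          mul_le_mul h1 h2 (norm_nonneg _) ((norm_nonneg _).trans h1)
      _ = (C [] * C' []) * (W * W') := by ring
      _ ≤ _ := by gcongr; exact le_abs_self _
  | cons l L ih =>
    obtain ⟨K1, hK1, H1⟩ := ih (fun L => C (L ++ [l])) C'
    obtain ⟨K2, hK2, H2⟩ := ih C (fun L => C' (L ++ [l]))
    refine ⟨K1 + K2, by positivity, fun f g hf hg ξ s hs W W' bf bg hW hW' => ?_⟩
    have hsl := hs l
    have shift : ∀ (C : List ι → ℝ) (W : ℝ) (f : EuclideanSpace ℝ ι → ℂ),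
        (∀ L, ‖pd L f ξ‖ ≤ C L * W / (L.map s).prod) →
        ∀ L, ‖pd L (pd [l] f) ξ‖ ≤ C (L ++ [l]) * (W / s l) / (L.map s).prod := by
      intro C W f h L
      have := h (L ++ [l])
      rw [pd_append] at this
      refine this.trans (le_of_eq ?_)
      simp only [List.map_append, List.map_cons, List.map_nil, List.prod_append, List.prod_cons,
        List.prod_nil, mul_one]
      rw [mul_div_assoc', div_div, mul_comm (s l)]
    have e : pd [l] (fun ξ => f ξ * g ξ) = fun ξ => pd [l] f ξ * g ξ + f ξ * pd [l] g ξ := by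
      funext y
      rw [pd_cons, pd_nil, fderiv_fun_mul (hf.differentiable (by simp) y)
        (hg.differentiable (by simp) y)]
      simp only [pd_cons, pd_nil, add_apply, smul_apply, smul_eq_mul]
      ring
    have c1 := contDiff_pd hf [l]
    have c2 := contDiff_pd hg [l]
    rw [pd_cons_inner (hf.mul hg), e, pd_add (c1.mul hg) (hf.mul c2)]
    have b1 := H1 (pd [l] f) g c1 hg ξ s hs (W / s l) W' (shift C W f bf) bg (by positivity) hW'
    have b2 := H2 f (pd [l] g) hf c2 ξ s hs W (W' / s l) bf (shift C' W' g bg) hW (by positivity)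
    refine (norm_add_le _ _).trans ((add_le_add b1 b2).trans (le_of_eq ?_))
    simp only [List.map_cons, List.prod_cons]
    field_simp

theorem SymbolBound.mul (a : Matrix ι ι ℝ) (C C' : List ι → ℝ) :
    ∃ K : List ι → ℝ, ∀ (f g : EuclideanSpace ℝ ι → ℂ) (W W' : EuclideanSpace ℝ ι → ℝ),
      ContDiff ℝ ∞ f → ContDiff ℝ ∞ g → (∀ ξ, 0 ≤ W ξ) → (∀ ξ, 0 ≤ W' ξ) →
      SymbolBound a C W f → SymbolBound a C' W' g →
      SymbolBound a K (fun ξ => W ξ * W' ξ) fun ξ => f ξ * g ξ := by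
  choose K _ H using fun L => exists_norm_pd_mul_le L C C'
  exact ⟨K, fun f g W W' hf hg hW hW' bf bg L ξ =>
    H L f g hf hg ξ (fun l => 1 + Ph a l ξ) (fun l => one_add_Ph_pos a l ξ) (W ξ) (W' ξ)
      (fun L => bf L ξ) (fun L => bg L ξ) (hW ξ) (hW' ξ)⟩

theorem contDiff_mono (l : ι) : ContDiff ℝ ∞ (mono l : EuclideanSpace ℝ ι → ℂ) := by
  have : ContDiff ℝ ∞ fun ξ : EuclideanSpace ℝ ι => ((ξ l : ℝ) : ℂ) :=
    Complex.ofRealCLM.contDiff.comp (EuclideanSpace.proj l : EuclideanSpace ℝ ι →L[ℝ] ℝ).contDiff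
  exact contDiff_const.mul this

theorem exists_symbolBound_mono {a : Matrix ι ι ℝ} (ha : BasicHypothesis a) (l : ι) :
    ∃ C : List ι → ℝ, SymbolBound a C (fun ξ => 1 + Ph a l ξ) (mono l) := by
  classical
  have h1 : ∀ k, pd [k] (mono l : EuclideanSpace ℝ ι → ℂ) =
      fun _ => if k = l then 2 * π * Complex.I else 0 := by
    intro k
    funext ξ
    have h : HasFDerivAt (mono l : EuclideanSpace ℝ ι → ℂ)
        ((2 * π * Complex.I) • Complex.ofRealCLM.comp
          (EuclideanSpace.proj l : EuclideanSpace ℝ ι →L[ℝ] ℝ)) ξ :=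
      ((Complex.ofRealCLM.comp (EuclideanSpace.proj l :
        EuclideanSpace ℝ ι →L[ℝ] ℝ)).hasFDerivAt).const_mul _
    rw [pd_cons, pd_nil, h.fderiv]
    change (2 * π * Complex.I) * (((EuclideanSpace.basisFun ι ℝ k) l : ℝ) : ℂ) = _
    rw [basisFun_coord]
    by_cases hk : k = l
    · simp [hk]
    · simp [hk, Ne.symm hk]
  refine ⟨fun _ => 2 * π, fun L ξ => ?_⟩
  have hpos := one_add_Ph_pos a l ξ
  rcases List.eq_nil_or_concat L with rfl | ⟨L, k, rfl⟩
  · simp only [pd_nil, List.map_nil, List.prod_nil, div_one, mono]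
    have := abs_le_Ph ha l ξ
    rw [norm_mul, norm_mul, norm_mul, Complex.norm_I, Complex.norm_real, Complex.norm_real,
      Real.norm_eq_abs, Real.norm_eq_abs, abs_of_pos Real.pi_pos, Complex.norm_two, mul_one]
    gcongr
    linarith
  · rw [List.concat_eq_append, pd_append, h1]
    have hpos' := prod_map_one_add_Ph_pos a (L ++ [k]) ξ
    rcases List.eq_nil_or_concat L with rfl | ⟨L, j, rfl⟩
    · by_cases hk : k = l
      · subst hk
        simp only [pd_nil, if_true, List.nil_append, List.map_cons, List.map_nil, List.prod_cons,
          List.prod_nil, mul_one]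
        rw [mul_div_assoc, div_self hpos.ne', mul_one]
        simp [abs_of_pos Real.pi_pos]
      · simp only [pd_nil, hk, if_false, norm_zero]
        positivity
    · rw [List.concat_eq_append, pd_append, pd_const, pd_zero, norm_zero]
      rw [List.concat_eq_append] at hpos'
      positivity

theorem contDiff_monoMul {f : EuclideanSpace ℝ ι → ℂ} (hf : ContDiff ℝ ∞ f) (Γ : List ι) :
    ContDiff ℝ ∞ (monoMul f Γ) := by
  induction Γ with
  | nil => exact hf
  | cons l Γ ih => exact (contDiff_mono l).mul ih

theorem exists_symbolBound_monoMul {a : Matrix ι ι ℝ} (ha : BasicHypothesis a) (C : List ι → ℝ)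
    (Γ : List ι) :
    ∃ K : List ι → ℝ, ∀ (f : EuclideanSpace ℝ ι → ℂ) (W : EuclideanSpace ℝ ι → ℝ),
      ContDiff ℝ ∞ f → (∀ ξ, 0 ≤ W ξ) → SymbolBound a C W f →
      SymbolBound a K (fun ξ => (Γ.map fun l => 1 + Ph a l ξ).prod * W ξ) (monoMul f Γ) := by
  induction Γ with
  | nil => exact ⟨C, fun f W _ _ h => by
      change SymbolBound a C (fun ξ => 1 * W ξ) f
      simpa only [one_mul] using h⟩
  | cons l Γ ih =>
    obtain ⟨K, hK⟩ := ih
    obtain ⟨Cl, hCl⟩ := exists_symbolBound_mono ha l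
    obtain ⟨K', hK'⟩ := SymbolBound.mul a Cl K
    refine ⟨K', fun f W hf hW h => ?_⟩
    have := hK' (mono l) (monoMul f Γ) _ _ (contDiff_mono l) (contDiff_monoMul hf Γ)
      (fun ξ => (one_add_Ph_pos a l ξ).le)
      (fun ξ => mul_nonneg (prod_map_one_add_Ph_pos a Γ ξ).le (hW ξ)) hCl (hK f W hf hW h)
    simp only [List.map_cons, List.prod_cons, mul_assoc]
    exact this

end Symbols

/-! ### Anisotropic cutoff functions -/

section Cutoff

variable {ι : Type*} [Fintype ι]

/-- The diagonal map `ξ ↦ (c_l ξ_l)_l`. -/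
noncomputable def diag (c : ι → ℝ) : EuclideanSpace ℝ ι →L[ℝ] EuclideanSpace ℝ ι :=
  LinearMap.toContinuousLinearMap
    { toFun := fun x => WithLp.toLp 2 fun l => c l * x l
      map_add' := fun x y => by ext l; simp [mul_add]
      map_smul' := fun r x => by ext l; simp; ring }

@[simp] theorem diag_apply (c : ι → ℝ) (x : EuclideanSpace ℝ ι) (l : ι) :
    diag c x l = c l * x l := rfl

theorem diag_basisFun (c : ι → ℝ) (l : ι) :
    diag c (EuclideanSpace.basisFun ι ℝ l) = c l • EuclideanSpace.basisFun ι ℝ l := by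
  classical
  ext k
  rw [diag_apply, PiLp.smul_apply, basisFun_coord, smul_eq_mul]
  split_ifs with h
  · rw [h]
  · simp

theorem diag_injective {c : ι → ℝ} (hc : ∀ l, 0 < c l) :
    Function.Injective (diag c).toLinearMap := by
  intro x y h
  ext l
  have h1 := congrArg (fun z : EuclideanSpace ℝ ι => z l) h
  exact mul_left_cancel₀ (hc l).ne' h1

theorem isClosedEmbedding_diag {c : ι → ℝ} (hc : ∀ l, 0 < c l) :
    Topology.IsClosedEmbedding (diag c) :=
  LinearMap.isClosedEmbedding_of_injective (LinearMap.ker_eq_bot.2 (diag_injective hc))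

theorem pd_comp_diag {F : Type*} [NormedAddCommGroup F] [NormedSpace ℝ F]
    {f : EuclideanSpace ℝ ι → F} (hf : ContDiff ℝ ∞ f) (c : ι → ℝ) (L : List ι)
    (ξ : EuclideanSpace ℝ ι) :
    pd L (fun ξ => f (diag c ξ)) ξ = (L.map c).prod • pd L f (diag c ξ) := by
  induction L generalizing ξ with
  | nil => simp
  | cons l L ih =>
    have e : pd L (fun ξ => f (diag c ξ)) = fun ξ => (L.map c).prod • pd L f (diag c ξ) := funext ih
    have h : HasFDerivAt (fun ξ => (L.map c).prod • pd L f (diag c ξ))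
        ((L.map c).prod • (fderiv ℝ (pd L f) (diag c ξ)).comp (diag c)) ξ :=
      (((differentiable_pd hf L (diag c ξ)).hasFDerivAt).comp ξ (diag c).hasFDerivAt).const_smul _
    rw [pd_cons, e, h.fderiv, pd_cons]
    change (L.map c).prod • (fderiv ℝ (pd L f) (diag c ξ)) (diag c _) = _
    rw [diag_basisFun, map_smul, smul_smul, List.map_cons, List.prod_cons, mul_comm]

theorem norm_diag_le_of_abs_le {c c' : ι → ℝ} (h : ∀ l, |c l| ≤ |c' l|)
    (ξ : EuclideanSpace ℝ ι) : ‖diag c ξ‖ ≤ ‖diag c' ξ‖ := by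
  rw [EuclideanSpace.norm_eq, EuclideanSpace.norm_eq]
  refine Real.sqrt_le_sqrt (Finset.sum_le_sum fun l _ => ?_)
  rw [diag_apply, diag_apply, norm_mul, norm_mul, Real.norm_eq_abs (c l), Real.norm_eq_abs (c' l)]
  have := h l
  gcongr

theorem pd_eq_zero_of_notMem_tsupport {F : Type*} [NormedAddCommGroup F] [NormedSpace ℝ F]
    {f : EuclideanSpace ℝ ι → F} {ξ : EuclideanSpace ℝ ι} (h : ξ ∉ tsupport f) (L : List ι) :
    pd L f ξ = 0 := by
  have h1 : f =ᶠ[𝓝 ξ] fun _ => 0 := notMem_tsupport_iff_eventuallyEq.1 h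
  have h2 := (pd_congr_of_eventuallyEq h1 L).eq_of_nhds
  rw [h2, pd_zero]

/-- A smooth bump function on `ℝ^ι`, equal to `1` on the unit ball and supported in the ball of
radius `2`. -/
noncomputable def bump (ι : Type*) [Fintype ι] : ContDiffBump (0 : EuclideanSpace ℝ ι) :=
  ⟨1, 2, zero_lt_one, one_lt_two⟩

/-- The cutoff function to the anisotropic box `|ξ_l| ≲ R^{a(l,l₀)}`. With these side lengths
`1 + P̂_l(ξ) ≲ R^{a(l,l₀)}` on the box for every `l`. -/
noncomputable def cut (a : Matrix ι ι ℝ) (l₀ : ι) (R : ℝ) (ξ : EuclideanSpace ℝ ι) : ℂ :=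
  (bump ι (diag (fun l => R ^ (-a l l₀)) ξ) : ℝ)

theorem contDiff_bump : ContDiff ℝ ∞ fun ξ : EuclideanSpace ℝ ι => ((bump ι ξ : ℝ) : ℂ) :=
  Complex.ofRealCLM.contDiff.comp (bump ι).contDiff

theorem contDiff_cut (a : Matrix ι ι ℝ) (l₀ : ι) (R : ℝ) : ContDiff ℝ ∞ (cut a l₀ R) :=
  contDiff_bump.comp (diag fun l => R ^ (-a l l₀)).contDiff

theorem hasCompactSupport_bump :
    HasCompactSupport fun ξ : EuclideanSpace ℝ ι => ((bump ι ξ : ℝ) : ℂ) :=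
  (bump ι).hasCompactSupport.comp_left (g := fun r : ℝ => (r : ℂ)) Complex.ofReal_zero

theorem hasCompactSupport_cut (a : Matrix ι ι ℝ) (l₀ : ι) {R : ℝ} (hR : 0 < R) :
    HasCompactSupport (cut a l₀ R) :=
  hasCompactSupport_bump.comp_isClosedEmbedding
    (isClosedEmbedding_diag fun _ => Real.rpow_pos_of_pos hR _)

theorem norm_le_two_of_bump_ne_zero {L : List ι} {ξ : EuclideanSpace ℝ ι}
    (h : pd L (fun ξ : EuclideanSpace ℝ ι => ((bump ι ξ : ℝ) : ℂ)) ξ ≠ 0) : ‖ξ‖ ≤ 2 := by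
  by_contra h2
  refine h (pd_eq_zero_of_notMem_tsupport (fun h3 => h2 ?_) L)
  have h4 : tsupport (fun ξ : EuclideanSpace ℝ ι => ((bump ι ξ : ℝ) : ℂ)) ⊆ tsupport (bump ι) :=
    tsupport_comp_subset (g := fun r : ℝ => (r : ℂ)) Complex.ofReal_zero _
  have h5 := h4 h3
  rw [(bump ι).tsupport_eq] at h5
  exact mem_closedBall_zero_iff.1 h5

theorem cut_eq_one (a : Matrix ι ι ℝ) (l₀ : ι) {R : ℝ} {ξ : EuclideanSpace ℝ ι}
    (h : ‖diag (fun l => R ^ (-a l l₀)) ξ‖ ≤ 1) : cut a l₀ R ξ = 1 := by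
  rw [cut, (bump ι).one_of_mem_closedBall (by rw [mem_closedBall_zero_iff]; exact h)]
  simp

/-- The cutoff functions satisfy symbol bounds uniformly in `R`. -/
theorem exists_symbolBound_cut {a : Matrix ι ι ℝ} (ha : BasicHypothesis a) (l₀ : ι) :
    ∃ C : List ι → ℝ, (∀ L, 0 ≤ C L) ∧
      ∀ R : ℝ, 1 ≤ R → SymbolBound a C (fun _ => 1) (cut a l₀ R) := by
  have hB : ∀ L : List ι, ∃ B : ℝ, ∀ ξ,
      ‖pd L (fun ξ : EuclideanSpace ℝ ι => ((bump ι ξ : ℝ) : ℂ)) ξ‖ ≤ B := fun L =>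
    (hasCompactSupport_pd hasCompactSupport_bump L).exists_bound_of_continuous
      (contDiff_pd contDiff_bump L).continuous
  choose B hB using hB
  obtain ⟨m, -, hm⟩ := exists_exponent_bound a
  set κ : ℝ := 1 + Fintype.card ι * 2 ^ m with hκ
  have hB0 : ∀ L, 0 ≤ B L := fun L => (norm_nonneg _).trans (hB L 0)
  have hκ0 : 0 ≤ κ := by positivity
  refine ⟨fun L => B L * κ ^ L.length, fun L => mul_nonneg (hB0 L) (by positivity),
    fun R hR L ξ => ?_⟩
  have hR0 : 0 < R := zero_lt_one.trans_le hR
  have hpos := prod_map_one_add_Ph_pos a L ξ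
  have e : pd L (cut a l₀ R) ξ = _ :=
    pd_comp_diag contDiff_bump (fun l => R ^ (-a l l₀)) L ξ
  rw [e]
  by_cases h0 : pd L (fun ξ : EuclideanSpace ℝ ι => ((bump ι ξ : ℝ) : ℂ))
      (diag (fun l => R ^ (-a l l₀)) ξ) = 0
  · rw [h0, smul_zero, norm_zero]
    have := hB0 L
    positivity
  have h2 := norm_le_two_of_bump_ne_zero h0
  have hξ : ∀ l, |ξ l| ≤ 2 * R ^ a l l₀ := by
    intro l
    have h3 := (PiLp.norm_apply_le (diag (fun l => R ^ (-a l l₀)) ξ) l).trans h2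
    rw [diag_apply, norm_mul, Real.norm_eq_abs, Real.norm_eq_abs,
      abs_of_pos (Real.rpow_pos_of_pos hR0 _), Real.rpow_neg hR0.le, inv_mul_eq_div,
      div_le_iff₀ (Real.rpow_pos_of_pos hR0 _)] at h3
    exact h3
  have hPh : ∀ l, 1 + Ph a l ξ ≤ κ * R ^ a l l₀ := by
    intro l
    have h1 : 1 ≤ R ^ a l l₀ := Real.one_le_rpow hR (ha.pos _ _).le
    have h3 : Ph a l ξ ≤ Fintype.card ι * (2 ^ m * R ^ a l l₀) := by
      refine (Finset.sum_le_sum (g := fun _ => 2 ^ m * R ^ a l l₀) fun k _ => ?_).trans (by simp)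
      have hp := one_div_pos.2 (ha.pos k l)
      refine (Real.rpow_le_rpow (abs_nonneg _) (hξ k) hp.le).trans ?_
      rw [Real.mul_rpow (by norm_num) (Real.rpow_nonneg hR0.le _), ← Real.rpow_mul hR0.le]
      have h4 : a k l₀ * (1 / a k l) ≤ a l l₀ := by
        rw [mul_one_div, div_le_iff₀ (ha.pos k l), mul_comm]
        exact ha.submul _ _ _
      exact mul_le_mul (rpow_le_pow_of_one_le one_le_two (hm _ _).2)
        (Real.rpow_le_rpow_of_exponent_le hR h4) (Real.rpow_nonneg hR0.le _) (by positivity)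
    rw [hκ]; linarith
  have hprod : ∀ L : List ι, 0 ≤ (L.map fun l => R ^ (-a l l₀)).prod ∧
      (L.map fun l => R ^ (-a l l₀)).prod * (L.map fun l => 1 + Ph a l ξ).prod ≤
        κ ^ L.length := by
    intro L
    induction L with
    | nil => simp
    | cons l L ih =>
      simp only [List.map_cons, List.prod_cons, List.length_cons]
      have h1 : 0 < R ^ (-a l l₀) := Real.rpow_pos_of_pos hR0 _
      have h3 : R ^ (-a l l₀) * (1 + Ph a l ξ) ≤ κ := by
        rw [Real.rpow_neg hR0.le, inv_mul_le_iff₀ (Real.rpow_pos_of_pos hR0 _), mul_comm]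
        exact hPh l
      refine ⟨mul_nonneg h1.le ih.1, ?_⟩
      calc _ = (R ^ (-a l l₀) * (1 + Ph a l ξ)) * ((L.map fun l => R ^ (-a l l₀)).prod *
            (L.map fun l => 1 + Ph a l ξ).prod) := by ring
        _ ≤ κ * κ ^ L.length := mul_le_mul h3 ih.2
            (mul_nonneg ih.1 (prod_map_one_add_Ph_pos a L ξ).le) hκ0
        _ = _ := by ring
  rw [le_div_iff₀ hpos, norm_smul, Real.norm_eq_abs, abs_of_nonneg (hprod L).1, mul_one]
  calc _ = (L.map fun l => R ^ (-a l l₀)).prod * (L.map fun l => 1 + Ph a l ξ).prod *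
        ‖pd L (fun ξ : EuclideanSpace ℝ ι => ((bump ι ξ : ℝ) : ℂ))
          (diag (fun l => R ^ (-a l l₀)) ξ)‖ := by ring
    _ ≤ κ ^ L.length * B L :=
        mul_le_mul (hprod L).2 (hB L _) (norm_nonneg _) (by positivity)
    _ = _ := by ring

/-- The difference of two cutoff functions lives where `1 + P̂_{l₀} ≳ R`, hence satisfies symbol
bounds with the small weight `(1 + P̂_{l₀}) / R`. -/
theorem exists_symbolBound_cut_sub {a : Matrix ι ι ℝ} (ha : BasicHypothesis a) (l₀ : ι) :
    ∃ C : List ι → ℝ, ∀ R R' : ℝ, 1 ≤ R → R ≤ R' →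
      SymbolBound a C (fun ξ => (1 + Ph a l₀ ξ) / R) fun ξ => cut a l₀ R ξ - cut a l₀ R' ξ := by
  obtain ⟨C, hC0, hC⟩ := exists_symbolBound_cut ha l₀
  obtain ⟨m, -, hm⟩ := exists_exponent_bound a
  have hn : (1 : ℝ) ≤ Fintype.card ι := by
    have : Nonempty ι := ⟨l₀⟩
    exact_mod_cast Fintype.card_pos
  refine ⟨fun L => 2 * C L * Fintype.card ι ^ m, fun R R' hR hRR' L ξ => ?_⟩
  have hR0 : 0 < R := zero_lt_one.trans_le hR
  have hR'0 : 0 < R' := hR0.trans_le hRR'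
  have hpos := prod_map_one_add_Ph_pos a L ξ
  have hpos' := one_add_Ph_pos a l₀ ξ
  by_cases h : ‖diag (fun l => R ^ (-a l l₀)) ξ‖ < 1
  · have hcont : Continuous fun ξ => ‖diag (fun l => R ^ (-a l l₀)) ξ‖ := by fun_prop
    have h1 : (fun ξ => cut a l₀ R ξ - cut a l₀ R' ξ) =ᶠ[𝓝 ξ] fun _ => 0 := by
      filter_upwards [hcont.continuousAt.eventually_lt_const h] with y hy
      rw [cut_eq_one a l₀ hy.le, cut_eq_one a l₀, sub_self]
      refine (norm_diag_le_of_abs_le (fun l => ?_) y).trans hy.le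
      rw [abs_of_pos (Real.rpow_pos_of_pos hR0 _), abs_of_pos (Real.rpow_pos_of_pos hR'0 _),
        Real.rpow_neg hR0.le, Real.rpow_neg hR'0.le]
      have := Real.rpow_pos_of_pos hR0 (a l l₀)
      have := (ha.pos l l₀).le
      gcongr
    rw [(pd_congr_of_eventuallyEq h1 L).eq_of_nhds, pd_zero, norm_zero]
    have := hC0 L
    positivity
  · have h1 : ∃ l, R ^ a l l₀ / Fintype.card ι ≤ |ξ l| := by
      by_contra! hlt
      refine h ((norm_le_sum_abs _).trans_lt ?_)
      have : ∑ _l : ι, (1 / Fintype.card ι : ℝ) = 1 := by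
        simp [Finset.sum_const, Finset.card_univ]
        field_simp
      rw [← this]
      refine Finset.sum_lt_sum_of_nonempty ⟨l₀, Finset.mem_univ _⟩ fun l _ => ?_
      have hRl := Real.rpow_pos_of_pos hR0 (a l l₀)
      have := hlt l
      rw [diag_apply, abs_mul, Real.rpow_neg hR0.le, abs_of_pos (inv_pos.2 hRl),
        inv_mul_lt_iff₀ hRl, mul_one_div]
      exact this
    obtain ⟨l, hl⟩ := h1
    have hRl := Real.rpow_pos_of_pos hR0 (a l l₀)
    have hp := one_div_pos.2 (ha.pos l l₀)
    have h2 : R ≤ Fintype.card ι ^ m * (1 + Ph a l₀ ξ) := by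
      have h3 : R ^ a l l₀ ≤ Fintype.card ι * |ξ l| := by
        rwa [div_le_iff₀ (zero_lt_one.trans_le hn), mul_comm] at hl
      have h4 := Real.rpow_le_rpow hRl.le h3 hp.le
      rw [← Real.rpow_mul hR0.le, mul_one_div_cancel (ha.pos l l₀).ne', Real.rpow_one,
        Real.mul_rpow (Nat.cast_nonneg _) (abs_nonneg _)] at h4
      refine h4.trans (mul_le_mul (rpow_le_pow_of_one_le hn (hm _ _).2)
        ((rpow_le_Ph a l₀ l ξ).trans (by linarith)) (Real.rpow_nonneg (abs_nonneg _) _)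
        (by positivity))
    rw [pd_sub (contDiff_cut a l₀ R) (contDiff_cut a l₀ R')]
    have b1 := hC R hR L ξ
    have b2 := hC R' (hR.trans hRR') L ξ
    refine (norm_sub_le _ _).trans ((add_le_add b1 b2).trans ?_)
    rw [← add_div]
    have h5 : 1 ≤ Fintype.card ι ^ m * ((1 + Ph a l₀ ξ) / R) := by
      rw [mul_div_assoc', one_le_div₀ hR0]; exact h2
    have := hC0 L
    gcongr
    calc C L * 1 + C L * 1 = 2 * C L * 1 := by ring
      _ ≤ 2 * C L * (Fintype.card ι ^ m * ((1 + Ph a l₀ ξ) / R)) := by gcongr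
      _ = _ := by ring

theorem tendsto_cut {a : Matrix ι ι ℝ} (ha : BasicHypothesis a) (l₀ : ι)
    (ξ : EuclideanSpace ℝ ι) :
    Tendsto (fun i : ℕ => cut a l₀ (i + 1) ξ) atTop (𝓝 1) := by
  have h1 : Tendsto (fun i : ℕ => ((i : ℝ) + 1)) atTop atTop :=
    tendsto_atTop_add_const_right _ _ tendsto_natCast_atTop_atTop
  have h2 : Tendsto (fun i : ℕ => ∑ l, |((i : ℝ) + 1) ^ (-a l l₀) * ξ l|) atTop (𝓝 0) := by
    have : (0 : ℝ) = ∑ l : ι, |0 * ξ l| := by simp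
    rw [this]
    exact tendsto_finsetSum _ fun l _ =>
      (((tendsto_rpow_neg_atTop (ha.pos l l₀)).comp h1).mul_const _).abs
  refine tendsto_const_nhds.congr' ?_
  filter_upwards [h2.eventually_le_const zero_lt_one] with i hi
  exact (cut_eq_one a l₀ ((norm_le_sum_abs _).trans hi)).symm

end Cutoff

/-! ### The kernel of a multiplier -/

section Kernel

variable {ι : Type*} [Fintype ι]

theorem integrable_exp_mul {f : EuclideanSpace ℝ ι → ℂ} (hf : Integrable f)
    (x : EuclideanSpace ℝ ι) :
    Integrable fun ξ => Complex.exp (2 * π * Complex.I * (inner ℝ ξ x : ℝ)) * f ξ := by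
  refine hf.bdd_mul (c := 1) (Continuous.aestronglyMeasurable (by fun_prop))
    (Eventually.of_forall fun ξ => (norm_exp_inner ξ x).le)

theorem osc_sub {f g : EuclideanSpace ℝ ι → ℂ} (hf : Integrable f) (hg : Integrable g)
    (x : EuclideanSpace ℝ ι) : osc (fun ξ => f ξ - g ξ) x = osc f x - osc g x := by
  simp only [osc, mul_sub]
  exact integral_sub (integrable_exp_mul hf x) (integrable_exp_mul hg x)

/-- Differentiating an oscillatory integral multiplies the integrand by `2πi ξ_l`. -/
theorem hasFDerivAt_osc {f : EuclideanSpace ℝ ι → ℂ} (hf : Continuous f)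
    (hf' : HasCompactSupport f) (x : EuclideanSpace ℝ ι) :
    HasFDerivAt (osc f) (∑ l, (EuclideanSpace.proj l : EuclideanSpace ℝ ι →L[ℝ] ℝ).smulRight
      (osc (fun ξ => mono l ξ * f ξ) x)) x := by
  set F' : EuclideanSpace ℝ ι → EuclideanSpace ℝ ι → EuclideanSpace ℝ ι →L[ℝ] ℂ := fun x ξ =>
    ∑ l, (EuclideanSpace.proj l : EuclideanSpace ℝ ι →L[ℝ] ℝ).smulRight
      (Complex.exp (2 * π * Complex.I * (inner ℝ ξ x : ℝ)) * (mono l ξ * f ξ)) with hF'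
  have hmono : ∀ l, Integrable fun ξ => mono l ξ * f ξ := fun l =>
    ((contDiff_mono l).continuous.mul hf).integrable_of_hasCompactSupport hf'.mul_left
  have hcont : ∀ l, Continuous fun ξ : EuclideanSpace ℝ ι => mono l ξ := fun l =>
    (contDiff_mono l).continuous
  have e : ∫ ξ, F' x ξ = ∑ l, (EuclideanSpace.proj l : EuclideanSpace ℝ ι →L[ℝ] ℝ).smulRight
      (osc (fun ξ => mono l ξ * f ξ) x) := by
    have hl : ∀ l, Integrable fun ξ => (EuclideanSpace.proj l :
        EuclideanSpace ℝ ι →L[ℝ] ℝ).smulRight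
        (Complex.exp (2 * π * Complex.I * (inner ℝ ξ x : ℝ)) * (mono l ξ * f ξ)) := fun l =>
      (ContinuousLinearMap.smulRightL ℝ (EuclideanSpace ℝ ι) ℂ
        (EuclideanSpace.proj l)).integrable_comp (integrable_exp_mul (hmono l) x)
    rw [hF', integral_finsetSum _ fun l _ => hl l]
    refine Finset.sum_congr rfl fun l _ => ?_
    exact (ContinuousLinearMap.smulRightL ℝ (EuclideanSpace ℝ ι) ℂ
        (EuclideanSpace.proj l)).integral_comp_comm (integrable_exp_mul (hmono l) x)
  rw [← e]
  refine hasFDerivAt_integral_of_dominated_of_fderiv_le (s := Set.univ) (F' := F')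
    (bound := fun ξ => ∑ l, ‖(EuclideanSpace.proj l : EuclideanSpace ℝ ι →L[ℝ] ℝ)‖ *
      ‖mono l ξ * f ξ‖) Filter.univ_mem
    (Eventually.of_forall fun y => ?_)
    (integrable_exp_mul (hf.integrable_of_hasCompactSupport hf') x) ?_ ?_ ?_ ?_
  · exact Continuous.aestronglyMeasurable (by fun_prop)
  · refine Continuous.aestronglyMeasurable ?_
    refine continuous_finsetSum _ fun l _ => ?_
    have := hcont l
    exact (ContinuousLinearMap.smulRightL ℝ (EuclideanSpace ℝ ι) ℂ
        (EuclideanSpace.proj l)).continuous.comp (by fun_prop)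
  · refine Eventually.of_forall fun ξ y _ => (norm_sum_le _ _).trans
      (Finset.sum_le_sum fun l _ => ?_)
    rw [ContinuousLinearMap.norm_smulRight_apply, norm_mul, norm_exp_inner, one_mul]
  · exact integrable_finsetSum _ fun l _ => (hmono l).norm.const_mul _
  · refine Eventually.of_forall fun ξ y _ => ?_
    have h1 : HasFDerivAt (fun y : EuclideanSpace ℝ ι => ((inner ℝ ξ y : ℝ) : ℂ))
        (Complex.ofRealCLM.comp (innerSL ℝ ξ)) y :=
      (Complex.ofRealCLM.comp (innerSL ℝ ξ)).hasFDerivAt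
    have h2 := ((h1.const_mul (2 * π * Complex.I)).cexp).mul_const (f ξ)
    refine h2.congr_fderiv ?_
    ext v
    have h3 : (inner ℝ ξ v : ℝ) = ∑ l, v l * ξ l := by
      rw [PiLp.inner_apply]; rfl
    have h4 : ((inner ℝ ξ v : ℝ) : ℂ) = ∑ l, (v l : ℂ) * (ξ l : ℂ) := by
      rw [h3]; push_cast; rfl
    have h5 : (F' y ξ) v = ∑ l, (v l : ℂ) * (Complex.exp (2 * π * Complex.I *
        (inner ℝ ξ y : ℝ)) * (mono l ξ * f ξ)) := by
      simp [hF']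
    rw [h5]
    change f ξ * (Complex.exp (2 * π * Complex.I * (inner ℝ ξ y : ℝ)) *
      (2 * π * Complex.I * ((inner ℝ ξ v : ℝ) : ℂ))) = _
    rw [h4, Finset.mul_sum, Finset.mul_sum, Finset.mul_sum]
    refine Finset.sum_congr rfl fun l _ => ?_
    rw [mono]; ring

theorem isJet_osc_monoMul {f : EuclideanSpace ℝ ι → ℂ} (hf : ContDiff ℝ ∞ f)
    (hf' : HasCompactSupport f) (U : Set (EuclideanSpace ℝ ι)) :
    IsJet U fun Γ => osc (monoMul f Γ) := fun Γ x _ =>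
  hasFDerivAt_osc (contDiff_monoMul hf Γ).continuous (hasCompactSupport_monoMul hf' Γ) x

/-- Fubini's theorem for oscillatory integrals. -/
theorem integral_mul_osc_comm {f φ : EuclideanSpace ℝ ι → ℂ} (hf : Integrable f)
    (hφ : Integrable φ) : ∫ ξ, f ξ * osc φ ξ = ∫ x, φ x * osc f x := by
  have h1 : Integrable (fun z : EuclideanSpace ℝ ι × EuclideanSpace ℝ ι =>
      Complex.exp (2 * π * Complex.I * (inner ℝ z.2 z.1 : ℝ)) * (f z.1 * φ z.2))
      (volume.prod volume) := by
    refine (hf.mul_prod hφ).bdd_mul (c := 1) (Continuous.aestronglyMeasurable (by fun_prop))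
      (Eventually.of_forall fun z => (norm_exp_inner z.2 z.1).le)
  calc ∫ ξ, f ξ * osc φ ξ
      = ∫ ξ, ∫ x, Complex.exp (2 * π * Complex.I * (inner ℝ x ξ : ℝ)) * (f ξ * φ x) := by
        refine integral_congr_ae (Eventually.of_forall fun ξ => ?_)
        simp only [osc]
        rw [← integral_const_mul]
        exact integral_congr_ae (Eventually.of_forall fun x => by ring)
    _ = ∫ x, ∫ ξ, Complex.exp (2 * π * Complex.I * (inner ℝ x ξ : ℝ)) * (f ξ * φ x) :=
        integral_integral_swap h1
    _ = ∫ x, φ x * osc f x := by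
        refine integral_congr_ae (Eventually.of_forall fun x => ?_)
        simp only [osc]
        rw [← integral_const_mul]
        refine integral_congr_ae (Eventually.of_forall fun ξ => ?_)
        simp only
        rw [real_inner_comm]; ring

/-- A bounded symbol `m` with `|∂^L m| ≤ C_L t ∏_{l ∈ L} (1 + P̂_l)⁻¹` has a kernel that is smooth
off the origin; the constants in the estimates of the kernel depend on `m` only through `C`, and
linearly on `t`. The kernel is the limit of those of the truncations `cut · m`. -/
theorem exists_kernel [Nonempty ι] {a : Matrix ι ι ℝ} (ha : BasicHypothesis a) (C : List ι → ℝ) :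
    ∃ K : List ι → ℕ → ℝ, ∀ (t : ℝ), 0 ≤ t → ∀ m : EuclideanSpace ℝ ι → ℂ, ContDiff ℝ ∞ m →
      SymbolBound a C (fun _ => t) m →
      ∃ g : List ι → EuclideanSpace ℝ ι → ℂ, IsJet {0}ᶜ g ∧
        (∀ Γ M x, x ≠ 0 → ‖g Γ x‖ ≤ K Γ M * t * decay a Γ M x) ∧
        ∀ φ : EuclideanSpace ℝ ι → ℂ, Continuous φ → HasCompactSupport φ → Integrable (osc φ) →
          0 ∉ tsupport φ → ∫ ξ, m ξ * osc φ ξ = ∫ x, φ x * g [] x := by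
  classical
  obtain ⟨l₀⟩ := ‹Nonempty ι›
  obtain ⟨C1, -, hC1⟩ := exists_symbolBound_cut ha l₀
  obtain ⟨C2, hC2⟩ := exists_symbolBound_cut_sub ha l₀
  obtain ⟨C3, hC3⟩ := SymbolBound.mul a C1 C
  obtain ⟨C4, hC4⟩ := SymbolBound.mul a C2 C
  choose C5 hC5 using exists_symbolBound_monoMul ha C3
  choose C6 hC6 using exists_symbolBound_monoMul ha C4
  choose K hK0 hK using fun (Γ : List ι) (M : ℕ) => exists_norm_osc_le ha Γ (C5 Γ) M
  choose K' hK'0 hK' using fun (Γ : List ι) => exists_norm_osc_le ha (l₀ :: Γ) (C6 Γ) 0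
  refine ⟨K, fun t ht m hm hmb => ?_⟩
  set f : ℕ → EuclideanSpace ℝ ι → ℂ := fun i ξ => cut a l₀ (i + 1) ξ * m ξ with hf
  have hi1 : ∀ i : ℕ, (1 : ℝ) ≤ i + 1 := fun i => by
    have : (0 : ℝ) ≤ i := Nat.cast_nonneg i
    linarith
  have hi0 : ∀ i : ℕ, (0 : ℝ) < i + 1 := fun i => zero_lt_one.trans_le (hi1 i)
  have hfs : ∀ i, ContDiff ℝ ∞ (f i) := fun i => (contDiff_cut a l₀ _).mul hm
  have hfc : ∀ i, HasCompactSupport (f i) := fun i => (hasCompactSupport_cut a l₀ (hi0 i)).mul_right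
  have hfb : ∀ i, SymbolBound a C3 (fun _ => 1 * t) (f i) := fun i =>
    hC3 _ _ _ _ (contDiff_cut a l₀ _) hm (fun _ => zero_le_one) (fun _ => ht) (hC1 _ (hi1 i)) hmb
  set J : ℕ → List ι → EuclideanSpace ℝ ι → ℂ := fun i Γ => osc (monoMul (f i) Γ) with hJ
  have hint : ∀ i Γ, Integrable (monoMul (f i) Γ) := fun i Γ =>
    (contDiff_monoMul (hfs i) Γ).continuous.integrable_of_hasCompactSupport
      (hasCompactSupport_monoMul (hfc i) Γ)
  have hJb : ∀ i Γ M x, x ≠ 0 → ‖J i Γ x‖ ≤ K Γ M * t * decay a Γ M x := by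
    intro i Γ M x hx
    refine hK Γ M _ (contDiff_monoMul (hfs i) Γ) (hasCompactSupport_monoMul (hfc i) Γ) t ht ?_ x hx
    have := hC5 Γ (f i) (fun _ => 1 * t) (hfs i) (fun _ => by positivity) (hfb i)
    convert this using 2
    ring
  -- the weight `(1 + P̂_{l₀}) / (i + 1)` of a difference of cutoffs costs one more factor
  -- `P_{l₀}(x)⁻¹` and gains `(i + 1)⁻¹`: the truncated kernels are locally uniformly Cauchy
  have hJd : ∀ i j, i ≤ j → ∀ Γ x, x ≠ 0 →
      ‖J i Γ x - J j Γ x‖ ≤ K' Γ * (t / (i + 1)) * decay a (l₀ :: Γ) 0 x := by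
    intro i j hij Γ x hx
    have e : monoMul (fun ξ => f i ξ - f j ξ) Γ = fun ξ => monoMul (f i) Γ ξ - monoMul (f j) Γ ξ :=
      funext fun ξ => monoMul_sub _ _ _ _
    have e2 : J i Γ x - J j Γ x = osc (monoMul (fun ξ => f i ξ - f j ξ) Γ) x := by
      rw [e, osc_sub (hint i Γ) (hint j Γ)]
    have hs : ContDiff ℝ ∞ fun ξ => f i ξ - f j ξ := (hfs i).sub (hfs j)
    have hc : HasCompactSupport fun ξ => f i ξ - f j ξ := (hfc i).sub (hfc j)
    rw [e2]
    refine hK' Γ _ (contDiff_monoMul hs Γ) (hasCompactSupport_monoMul hc Γ) _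
      (div_nonneg ht (hi0 i).le) ?_ x hx
    have hij' : (i : ℝ) + 1 ≤ j + 1 := by
      have : (i : ℝ) ≤ j := Nat.cast_le.2 hij
      linarith
    have h1 := hC4 _ m (fun ξ => (1 + Ph a l₀ ξ) / (i + 1)) (fun _ => t)
      ((contDiff_cut a l₀ (i + 1)).sub (contDiff_cut a l₀ (j + 1))) hm
      (fun ξ => div_nonneg (one_add_Ph_pos a l₀ ξ).le (hi0 i).le) (fun _ => ht)
      (hC2 _ _ (hi1 i) hij') hmb
    have e3 : (fun ξ => (cut a l₀ (i + 1) ξ - cut a l₀ (j + 1) ξ) * m ξ) =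
        fun ξ => f i ξ - f j ξ := by
      funext ξ; simp only [hf]; ring
    rw [e3] at h1
    have h2 := hC6 Γ _ _ hs (fun ξ => mul_nonneg
      (div_nonneg (one_add_Ph_pos a l₀ ξ).le (hi0 i).le) ht) h1
    convert h2 using 2
    simp only [List.map_cons, List.prod_cons]
    ring
  have hε : Tendsto (fun i : ℕ => t / ((i : ℝ) + 1)) atTop (𝓝 0) :=
    tendsto_const_nhds.div_atTop
      (tendsto_atTop_add_const_right _ _ tendsto_natCast_atTop_atTop)
  set g : List ι → EuclideanSpace ℝ ι → ℂ := fun Γ x => limUnder atTop fun i => J i Γ x with hg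
  have hlim : ∀ Γ x, x ≠ 0 → Tendsto (fun i => J i Γ x) atTop (𝓝 (g Γ x)) := by
    intro Γ x hx
    refine CauchySeq.tendsto_limUnder ?_
    refine cauchySeq_of_le_tendsto_0' (fun i => K' Γ * (t / (i + 1)) * decay a (l₀ :: Γ) 0 x)
      (fun i j hij => ?_) ?_
    · rw [dist_eq_norm]; exact hJd i j hij Γ x hx
    · simpa using (hε.const_mul (K' Γ)).mul_const (decay a (l₀ :: Γ) 0 x)
  have hgb : ∀ Γ M x, x ≠ 0 → ‖g Γ x‖ ≤ K Γ M * t * decay a Γ M x := fun Γ M x hx =>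
    le_of_tendsto (hlim Γ x hx).norm (Eventually.of_forall fun i => hJb i Γ M x hx)
  have hjet : IsJet {0}ᶜ g := by
    refine IsJet.of_tendsto isOpen_compl_singleton (G := J)
      (fun i => isJet_osc_monoMul (hfs i) (hfc i) _) (fun Γ x => K' Γ * decay a (l₀ :: Γ) 0 x)
      (fun Γ => continuousOn_const.mul (continuousOn_decay ha _ _)) _ hε
      (fun i => div_nonneg ht (hi0 i).le) fun i Γ x hx => ?_
    have h1 : Tendsto (fun j => ‖J i Γ x - J j Γ x‖) atTop (𝓝 ‖J i Γ x - g Γ x‖) :=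
      (tendsto_const_nhds.sub (hlim Γ x hx)).norm
    refine (le_of_tendsto h1 ?_).trans (le_of_eq (by ring :
      K' Γ * (t / (i + 1)) * decay a (l₀ :: Γ) 0 x = _))
    filter_upwards [eventually_ge_atTop i] with j hij
    exact hJd i j hij Γ x hx
  refine ⟨g, hjet, hgb, fun φ hφ hφc hφi h0 => ?_⟩
  have hswap : ∀ i, ∫ ξ, f i ξ * osc φ ξ = ∫ x, φ x * J i [] x := fun i =>
    integral_mul_osc_comm (hint i []) (hφ.integrable_of_hasCompactSupport hφc)
  have hl1 : Tendsto (fun i => ∫ ξ, f i ξ * osc φ ξ) atTop (𝓝 (∫ ξ, m ξ * osc φ ξ)) := by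
    refine tendsto_integral_of_dominated_convergence (fun ξ => C3 [] * t * ‖osc φ ξ‖)
      (fun i => ((hfs i).continuous.aestronglyMeasurable).mul hφi.aestronglyMeasurable)
      (hφi.norm.const_mul _) (fun i => Eventually.of_forall fun ξ => ?_)
      (Eventually.of_forall fun ξ => ?_)
    · rw [norm_mul]
      gcongr
      simpa using hfb i [] ξ
    · have := ((tendsto_cut ha l₀ ξ).mul_const (m ξ)).mul_const (osc φ ξ)
      simpa [hf] using this
  obtain ⟨B, hB⟩ : ∃ B, ∀ x ∈ tsupport φ, decay a [] 0 x ≤ B := by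
    have hK2 : IsCompact (tsupport φ) := hφc
    obtain ⟨B, hB⟩ := hK2.bddAbove_image ((continuousOn_decay ha [] 0).mono
      (fun x hx => by rintro rfl; exact h0 hx))
    exact ⟨B, fun x hx => hB (Set.mem_image_of_mem _ hx)⟩
  have hl2 : Tendsto (fun i => ∫ x, φ x * J i [] x) atTop (𝓝 (∫ x, φ x * g [] x)) := by
    refine tendsto_integral_of_dominated_convergence (fun x => ‖φ x‖ * (K [] 0 * t * B))
      (fun i => hφ.aestronglyMeasurable.mul ?_)
      ((hφ.integrable_of_hasCompactSupport hφc).norm.mul_const _)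
      (fun i => Eventually.of_forall fun x => ?_)
      (Eventually.of_forall fun x => ?_)
    · exact ((isJet_osc_monoMul (hfs i) (hfc i) Set.univ).contDiff
        []).continuous.aestronglyMeasurable
    · by_cases hx : x ∈ tsupport φ
      · have hx0 : x ≠ 0 := by rintro rfl; exact h0 hx
        rw [norm_mul]
        have h1 := hJb i [] 0 x hx0
        have h2 := hB x hx
        have h3 : 0 ≤ K [] 0 * t := mul_nonneg (hK0 _ _) ht
        gcongr
        exact h1.trans (mul_le_mul_of_nonneg_left h2 h3)
      · rw [image_eq_zero_of_notMem_tsupport hx]; simp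
    · by_cases hx : x ∈ tsupport φ
      · have hx0 : x ≠ 0 := by rintro rfl; exact h0 hx
        exact (hlim [] x hx0).const_mul _
      · rw [image_eq_zero_of_notMem_tsupport hx]; simp
  simp_rw [hswap] at hl1
  exact tendsto_nhds_unique hl1 hl2

end Kernel

/-! ### The Fourier transform of dilated test functions -/

section TestFunctions

variable {ι : Type*} [Fintype ι]

theorem diag_inv_diag {c : ι → ℝ} (hc : ∀ l, 0 < c l) (x : EuclideanSpace ℝ ι) :
    diag c⁻¹ (diag c x) = x := by
  ext l
  simp [diag_apply, inv_mul_cancel_left₀ (hc l).ne']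

/-- A diagonal change of variables, with its Jacobian `r`. -/
theorem exists_integral_comp_diag {c : ι → ℝ} (hc : ∀ l, 0 < c l) :
    ∃ r : ℝ, 0 < r ∧ (∀ f : EuclideanSpace ℝ ι → ℂ, ∫ x, f (diag c x) = r • ∫ x, f x) ∧
      ∀ f : EuclideanSpace ℝ ι → ℝ, ∫ x, f (diag c⁻¹ x) = r⁻¹ • ∫ x, f x := by
  have hdet : LinearMap.det (diag c).toLinearMap ≠ 0 := by
    rw [← isUnit_iff_ne_zero]
    exact LinearMap.isUnit_det _
      ((LinearMap.isUnit_iff_ker_eq_bot _).2 (LinearMap.ker_eq_bot.2 (diag_injective hc)))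
  have hmap : Measure.map (diag c) (volume : Measure (EuclideanSpace ℝ ι)) =
      ENNReal.ofReal |(LinearMap.det (diag c).toLinearMap)⁻¹| • volume :=
    Measure.map_linearMap_addHaar_eq_smul_addHaar volume hdet
  have hemb : MeasurableEmbedding (diag c) := (isClosedEmbedding_diag hc).measurableEmbedding
  have hr : 0 < |(LinearMap.det (diag c).toLinearMap)⁻¹| := abs_pos.2 (inv_ne_zero hdet)
  refine ⟨_, hr, fun f => ?_, fun f => ?_⟩
  · rw [← hemb.integral_map (μ := volume) f, hmap, integral_smul_measure,
      ENNReal.toReal_ofReal (abs_nonneg _)]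
  · have h := hemb.integral_map (μ := volume) fun x => f (diag c⁻¹ x)
    rw [hmap, integral_smul_measure, ENNReal.toReal_ofReal (abs_nonneg _)] at h
    simp only [diag_inv_diag hc] at h
    rw [← h, smul_smul, inv_mul_cancel₀ hr.ne', one_smul]

end TestFunctions

/-! ### Splitting the coordinates into two groups -/

theorem glue_ext {α β ι : Type*} (e : α ⊕ β ≃ ι) {x y : EuclideanSpace ℝ ι}
    (h1 : ∀ i, x (e (Sum.inl i)) = y (e (Sum.inl i)))
    (h2 : ∀ j, x (e (Sum.inr j)) = y (e (Sum.inr j))) : x = y := by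
  ext l
  obtain ⟨s, rfl⟩ := e.surjective l
  rcases s with i | j
  exacts [h1 i, h2 j]

section Splitting

variable {α β ι : Type*} [Fintype α] [Fintype β] [Fintype ι]

/-- The linear identification of `ℝ^α × ℝ^β` with `ℝ^ι` given by a bijection `α ⊕ β ≃ ι`. -/
noncomputable def glue (e : α ⊕ β ≃ ι) :
    EuclideanSpace ℝ α × EuclideanSpace ℝ β →L[ℝ] EuclideanSpace ℝ ι :=
  LinearMap.toContinuousLinearMap
    { toFun := fun z => WithLp.toLp 2 fun l =>
        Sum.elim (fun i => z.1 i) (fun j => z.2 j) (e.symm l)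
      map_add' := fun z z' => by
        ext l
        rcases h : e.symm l with i | j <;> simp [h]
      map_smul' := fun r z => by
        ext l
        rcases h : e.symm l with i | j <;> simp [h] }

@[simp] theorem glue_inl (e : α ⊕ β ≃ ι) (z : EuclideanSpace ℝ α × EuclideanSpace ℝ β) (i : α) :
    glue e z (e (Sum.inl i)) = z.1 i := by
  change Sum.elim (fun i => z.1 i) (fun j => z.2 j) (e.symm (e (Sum.inl i))) = _
  simp

@[simp] theorem glue_inr (e : α ⊕ β ≃ ι) (z : EuclideanSpace ℝ α × EuclideanSpace ℝ β) (j : β) :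
    glue e z (e (Sum.inr j)) = z.2 j := by
  change Sum.elim (fun i => z.1 i) (fun j => z.2 j) (e.symm (e (Sum.inr j))) = _
  simp

theorem glue_injective (e : α ⊕ β ≃ ι) : Function.Injective (glue e) := by
  intro z z' h
  refine Prod.ext ?_ ?_
  · ext i; rw [← glue_inl e z, h, glue_inl]
  · ext j; rw [← glue_inr e z, h, glue_inr]

theorem measurePreserving_glue (e : α ⊕ β ≃ ι) : MeasurePreserving (glue e) := by
  have h1 := (PiLp.volume_preserving_ofLp α).prod (PiLp.volume_preserving_ofLp β)
  have h2 := volume_measurePreserving_sumPiEquivProdPi_symm (fun _ : α ⊕ β => ℝ)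
  have h3 := volume_measurePreserving_piCongrLeft (fun _ : ι => ℝ) e
  have h4 := PiLp.volume_preserving_toLp ι
  have h := (h4.comp h3).comp (h2.comp h1)
  have hfun : ⇑(glue e) = (WithLp.toLp 2 ∘ MeasurableEquiv.piCongrLeft (fun _ : ι => ℝ) e) ∘
      (MeasurableEquiv.sumPiEquivProdPi fun _ : α ⊕ β => ℝ).symm ∘
        Prod.map WithLp.ofLp WithLp.ofLp := by
    funext z
    refine glue_ext e (fun i => ?_) fun j => ?_
    · rw [glue_inl]
      simp [MeasurableEquiv.piCongrLeft, Equiv.piCongrLeft]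
      rfl
    · rw [glue_inr]
      simp [MeasurableEquiv.piCongrLeft, Equiv.piCongrLeft]
      rfl
  rw [hfun]
  exact h

theorem measurableEmbedding_glue (e : α ⊕ β ≃ ι) : MeasurableEmbedding (glue e) :=
  (LinearMap.isClosedEmbedding_of_injective (f := (glue e).toLinearMap)
    (LinearMap.ker_eq_bot.2 (glue_injective e))).measurableEmbedding

theorem integral_comp_glue {F : Type*} [NormedAddCommGroup F] [NormedSpace ℝ F] (e : α ⊕ β ≃ ι)
    (f : EuclideanSpace ℝ ι → F) : ∫ z, f (glue e z) = ∫ x, f x :=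
  (measurePreserving_glue e).integral_comp (measurableEmbedding_glue e) f

theorem inner_glue (e : α ⊕ β ≃ ι) (z z' : EuclideanSpace ℝ α × EuclideanSpace ℝ β) :
    (inner ℝ (glue e z) (glue e z') : ℝ) = inner ℝ z.1 z'.1 + inner ℝ z.2 z'.2 := by
  simp only [PiLp.inner_apply]
  rw [← Equiv.sum_comp e, Fintype.sum_sum_type]
  simp only [glue_inl, glue_inr]

/-- The Fourier transform of a tensor product. -/
theorem osc_tensor (e : α ⊕ β ≃ ι) {φ : EuclideanSpace ℝ α → ℂ} {ψ : EuclideanSpace ℝ β → ℂ}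
    {χ : EuclideanSpace ℝ ι → ℂ} (h : ∀ z, χ (glue e z) = φ z.1 * ψ z.2)
    (z : EuclideanSpace ℝ α × EuclideanSpace ℝ β) :
    osc χ (glue e z) = osc φ z.1 * osc ψ z.2 := by
  rw [osc, ← integral_comp_glue e, osc, osc, ← integral_prod_mul]
  refine integral_congr_ae (Eventually.of_forall fun y => ?_)
  simp only [h, inner_glue]
  push_cast
  rw [mul_add, Complex.exp_add]
  ring

theorem Ph_le_Ph_glue (a : Matrix ι ι ℝ) (e : α ⊕ β ≃ ι)
    (z : EuclideanSpace ℝ α × EuclideanSpace ℝ β) (i : α) :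
    Ph (a.submatrix (fun i => e (Sum.inl i)) fun i => e (Sum.inl i)) i z.1 ≤
      Ph a (e (Sum.inl i)) (glue e z) := by
  rw [Ph, Ph, ← Equiv.sum_comp e, Fintype.sum_sum_type]
  simp only [glue_inl, Matrix.submatrix_apply]
  exact le_add_of_nonneg_right (Finset.sum_nonneg fun _ _ => Real.rpow_nonneg (abs_nonneg _) _)

theorem prod_one_add_Ph_le (a : Matrix ι ι ℝ) (e : α ⊕ β ≃ ι)
    (z : EuclideanSpace ℝ α × EuclideanSpace ℝ β) (L : List α) :
    (L.map fun i => 1 + Ph (a.submatrix (fun i => e (Sum.inl i)) fun i => e (Sum.inl i)) i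
      z.1).prod ≤ ((L.map fun i => e (Sum.inl i)).map fun l => 1 + Ph a l (glue e z)).prod := by
  induction L with
  | nil => simp
  | cons i L ih =>
    simp only [List.map_cons, List.prod_cons]
    exact mul_le_mul (by linarith [Ph_le_Ph_glue a e z i]) ih
      (prod_map_one_add_Ph_pos _ L z.1).le (one_add_Ph_pos _ _ _).le

/-- The `L`-th partial derivative of the averaged multiplier `ξ ↦ ∫ m(ξ, η) h(η) dη`. -/
noncomputable def avg (e : α ⊕ β ≃ ι) (m : EuclideanSpace ℝ ι → ℂ) (h : EuclideanSpace ℝ β → ℂ)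
    (L : List α) (ξ : EuclideanSpace ℝ α) : ℂ :=
  ∫ η, pd (L.map fun i => e (Sum.inl i)) m (glue e (ξ, η)) * h η

theorem norm_pd_glue_le {a : Matrix ι ι ℝ} {C : List ι → ℝ} {m : EuclideanSpace ℝ ι → ℂ}
    (hm : SymbolBound a C (fun _ => 1) m) (e : α ⊕ β ≃ ι) (L : List α)
    (ξ : EuclideanSpace ℝ α) (η : EuclideanSpace ℝ β) :
    ‖pd (L.map fun i => e (Sum.inl i)) m (glue e (ξ, η))‖ ≤
      C (L.map fun i => e (Sum.inl i)) /
        (L.map fun i => 1 + Ph (a.submatrix (fun i => e (Sum.inl i)) fun i => e (Sum.inl i)) i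
          ξ).prod := by
  have h1 := hm (L.map fun i => e (Sum.inl i)) (glue e (ξ, η))
  have hp := prod_map_one_add_Ph_pos a (L.map fun i => e (Sum.inl i)) (glue e (ξ, η))
  have hC : 0 ≤ C (L.map fun i => e (Sum.inl i)) := by
    have h2 := (norm_nonneg _).trans h1
    rw [mul_one] at h2
    by_contra hneg
    exact absurd h2 (not_le.2 (div_neg_of_neg_of_pos (not_le.1 hneg) hp))
  rw [mul_one] at h1
  exact h1.trans (div_le_div_of_nonneg_left hC (prod_map_one_add_Ph_pos _ L ξ)
    (prod_one_add_Ph_le a e (ξ, η) L))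

theorem norm_pd_le_of_symbolBound {a : Matrix ι ι ℝ} {C : List ι → ℝ}
    {m : EuclideanSpace ℝ ι → ℂ} (hm : SymbolBound a C (fun _ => 1) m) (L : List ι)
    (ζ : EuclideanSpace ℝ ι) : ‖pd L m ζ‖ ≤ |C L| := by
  have h1 := hm L ζ
  have hp : 1 ≤ (L.map fun l => 1 + Ph a l ζ).prod := by
    induction L with
    | nil => simp
    | cons l L ih =>
      rw [List.map_cons, List.prod_cons]
      exact one_le_mul_of_one_le_of_one_le (by linarith [Ph_nonneg a l ζ]) (ih (hm L ζ))
  refine h1.trans ?_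
  rw [mul_one]
  exact (div_le_div_of_nonneg_right (le_abs_self _) (zero_le_one.trans hp)).trans
    (div_le_self (abs_nonneg _) hp)

theorem isJet_avg {a : Matrix ι ι ℝ} {C : List ι → ℝ} {m : EuclideanSpace ℝ ι → ℂ}
    (hmd : ContDiff ℝ ∞ m) (hm : SymbolBound a C (fun _ => 1) m) (e : α ⊕ β ≃ ι)
    {h : EuclideanSpace ℝ β → ℂ} (hh : Integrable h) : IsJet Set.univ (avg e m h) := by
  intro L ξ _
  have hc : ∀ (L : List α) (ξ : EuclideanSpace ℝ α), Continuous fun η : EuclideanSpace ℝ β =>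
      pd (L.map fun i => e (Sum.inl i)) m (glue e (ξ, η)) := fun L ξ =>
    (contDiff_pd hmd _).continuous.comp (by fun_prop)
  have hint : ∀ (L : List α) (ξ : EuclideanSpace ℝ α), Integrable fun η : EuclideanSpace ℝ β =>
      pd (L.map fun i => e (Sum.inl i)) m (glue e (ξ, η)) * h η := fun L ξ =>
    hh.bdd_mul (hc L ξ).aestronglyMeasurable
      (Eventually.of_forall fun η => norm_pd_le_of_symbolBound hm _ _)
  set F' : EuclideanSpace ℝ α → EuclideanSpace ℝ β → EuclideanSpace ℝ α →L[ℝ] ℂ := fun ξ η =>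
    ∑ i, (EuclideanSpace.proj i : EuclideanSpace ℝ α →L[ℝ] ℝ).smulRight
      (pd ((i :: L).map fun i => e (Sum.inl i)) m (glue e (ξ, η)) * h η) with hF'
  have hI : ∫ η, F' ξ η = ∑ i, (EuclideanSpace.proj i : EuclideanSpace ℝ α →L[ℝ] ℝ).smulRight
      (avg e m h (i :: L) ξ) := by
    have hl : ∀ i, Integrable fun η => (EuclideanSpace.proj i :
        EuclideanSpace ℝ α →L[ℝ] ℝ).smulRight
        (pd ((i :: L).map fun i => e (Sum.inl i)) m (glue e (ξ, η)) * h η) := fun i =>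
      (ContinuousLinearMap.smulRightL ℝ (EuclideanSpace ℝ α) ℂ
        (EuclideanSpace.proj i)).integrable_comp (hint (i :: L) ξ)
    rw [hF', integral_finsetSum _ fun i _ => hl i]
    refine Finset.sum_congr rfl fun i _ => ?_
    exact (ContinuousLinearMap.smulRightL ℝ (EuclideanSpace ℝ α) ℂ
        (EuclideanSpace.proj i)).integral_comp_comm (hint (i :: L) ξ)
  rw [← hI]
  refine hasFDerivAt_integral_of_dominated_of_fderiv_le (s := Set.univ) (F' := F')
    (bound := fun η => ∑ i, ‖(EuclideanSpace.proj i : EuclideanSpace ℝ α →L[ℝ] ℝ)‖ *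
      (|C ((i :: L).map fun i => e (Sum.inl i))| * ‖h η‖)) Filter.univ_mem
    (Eventually.of_forall fun y => (hint L y).aestronglyMeasurable) (hint L ξ) ?_ ?_ ?_ ?_
  · refine Finset.aestronglyMeasurable_fun_sum _ fun i _ => ?_
    exact (ContinuousLinearMap.smulRightL ℝ (EuclideanSpace ℝ α) ℂ
        (EuclideanSpace.proj i)).continuous.comp_aestronglyMeasurable
        (hint (i :: L) ξ).aestronglyMeasurable
  · refine Eventually.of_forall fun η y _ => (norm_sum_le _ _).trans
      (Finset.sum_le_sum fun i _ => ?_)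
    rw [ContinuousLinearMap.norm_smulRight_apply, norm_mul]
    gcongr
    exact norm_pd_le_of_symbolBound hm _ _
  · exact integrable_finsetSum _ fun i _ => (hh.norm.const_mul _).const_mul _
  · refine Eventually.of_forall fun η y _ => ?_
    have h1 : HasFDerivAt (fun y : EuclideanSpace ℝ α => glue e (y, η))
        ((glue e).comp (ContinuousLinearMap.inl ℝ _ _)) y := by
      have := (glue e).hasFDerivAt (x := (y, η))
      exact this.comp y (hasFDerivAt_prodMk_left y η)
    have h2 := (((differentiable_pd hmd (L.map fun i => e (Sum.inl i))
      (glue e (y, η))).hasFDerivAt).comp y h1).mul_const (h η)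
    refine h2.congr_fderiv ?_
    refine ContinuousLinearMap.ext fun v => ?_
    have h3 : glue e (v, 0) = ∑ i, v i • EuclideanSpace.basisFun ι ℝ (e (Sum.inl i)) := by
      classical
      refine glue_ext e (fun i => ?_) fun j => ?_
      · rw [glue_inl, WithLp.ofLp_sum, Finset.sum_apply]
        simp
      · rw [glue_inr, WithLp.ofLp_sum, Finset.sum_apply]
        simp
    change h η * (fderiv ℝ (pd (L.map fun i => e (Sum.inl i)) m) (glue e (y, η)))
      (glue e (v, 0)) = _
    rw [h3, map_sum, Finset.mul_sum]
    simp only [hF', sum_apply, ContinuousLinearMap.smulRight_apply]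
    refine Finset.sum_congr rfl fun i _ => ?_
    rw [map_smul, List.map_cons, pd_cons]
    change _ = v i • _
    simp only [Complex.real_smul]
    ring

theorem symbolBound_avg {a : Matrix ι ι ℝ} {C : List ι → ℝ} {m : EuclideanSpace ℝ ι → ℂ}
    (hmd : ContDiff ℝ ∞ m) (hm : SymbolBound a C (fun _ => 1) m) (e : α ⊕ β ≃ ι)
    {h : EuclideanSpace ℝ β → ℂ} (hh : Integrable h) {t : ℝ} (ht : ∫ η, ‖h η‖ ≤ t) :
    SymbolBound (a.submatrix (fun i => e (Sum.inl i)) fun i => e (Sum.inl i))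
      (fun L => |C (L.map fun i => e (Sum.inl i))|) (fun _ => t) (avg e m h []) := by
  intro L ξ
  rw [(isJet_avg hmd hm e hh).pd_eq]
  set Q := (L.map fun i => 1 + Ph (a.submatrix (fun i => e (Sum.inl i))
    fun i => e (Sum.inl i)) i ξ).prod with hQ
  have hQ0 : 0 < Q := prod_map_one_add_Ph_pos _ L ξ
  calc ‖avg e m h L ξ‖ ≤ ∫ η, |C (L.map fun i => e (Sum.inl i))| / Q * ‖h η‖ := by
        refine norm_integral_le_of_norm_le (hh.norm.const_mul _)
          (Eventually.of_forall fun η => ?_)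
        rw [norm_mul]
        gcongr
        refine (norm_pd_glue_le hm e L ξ η).trans ?_
        rw [← hQ]
        gcongr
        exact le_abs_self _
    _ = |C (L.map fun i => e (Sum.inl i))| / Q * ∫ η, ‖h η‖ := integral_const_mul _ _
    _ ≤ |C (L.map fun i => e (Sum.inl i))| / Q * t := by gcongr
    _ = _ := by ring

/-- Testing the Fourier transform of `m` on a tensor product amounts to testing the Fourier
transform of an averaged multiplier on the first factor. -/
theorem integral_mul_osc_tensor {a : Matrix ι ι ℝ} {C : List ι → ℝ} {m : EuclideanSpace ℝ ι → ℂ}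
    (hmd : ContDiff ℝ ∞ m) (hm : SymbolBound a C (fun _ => 1) m) (e : α ⊕ β ≃ ι)
    {φ : EuclideanSpace ℝ α → ℂ} {ψ : EuclideanSpace ℝ β → ℂ}
    {χ : EuclideanSpace ℝ ι → ℂ} (h : ∀ z, χ (glue e z) = φ z.1 * ψ z.2)
    (hφ : Integrable (osc φ)) (hψ : Integrable (osc ψ)) :
    ∫ ζ, m ζ * osc χ ζ = ∫ ξ, avg e m (osc ψ) [] ξ * osc φ ξ := by
  rw [← integral_comp_glue e]
  have hi : Integrable (fun z : EuclideanSpace ℝ α × EuclideanSpace ℝ β =>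
      m (glue e z) * (osc φ z.1 * osc ψ z.2)) (volume.prod volume) :=
    (hφ.mul_prod hψ).bdd_mul
      (hmd.continuous.comp (glue e).continuous).aestronglyMeasurable
      (Eventually.of_forall fun z => norm_pd_le_of_symbolBound hm [] _)
  calc ∫ z, m (glue e z) * osc χ (glue e z)
      = ∫ z : EuclideanSpace ℝ α × EuclideanSpace ℝ β,
          m (glue e z) * (osc φ z.1 * osc ψ z.2) ∂(volume.prod volume) :=
        integral_congr_ae (Eventually.of_forall fun z => by simp only [osc_tensor e h z])
    _ = ∫ ξ, ∫ η, m (glue e (ξ, η)) * (osc φ ξ * osc ψ η) := integral_prod _ hi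
    _ = _ := by
        refine integral_congr_ae (Eventually.of_forall fun ξ => ?_)
        simp only [avg]
        rw [← integral_mul_const]
        refine integral_congr_ae (Eventually.of_forall fun η => ?_)
        simp only [List.map_nil, pd_nil]
        ring

end Splitting

section TestFunctionBounds

variable {ι : Type*} [Fintype ι]

theorem osc_pd {f : EuclideanSpace ℝ ι → ℂ} (hf : ContDiff ℝ ∞ f) (hf' : HasCompactSupport f)
    (l : ι) (ξ : EuclideanSpace ℝ ι) :
    osc (pd [l] f) ξ = -(2 * π * Complex.I * ξ l * osc f ξ) := by
  have hi : ∀ {g : EuclideanSpace ℝ ι → ℂ}, Continuous g → HasCompactSupport g →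
      ∀ {e : EuclideanSpace ℝ ι → ℂ}, Continuous e → Integrable fun x => e x * g x :=
    fun hg hg' _ he => (he.mul hg).integrable_of_hasCompactSupport hg'.mul_left
  have he : Continuous fun x : EuclideanSpace ℝ ι =>
      Complex.exp (2 * π * Complex.I * (inner ℝ x ξ : ℝ)) := by fun_prop
  have h := integral_bilinear_hasLineDerivAt_right_eq_neg_left_of_integrable
    (μ := (volume : Measure (EuclideanSpace ℝ ι))) (B := ContinuousLinearMap.mul ℝ ℂ)
    (v := EuclideanSpace.basisFun ι ℝ l) (g := f) (g' := pd [l] f)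
    (f := fun x => Complex.exp (2 * π * Complex.I * (inner ℝ x ξ : ℝ)))
    (f' := fun x => 2 * π * Complex.I * ξ l *
      Complex.exp (2 * π * Complex.I * (inner ℝ x ξ : ℝ)))
    (hi hf.continuous hf' (continuous_const.mul he))
    (hi (contDiff_pd hf _).continuous (hasCompactSupport_pd hf' _) he)
    (hi hf.continuous hf' he) (fun x _ => hasLineDerivAt_exp_inner ξ x l)
    (fun x _ => ((differentiable_pd hf [] x).hasFDerivAt).hasLineDerivAt _)
  simp only [ContinuousLinearMap.mul_apply'] at h
  rw [osc, h, osc, ← integral_const_mul]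
  congr 1
  exact integral_congr_ae (Eventually.of_forall fun x => by ring)

theorem continuous_osc {f : EuclideanSpace ℝ ι → ℂ} (hf : Continuous f)
    (hf' : HasCompactSupport f) : Continuous (osc f) :=
  continuous_iff_continuousAt.2 fun x => (hasFDerivAt_osc hf hf' x).continuousAt

theorem tsupport_pd_subset {f : EuclideanSpace ℝ ι → ℂ} (L : List ι) :
    tsupport (pd L f) ⊆ tsupport f :=
  closure_minimal (fun x hx => by
    by_contra h
    exact hx (pd_eq_zero_of_notMem_tsupport h L)) (isClosed_tsupport f)

/-- Decay of the Fourier transform of a test function, from applying `1 - ∂_l²` for every `l`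
in the list `s`. -/
theorem norm_osc_mul_prod_le {K : Set (EuclideanSpace ℝ ι)} (hK : IsCompact K) (s : List ι) :
    ∀ {f : EuclideanSpace ℝ ι → ℂ}, ContDiff ℝ ∞ f → tsupport f ⊆ K → ∀ {b : ℝ},
      (∀ L : List ι, L.length ≤ 2 * s.length → ∀ x, ‖pd L f x‖ ≤ b) → ∀ ξ,
      ‖osc f ξ‖ * (s.map fun l => 1 + (2 * π * ξ l) ^ 2).prod ≤
        2 ^ s.length * b * volume.real K := by
  induction s with
  | nil =>
    intro f hf hfK b hb ξ
    have h0 : ∀ x ∉ K,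
        Complex.exp (2 * π * Complex.I * (inner ℝ x ξ : ℝ)) * f x = 0 := fun x hx => by
      rw [image_eq_zero_of_notMem_tsupport fun h => hx (hfK h), mul_zero]
    simp only [List.map_nil, List.prod_nil, mul_one, List.length_nil, pow_zero, one_mul]
    rw [osc, ← setIntegral_eq_integral_of_forall_compl_eq_zero h0]
    refine norm_setIntegral_le_of_norm_le_const hK.measure_lt_top fun x _ => ?_
    rw [norm_mul, norm_exp_inner, one_mul]
    exact hb [] (by simp) x
  | cons l s ih =>
    intro f hf hfK b hb ξ
    have hcs : HasCompactSupport f := hK.of_isClosed_subset (isClosed_tsupport f) hfK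
    set g : EuclideanSpace ℝ ι → ℂ := fun x => f x - pd [l, l] f x with hg
    have hgd : ContDiff ℝ ∞ g := hf.sub (contDiff_pd hf _)
    have hgK : tsupport g ⊆ K :=
      (tsupport_sub _ _).trans (Set.union_subset hfK ((tsupport_pd_subset _).trans hfK))
    have hgb : ∀ L : List ι, L.length ≤ 2 * s.length → ∀ x, ‖pd L g x‖ ≤ 2 * b := by
      intro L hL x
      rw [hg, pd_sub hf (contDiff_pd hf _), ← pd_append]
      have h1 := hb L (by simp; omega) x
      have h2 := hb (L ++ [l, l]) (by simp; omega) x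
      exact (norm_sub_le _ _).trans (by linarith)
    have hosc : osc g ξ = ((1 + (2 * π * ξ l) ^ 2 : ℝ) : ℂ) * osc f ξ := by
      have h1 : pd [l, l] f = pd [l] (pd [l] f) := pd_append [l] [l] f
      rw [hg, osc_sub (hf.continuous.integrable_of_hasCompactSupport hcs)
        ((contDiff_pd hf _).continuous.integrable_of_hasCompactSupport
          (hasCompactSupport_pd hcs _)), h1, osc_pd (contDiff_pd hf _)
        (hasCompactSupport_pd hcs _), osc_pd hf hcs]
      push_cast
      linear_combination (4 * π ^ 2 * ξ l ^ 2 * osc f ξ) * (-Complex.I_sq)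
    have h := ih hgd hgK hgb ξ
    rw [hosc, norm_mul, Complex.norm_real, Real.norm_of_nonneg (by positivity)] at h
    calc _ = (1 + (2 * π * ξ l) ^ 2) * ‖osc f ξ‖ *
          (s.map fun l => 1 + (2 * π * ξ l) ^ 2).prod := by
            rw [List.map_cons, List.prod_cons]; ring
      _ ≤ _ := h
      _ = _ := by rw [List.length_cons, pow_succ]; ring

/-- The `L¹` norm of the Fourier transform of a test function is bounded by the sup norms of
finitely many derivatives. -/
theorem integral_norm_osc_le {K : Set (EuclideanSpace ℝ ι)} (hK : IsCompact K)
    {f : EuclideanSpace ℝ ι → ℂ} (hf : ContDiff ℝ ∞ f) (hfK : tsupport f ⊆ K) {b : ℝ}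
    (hb : ∀ L : List ι, L.length ≤ 2 * Fintype.card ι → ∀ x, ‖pd L f x‖ ≤ b) :
    Integrable (osc f) ∧ ∫ ξ, ‖osc f ξ‖ ≤
      (2 ^ Fintype.card ι * volume.real K * ∏ _j : ι, (π * (2 * π)⁻¹)) * b := by
  obtain ⟨h1, h2⟩ := integral_prod_inv_one_add_sq (ι := ι) (c := fun _ => 2 * π)
    fun _ => by positivity
  have hcs : HasCompactSupport f := hK.of_isClosed_subset (isClosed_tsupport f) hfK
  have hle : ∀ ξ, ‖osc f ξ‖ ≤ 2 ^ Fintype.card ι * b * volume.real K *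
      ∏ j, (1 + (2 * π * ξ j) ^ 2)⁻¹ := by
    intro ξ
    have h := norm_osc_mul_prod_le hK Finset.univ.toList hf hfK (b := b) (by simpa using hb) ξ
    rw [Finset.prod_map_toList, Finset.length_toList, Finset.card_univ] at h
    rw [Finset.prod_inv_distrib, ← div_eq_mul_inv]
    exact (le_div_iff₀ (Finset.prod_pos fun _ _ => by positivity)).2 h
  have hint : Integrable (osc f) := (h1.const_mul _).mono'
    (continuous_osc hf.continuous hcs).aestronglyMeasurable (Eventually.of_forall hle)
  refine ⟨hint, (integral_mono hint.norm (h1.const_mul _) hle).trans ?_⟩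
  rw [integral_const_mul, h2]
  exact le_of_eq (by ring)

theorem integrable_osc {f : EuclideanSpace ℝ ι → ℂ} (hf : ContDiff ℝ ∞ f)
    (hf' : HasCompactSupport f) : Integrable (osc f) := by
  classical
  have hbd : ∀ L : List ι, ∃ b : ℝ, ∀ x, ‖pd L f x‖ ≤ b := fun L =>
    (contDiff_pd hf L).continuous.bounded_above_of_compact_support (hasCompactSupport_pd hf' L)
  choose b hb using hbd
  obtain ⟨B, hB⟩ : ∃ B, ∀ L : List ι, L.length ≤ 2 * Fintype.card ι → b L ≤ B := by
    obtain ⟨B, hB⟩ := ((List.finite_length_le ι (2 * Fintype.card ι)).image b).bddAbove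
    exact ⟨B, fun L hL => hB ⟨L, hL, rfl⟩⟩
  exact (integral_norm_osc_le hf'.isCompact hf le_rfl fun L hL x =>
    (hb L x).trans (hB L hL)).1

theorem osc_comp_diag {c : ι → ℝ} (hc : ∀ l, 0 < c l) {r : ℝ}
    (hr : ∀ f : EuclideanSpace ℝ ι → ℂ, ∫ x, f (diag c x) = r • ∫ x, f x)
    (f : EuclideanSpace ℝ ι → ℂ) (ξ : EuclideanSpace ℝ ι) :
    osc (fun x => f (diag c x)) ξ = r • osc f (diag c⁻¹ ξ) := by
  rw [osc, osc, ← hr]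
  refine integral_congr_ae (Eventually.of_forall fun x => ?_)
  have h : (inner ℝ (diag c x) (diag c⁻¹ ξ) : ℝ) = inner ℝ x ξ := by
    simp only [PiLp.inner_apply, diag_apply]
    refine Finset.sum_congr rfl fun l _ => ?_
    simp only [RCLike.inner_apply, conj_trivial, Pi.inv_apply]
    have := (hc l).ne'
    field_simp
  simp only [h]

/-- The `L¹` norm of the Fourier transform is invariant under dilations of the function. -/
theorem integral_norm_osc_comp_diag {c : ι → ℝ} (hc : ∀ l, 0 < c l)
    (f : EuclideanSpace ℝ ι → ℂ) :
    ∫ ξ, ‖osc (fun x => f (diag c x)) ξ‖ = ∫ ξ, ‖osc f ξ‖ := by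
  obtain ⟨r, hr, h1, h2⟩ := exists_integral_comp_diag hc
  simp only [osc_comp_diag hc h1, norm_smul, Real.norm_of_nonneg hr.le]
  rw [integral_const_mul, h2 fun ξ => ‖osc f ξ‖, smul_eq_mul, mul_inv_cancel_left₀ hr.ne']

theorem pd_ofReal {f : EuclideanSpace ℝ ι → ℝ} (hf : ContDiff ℝ ∞ f) (L : List ι) :
    pd L (fun x => (f x : ℂ)) = fun x => ((pd L f x : ℝ) : ℂ) := by
  induction L with
  | nil => rfl
  | cons l L ih =>
    funext x
    have h : HasFDerivAt (fun x => ((pd L f x : ℝ) : ℂ))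
        (Complex.ofRealCLM.comp (fderiv ℝ (pd L f) x)) x :=
      Complex.ofRealCLM.hasFDerivAt.comp x (differentiable_pd hf L x).hasFDerivAt
    rw [pd_cons, ih, h.fderiv]
    rfl

theorem bddAbove_testNorm (p : ℕ) (ψ : 𝓓((⊤ : Opens (EuclideanSpace ℝ ι)), ℝ)) :
    BddAbove {r : ℝ | ∃ γ : ι → ℕ, ∑ l, γ l ≤ p ∧ ∃ x, r = |multiDeriv γ ψ x|} := by
  classical
  have h1 : {r : ℝ | ∃ γ : ι → ℕ, ∑ l, γ l ≤ p ∧ ∃ x, r = |multiDeriv γ ψ x|} ⊆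
      ⋃ γ ∈ Set.Iic fun _ : ι => p, Set.range fun x => |multiDeriv γ ψ x| := by
    rintro r ⟨γ, hγ, x, rfl⟩
    refine Set.mem_biUnion (x := γ) (fun l => ?_) ⟨x, rfl⟩
    exact (Finset.single_le_sum (fun i _ => Nat.zero_le (γ i)) (Finset.mem_univ l)).trans hγ
  refine BddAbove.mono h1 (((Set.finite_Iic _).bddAbove_biUnion).2 fun γ _ => ?_)
  obtain ⟨b, hb⟩ :=
    (contDiff_pd ψ.contDiff (directions γ)).continuous.bounded_above_of_compact_support
      (hasCompactSupport_pd ψ.hasCompactSupport _)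
  refine ⟨b, ?_⟩
  rintro _ ⟨x, rfl⟩
  simp only [multiDeriv_eq_pd ψ.contDiff]
  exact hb x

theorem abs_pd_le_testNorm {p : ℕ} (ψ : 𝓓((⊤ : Opens (EuclideanSpace ℝ ι)), ℝ)) {L : List ι}
    (hL : L.length ≤ p) (x : EuclideanSpace ℝ ι) : |pd L ψ x| ≤ testNorm p ψ := by
  classical
  refine le_csSup (bddAbove_testNorm p ψ) ⟨fun l => L.count l, ?_, x, ?_⟩
  · have h := Multiset.sum_count_eq_card (s := Finset.univ) (m := (L : Multiset ι)) (by simp)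
    simp only [Multiset.coe_count, Multiset.coe_card] at h
    exact h.trans_le hL
  · rw [pd_eq_multiDeriv ψ.contDiff]

theorem testNorm_nonneg (p : ℕ) (ψ : 𝓓((⊤ : Opens (EuclideanSpace ℝ ι)), ℝ)) :
    0 ≤ testNorm p ψ :=
  (abs_nonneg _).trans (abs_pd_le_testNorm ψ (L := []) (Nat.zero_le p) 0)

/-- The Fourier transforms of the dilates of a test function are bounded in `L¹`, uniformly in
the dilation. -/
theorem exists_integral_norm_osc_dilate_le {K : Set (EuclideanSpace ℝ ι)} (hK : IsCompact K) :
    ∃ (C : ℝ) (p : ℕ), 0 ≤ C ∧ ∀ ψ : 𝓓((⊤ : Opens (EuclideanSpace ℝ ι)), ℝ), tsupport ψ ⊆ K →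
      ∀ c : ι → ℝ, (∀ l, 0 < c l) →
        ∫ ξ, ‖osc (fun x => (ψ (diag c x) : ℂ)) ξ‖ ≤ C * testNorm p ψ := by
  refine ⟨2 ^ Fintype.card ι * volume.real K * ∏ _j : ι, (π * (2 * π)⁻¹), 2 * Fintype.card ι,
    by positivity, fun ψ hψ c hc => ?_⟩
  rw [integral_norm_osc_comp_diag hc fun x => (ψ x : ℂ)]
  refine (integral_norm_osc_le hK (Complex.ofRealCLM.contDiff.comp ψ.contDiff) ?_
    fun L hL x => ?_).2
  · exact (tsupport_comp_subset Complex.ofReal_zero _).trans hψ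
  · change ‖pd L (fun x => ((ψ x : ℝ) : ℂ)) x‖ ≤ _
    rw [pd_ofReal ψ.contDiff, Complex.norm_real]
    exact abs_pd_le_testNorm ψ hL x

end TestFunctionBounds

/-! ### From blocks to coordinates -/

section CoordMatrix

variable {α κ : Type*}

/-- The matrix on the coordinates induced by the matrix `E` on the blocks: with it, `P_l` is
comparable to `N_j^{d_l}`, where `j` is the block of `l`. -/
noncomputable def coordMatrix (b : α → κ) (d : α → ℝ) (E : Matrix κ κ ℝ) : Matrix α α ℝ :=
  fun l l' => E (b l) (b l') * d l / d l'

theorem basicHypothesis_coordMatrix {b : α → κ} {d : α → ℝ} {E : Matrix κ κ ℝ}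
    (hE : BasicHypothesis E) (hd : ∀ l, 0 < d l) :
    BasicHypothesis (coordMatrix b d E) where
  pos l l' := div_pos (mul_pos (hE.pos _ _) (hd l)) (hd l')
  diag l := by rw [coordMatrix, hE.diag, one_mul, div_self (hd l).ne']
  submul l l' l'' := by
    have h1 : E (b l) (b l') * d l / d l' * (E (b l') (b l'') * d l' / d l'') =
        (E (b l) (b l') * E (b l') (b l'')) * d l / d l'' := by
      have := (hd l').ne'
      field_simp
    rw [coordMatrix, coordMatrix, coordMatrix, h1]
    have h2 := hE.submul (b l) (b l') (b l'')
    have h3 := (hd l).le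
    have h4 := (hd l'').le
    gcongr

end CoordMatrix

section Blocks

variable {α κ : Type*} [Fintype α] [DecidableEq κ]

/-- The functions `ν_j` of `x ∈ ℝ^α` are comparable to `∑ |x_l|^{1/d_l}`, summed over the block
of coordinates `l` with `b l = j`. -/
def IsBlockNorm (b : α → κ) (d : α → ℝ) (ν : κ → EuclideanSpace ℝ α → ℝ) : Prop :=
  ∀ j, ∃ A : ℝ, 0 < A ∧ ∀ x,
    (∑ l with b l = j, |x l| ^ (1 / d l)) ≤ A * ν j x ∧
      ν j x ≤ A * ∑ l with b l = j, |x l| ^ (1 / d l)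

variable {b : α → κ} {d : α → ℝ} {ν : κ → EuclideanSpace ℝ α → ℝ} {E : Matrix κ κ ℝ}

theorem IsBlockNorm.nonneg (h : IsBlockNorm b d ν) (j : κ) (x : EuclideanSpace ℝ α) :
    0 ≤ ν j x := by
  obtain ⟨A, hA, hx⟩ := h j
  have h0 : 0 ≤ ∑ l with b l = j, |x l| ^ (1 / d l) :=
    Finset.sum_nonneg fun _ _ => Real.rpow_nonneg (abs_nonneg _) _
  exact nonneg_of_mul_nonneg_right (h0.trans (hx x).1) hA

theorem IsBlockNorm.rpow_le (h : IsBlockNorm b d ν) :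
    ∃ A : κ → ℝ, (∀ j, 0 < A j) ∧ ∀ l x, |x l| ^ (1 / d l) ≤ A (b l) * ν (b l) x := by
  choose A hA hx using h
  refine ⟨A, hA, fun l x => le_trans ?_ (hx (b l) x).1⟩
  exact Finset.single_le_sum (f := fun l => |x l| ^ (1 / d l))
    (fun _ _ => Real.rpow_nonneg (abs_nonneg _) _) (Finset.mem_filter.2 ⟨Finset.mem_univ l, rfl⟩)

theorem IsBlockNorm.exists_pos (h : IsBlockNorm b d ν) {x : EuclideanSpace ℝ α} (hx : x ≠ 0) :
    ∃ k, 0 < ν k x := by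
  obtain ⟨l, hl⟩ : ∃ l, x l ≠ 0 := by
    by_contra! hall
    exact hx (by ext l; exact hall l)
  obtain ⟨A, hA, hA'⟩ := h.rpow_le
  exact ⟨b l, pos_of_mul_pos_right
    ((Real.rpow_pos_of_pos (abs_pos.2 hl) _).trans_le (hA' l x)) (hA _).le⟩

variable [Fintype κ]

/-- The weight `1 + P̂_l` is controlled by `(1 + N̂_j)^{d_l}`, where `j` is the block of `l`. -/
theorem exists_one_add_Ph_le (hd : ∀ l, 0 < d l) (hE : BasicHypothesis E)
    (h : IsBlockNorm b d ν) (l : α) :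
    ∃ B : ℝ, 0 ≤ B ∧ ∀ ξ, 1 + Ph (coordMatrix b d E) l ξ ≤
      B * (1 + ∑ k, ν k ξ ^ (1 / E k (b l))) ^ d l := by
  obtain ⟨A, hA, hA'⟩ := h.rpow_le
  refine ⟨1 + ∑ k, A (b k) ^ (d l / E (b k) (b l)), ?_, fun ξ => ?_⟩
  · exact add_nonneg zero_le_one (Finset.sum_nonneg fun k _ => Real.rpow_nonneg (hA _).le _)
  set S := 1 + ∑ k, ν k ξ ^ (1 / E k (b l)) with hS
  have hν : ∀ k, ν k ξ ^ (1 / E k (b l)) ≤ S := fun k => by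
    have := Finset.single_le_sum (f := fun k => ν k ξ ^ (1 / E k (b l)))
      (fun k _ => Real.rpow_nonneg (h.nonneg k ξ) _) (Finset.mem_univ k)
    rw [hS]; linarith
  have hS1 : 1 ≤ S := by
    rw [hS]
    exact le_add_of_nonneg_right (Finset.sum_nonneg fun k _ => Real.rpow_nonneg (h.nonneg k ξ) _)
  rw [add_mul, one_mul, Ph, Finset.sum_mul]
  refine add_le_add (Real.one_le_rpow hS1 (hd l).le) (Finset.sum_le_sum fun k _ => ?_)
  have hE' := hE.pos (b k) (b l)
  have e1 : 1 / coordMatrix b d E k l = 1 / d k * (d l / E (b k) (b l)) := by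
    rw [coordMatrix]
    have h1 := (hd k).ne'
    have h2 := (hd l).ne'
    field_simp
  have e2 : d l / E (b k) (b l) = 1 / E (b k) (b l) * d l := by ring
  have h0 : 0 ≤ d l / E (b k) (b l) := (div_pos (hd l) hE').le
  calc |ξ k| ^ (1 / coordMatrix b d E k l)
      = (|ξ k| ^ (1 / d k)) ^ (d l / E (b k) (b l)) := by
        rw [e1, Real.rpow_mul (abs_nonneg _)]
    _ ≤ (A (b k) * ν (b k) ξ) ^ (d l / E (b k) (b l)) :=
        Real.rpow_le_rpow (Real.rpow_nonneg (abs_nonneg _) _) (hA' k ξ) h0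
    _ = A (b k) ^ (d l / E (b k) (b l)) * (ν (b k) ξ ^ (1 / E (b k) (b l))) ^ d l := by
        rw [Real.mul_rpow (hA _).le (h.nonneg _ _), ← Real.rpow_mul (h.nonneg _ _), ← e2]
    _ ≤ _ := mul_le_mul_of_nonneg_left (Real.rpow_le_rpow
        (Real.rpow_nonneg (h.nonneg _ _) _) (hν _) (hd l).le) (Real.rpow_nonneg (hA _).le _)

/-- The power `N_j^{d_l}` is controlled by `P_l`, where `j` is the block of `l`. -/
theorem exists_rpow_le_P (hd : ∀ l, 0 < d l) (hE : BasicHypothesis E)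
    (h : IsBlockNorm b d ν) (l : α) :
    ∃ B : ℝ, 0 ≤ B ∧ ∀ x, (∑ k, ν k x ^ E (b l) k) ^ d l ≤ B * P (coordMatrix b d E) l x := by
  choose A hA hx using h
  have h : IsBlockNorm b d ν := fun j => ⟨A j, hA j, hx j⟩
  set B₀ : ℝ := ∑ k, (A k * Fintype.card α) ^ E (b l) k with hB₀
  have hB₀0 : 0 ≤ B₀ := Finset.sum_nonneg fun k _ => by have := hA k; positivity
  refine ⟨B₀ ^ d l, Real.rpow_nonneg hB₀0 _, fun x => ?_⟩
  set p := P (coordMatrix b d E) l x with hp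
  have hp0 : 0 ≤ p := P_nonneg _ _ _
  have hk : ∀ k, ν k x ^ E (b l) k ≤ (A k * Fintype.card α) ^ E (b l) k * p ^ (1 / d l) := by
    intro k
    have hE' := hE.pos (b l) k
    have h1 : ∀ l' ∈ Finset.univ.filter (fun l' => b l' = k),
        |x l'| ^ (1 / d l') ≤ p ^ (1 / (E (b l) k * d l)) := by
      intro l' hl'
      have hb : b l' = k := (Finset.mem_filter.1 hl').2
      have e : 1 / d l' = coordMatrix b d E l l' * (1 / (E (b l) k * d l)) := by
        rw [coordMatrix, hb]
        have h1 := (hd l).ne'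
        have h2 := (hd l').ne'
        have h3 := hE'.ne'
        field_simp
      rw [e, Real.rpow_mul (abs_nonneg _)]
      exact Real.rpow_le_rpow (Real.rpow_nonneg (abs_nonneg _) _) (rpow_le_P _ l l' x)
        (one_div_pos.2 (mul_pos hE' (hd l))).le
    have h2 : ν k x ≤ A k * Fintype.card α * p ^ (1 / (E (b l) k * d l)) := by
      refine (hx k x).2.trans ?_
      rw [mul_assoc]
      refine mul_le_mul_of_nonneg_left ((Finset.sum_le_card_nsmul _ _ _ h1).trans ?_) (hA k).le
      rw [nsmul_eq_mul]
      refine mul_le_mul_of_nonneg_right ?_ (Real.rpow_nonneg hp0 _)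
      exact_mod_cast Finset.card_le_univ _
    have hc : 0 ≤ A k * Fintype.card α := mul_nonneg (hA k).le (Nat.cast_nonneg _)
    refine (Real.rpow_le_rpow (h.nonneg k x) h2 hE'.le).trans (le_of_eq ?_)
    rw [Real.mul_rpow hc (Real.rpow_nonneg hp0 _), ← Real.rpow_mul hp0]
    congr 2
    have h1 := (hd l).ne'
    have h3 := hE'.ne'
    field_simp
  have hsum : ∑ k, ν k x ^ E (b l) k ≤ B₀ * p ^ (1 / d l) := by
    rw [hB₀, Finset.sum_mul]
    exact Finset.sum_le_sum fun k _ => hk k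
  refine (Real.rpow_le_rpow (Finset.sum_nonneg fun k _ => Real.rpow_nonneg (h.nonneg k x) _)
    hsum (hd l).le).trans (le_of_eq ?_)
  rw [Real.mul_rpow hB₀0 (Real.rpow_nonneg hp0 _), ← Real.rpow_mul hp0,
    one_div_mul_cancel (hd l).ne', Real.rpow_one]

theorem prod_rpow_neg_eq {y : κ → ℝ} (hy : ∀ j, 0 < y j) (γ : α → ℕ) :
    ∏ j, y j ^ (-∑ l with b l = j, γ l * d l) = ∏ l, ((y (b l) ^ d l)⁻¹) ^ γ l := by
  rw [← Finset.prod_fiberwise (s := Finset.univ) (g := b)]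
  refine Finset.prod_congr rfl fun j _ => ?_
  rw [Real.rpow_neg (hy j).le, Real.rpow_sum_of_pos (hy j), ← Finset.prod_inv_distrib]
  refine Finset.prod_congr rfl fun l hl => ?_
  rw [(Finset.mem_filter.1 hl).2, mul_comm, Real.rpow_mul (hy j).le, Real.rpow_natCast, inv_pow]

/-- The decay in terms of the coordinate norms `P_l` is bounded by that in terms of the norms
`N_j` attached to the blocks. -/
theorem exists_decay_le (hd : ∀ l, 0 < d l) (hE : BasicHypothesis E) (h : IsBlockNorm b d ν)
    (γ : α → ℕ) :
    ∃ B : ℝ, 0 ≤ B ∧ ∀ (M : ℕ) (x : EuclideanSpace ℝ α), x ≠ 0 →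
      decay (coordMatrix b d E) (directions γ) M x ≤
        B * (∏ j, (∑ k, ν k x ^ E j k) ^
          (-((∑ l with b l = j, d l) + ∑ l with b l = j, γ l * d l))) *
          (1 + ‖x‖) ^ (-(M : ℝ)) := by
  choose B hB0 hB using fun l => exists_rpow_le_P hd hE h l
  refine ⟨∏ l, B l ^ (1 + γ l), Finset.prod_nonneg fun l _ => pow_nonneg (hB0 l) _,
    fun M x hx => ?_⟩
  have hN : ∀ j, 0 < ∑ k, ν k x ^ E j k := fun j => by
    obtain ⟨k, hk⟩ := h.exists_pos hx
    exact Finset.sum_pos' (fun k _ => Real.rpow_nonneg (h.nonneg k x) _)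
      ⟨k, Finset.mem_univ _, Real.rpow_pos_of_pos hk _⟩
  have e1 : ∀ j, -((∑ l with b l = j, d l) + ∑ l with b l = j, γ l * d l) =
      -∑ l with b l = j, ((1 + γ l : ℕ) : ℝ) * d l := fun j => by
    rw [← Finset.sum_add_distrib]
    congr 1
    exact Finset.sum_congr rfl fun l _ => by push_cast; ring
  have e2 : (1 + ‖x‖) ^ (-(M : ℝ)) = ((1 + ‖x‖) ^ M)⁻¹ := by
    rw [Real.rpow_neg (by positivity), Real.rpow_natCast]
  simp only [e1]
  rw [prod_rpow_neg_eq hN, e2, decay, prod_map_directions, ← Finset.prod_mul_distrib,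
    ← Finset.prod_mul_distrib]
  refine mul_le_mul_of_nonneg_right (Finset.prod_le_prod (fun l _ => ?_) fun l _ => ?_)
    (by positivity)
  · exact mul_nonneg (inv_nonneg.2 (P_nonneg _ _ _)) (pow_nonneg (inv_nonneg.2 (P_nonneg _ _ _)) _)
  · rw [← pow_succ', ← mul_pow, add_comm]
    refine pow_le_pow_left₀ (inv_nonneg.2 (P_nonneg _ _ _)) ?_ _
    have hy := Real.rpow_pos_of_pos (hN (b l)) (d l)
    have hp := P_pos (coordMatrix b d E) l hx
    rw [← div_eq_mul_inv, le_div_iff₀ hy, inv_mul_le_iff₀ hp, mul_comm]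
    exact hB l x

/-- The estimates that define the class of multipliers, in coordinates. -/
theorem exists_symbolBound (hd : ∀ l, 0 < d l) (hE : BasicHypothesis E) (h : IsBlockNorm b d ν)
    {m : EuclideanSpace ℝ α → ℂ} (hm : ContDiff ℝ ∞ m)
    (hb : ∀ γ : α → ℕ, ∃ C : ℝ, ∀ ξ, ‖multiDeriv γ m ξ‖ ≤
      C * ∏ j, (1 + ∑ k, ν k ξ ^ (1 / E k j)) ^ (-∑ l with b l = j, γ l * d l)) :
    ∃ C, SymbolBound (coordMatrix b d E) C (fun _ => 1) m := by
  classical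
  choose B hB0 hB using fun l => exists_one_add_Ph_le hd hE h l
  choose C hC using hb
  refine ⟨fun L => |C fun l => L.count l| * ∏ l, B l ^ L.count l, fun L ξ => ?_⟩
  have hN : ∀ j, 0 < 1 + ∑ k, ν k ξ ^ (1 / E k j) := fun j =>
    add_pos_of_pos_of_nonneg one_pos
      (Finset.sum_nonneg fun k _ => Real.rpow_nonneg (h.nonneg k ξ) _)
  have e : (L.map fun l => 1 + Ph (coordMatrix b d E) l ξ).prod =
      ∏ l, (1 + Ph (coordMatrix b d E) l ξ) ^ L.count l := by
    rw [← prod_map_directions]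
    exact ((directions_count_perm L).map _).prod_eq.symm
  have h1 := hC (fun l => L.count l) ξ
  rw [prod_rpow_neg_eq hN] at h1
  rw [pd_eq_multiDeriv hm, e, mul_one, mul_div_assoc, ← Finset.prod_div_distrib]
  refine h1.trans (mul_le_mul (le_abs_self _) (Finset.prod_le_prod (fun l _ => ?_)
    fun l _ => ?_) (Finset.prod_nonneg fun l _ => ?_) (abs_nonneg _))
  · exact pow_nonneg (inv_nonneg.2 (Real.rpow_nonneg (hN _).le _)) _
  · rw [← div_pow]
    refine pow_le_pow_left₀ (inv_nonneg.2 (Real.rpow_nonneg (hN _).le _)) ?_ _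
    rw [le_div_iff₀ (one_add_Ph_pos _ _ _), inv_mul_le_iff₀ (Real.rpow_pos_of_pos (hN _) _),
      mul_comm]
    exact hB l ξ
  · exact pow_nonneg (inv_nonneg.2 (Real.rpow_nonneg (hN _).le _)) _

end Blocks

/-! ### The Fourier transform as a tempered distribution -/

section Tempered

variable {ι : Type*} [Fintype ι]

/-- A bounded continuous function has a Fourier transform, as a tempered distribution. -/
theorem exists_isFourierTransformOf {m : EuclideanSpace ℝ ι → ℂ} (hm : Continuous m) {B : ℝ}
    (hB : ∀ ξ, ‖m ξ‖ ≤ B) : ∃ T : 𝓢'(EuclideanSpace ℝ ι, ℂ), IsFourierTransformOf T m := by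
  have hmem : MemLp m ⊤ (volume : Measure (EuclideanSpace ℝ ι)) :=
    memLp_top_of_bound hm.aestronglyMeasurable B (Eventually.of_forall hB)
  refine ⟨FourierTransformInv.fourierInv (Lp.toTemperedDistribution (hmem.toLp m)), fun φ => ?_⟩
  rw [TemperedDistribution.fourierInv_apply, Lp.toTemperedDistribution_apply]
  refine integral_congr_ae ?_
  filter_upwards [hmem.coeFn_toLp] with ξ hξ
  rw [hξ, smul_eq_mul, mul_comm, SchwartzMap.fourierInv_coe, Real.fourierInv_eq']
  congr 1
  refine integral_congr_ae (Eventually.of_forall fun x => ?_)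
  simp only [smul_eq_mul]
  congr 2
  push_cast
  ring

end Tempered

/-! ### Block decompositions -/

section BlockSpaces

variable {ι κ : Type*} [Fintype ι] [DecidableEq κ] (S : BlockSpace ι κ)

theorem isBlockNorm_comp : IsBlockNorm S.block S.d fun j x => S.n j (S.comp j x) := by
  intro j
  obtain ⟨A, hA, h⟩ := S.n_equiv j
  refine ⟨A, hA, fun x => ?_⟩
  have e : ∑ l with S.block l = j, |x l| ^ (1 / S.d l) =
      ∑ l : {l // S.block l = j}, |S.comp j x l| ^ (1 / S.d l) :=
    Finset.sum_subtype _ (by simp) _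
  rw [e]
  exact h _

/-- The block of a coordinate of `ℝ^L`, as an element of `L`. -/
def subBlock (L : Finset κ) (l : {l // S.block l ∈ L}) : {k // k ∈ L} := ⟨S.block l, l.2⟩

theorem isBlockNorm_subComp (L : Finset κ) :
    IsBlockNorm (subBlock S L) (fun l => S.d l)
      fun j x => S.n j (S.subComp L j x) := by
  intro j
  obtain ⟨A, hA, h⟩ := S.n_equiv j
  refine ⟨A, hA, fun x => ?_⟩
  have e : ∑ l with subBlock S L l = j,
      |x l| ^ (1 / S.d l) =
      ∑ l : {l // S.block l = j}, |S.subComp L j x l| ^ (1 / S.d l) := by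
    refine Finset.sum_bij' (fun l hl => ⟨l.1, congrArg Subtype.val (Finset.mem_filter.1 hl).2⟩)
      (fun l _ => ⟨l.1, l.2.symm ▸ j.2⟩) ?_ ?_ ?_ ?_ ?_
    · exact fun _ _ => Finset.mem_univ _
    · exact fun l _ => Finset.mem_filter.2 ⟨Finset.mem_univ _, Subtype.ext l.2⟩
    · exact fun _ _ => rfl
    · exact fun _ _ => rfl
    · exact fun _ _ => rfl
  rw [e]
  exact h _

theorem sum_subBlock_eq {L : Finset κ} (j : {k // k ∈ L}) (f : ι → ℝ) :
    ∑ l with subBlock S L l = j, f l =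
      ∑ l with S.block l = j, f l := by
  refine Finset.sum_bij' (fun l _ => l.1)
    (fun l hl => ⟨l, (Finset.mem_filter.1 hl).2.symm ▸ j.2⟩) ?_ ?_ ?_ ?_ ?_
  · exact fun l hl => Finset.mem_filter.2
      ⟨Finset.mem_univ _, congrArg Subtype.val (Finset.mem_filter.1 hl).2⟩
  · exact fun l hl => Finset.mem_filter.2
      ⟨Finset.mem_univ _, Subtype.ext (Finset.mem_filter.1 hl).2⟩
  · exact fun _ _ => rfl
  · exact fun _ _ => rfl
  · exact fun _ _ => rfl

/-- The bound in the cancellation condition, as a product over the blocks in `L`. -/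
theorem prod_sub_eq [Fintype κ] (E : Matrix κ κ ℝ) (L : Finset κ)
    (γ : {l // S.block l ∈ L} → ℕ) (x : S.SubSpace L) :
    ∏ j : {k // k ∈ L}, (∑ k : {k // k ∈ L}, S.n k (S.subComp L k x) ^
        (E.submatrix Subtype.val Subtype.val : Matrix {k // k ∈ L} {k // k ∈ L} ℝ) j k) ^
      (-((∑ l with subBlock S L l = j, S.d l) +
        ∑ l with subBlock S L l = j,
          γ l * S.d l)) =
      ∏ j ∈ L, S.subN E L j x ^ (-(S.Q j + S.subWlen L γ j)) := by
  rw [← Finset.prod_coe_sort L fun j => S.subN E L j x ^ (-(S.Q j + S.subWlen L γ j))]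
  refine Finset.prod_congr rfl fun j _ => ?_
  rw [sum_subBlock_eq S j S.d]
  simp only [Subtype.ext_iff, subBlock]
  rfl

/-- The unit balls are relatively compact. -/
theorem exists_compact_of_isBlockNorm {α κ : Type*} [Fintype α] [DecidableEq κ] {b : α → κ}
    {d : α → ℝ} (hd : ∀ l, 0 < d l) {ν : κ → EuclideanSpace ℝ α → ℝ} (h : IsBlockNorm b d ν) :
    ∃ K : Set (EuclideanSpace ℝ α), IsCompact K ∧ {x | ∀ j, ν j x < 1} ⊆ K := by
  obtain ⟨A, hA, hA'⟩ := h.rpow_le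
  refine ⟨Metric.closedBall 0 (∑ l, A (b l) ^ d l), isCompact_closedBall _ _, fun x hx => ?_⟩
  rw [mem_closedBall_zero_iff]
  refine (norm_le_sum_abs x).trans (Finset.sum_le_sum fun l _ => ?_)
  have h1 : |x l| ^ (1 / d l) ≤ A (b l) := (hA' l x).trans
    (mul_le_of_le_one_right (hA _).le (hx (b l)).le)
  have h2 := Real.rpow_le_rpow (Real.rpow_nonneg (abs_nonneg _) _) h1 (hd l).le
  rwa [← Real.rpow_mul (abs_nonneg _), one_div_mul_cancel (hd l).ne', Real.rpow_one] at h2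

theorem basicHypothesis_submatrix {κ κ' : Type*} {E : Matrix κ κ ℝ} (hE : BasicHypothesis E)
    (f : κ' → κ) : BasicHypothesis (E.submatrix f f) :=
  ⟨fun _ _ => hE.pos _ _, fun _ => hE.diag _, fun _ _ _ => hE.submul _ _ _⟩

/-- The coordinates of `ℝ^L ⊕ ℝ^{Lᶜ}`. -/
noncomputable def splitEquiv [Fintype κ] (L : Finset κ) :
    {l // S.block l ∈ L} ⊕ {l // S.block l ∈ Lᶜ} ≃ ι :=
  Equiv.ofBijective (Sum.elim Subtype.val Subtype.val) <| by
    constructor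
    · rintro (⟨l, hl⟩ | ⟨l, hl⟩) (⟨l', hl'⟩ | ⟨l', hl'⟩) h
      · exact congrArg Sum.inl (Subtype.ext h)
      · obtain rfl : l = l' := h
        exact absurd hl (Finset.mem_compl.1 hl')
      · obtain rfl : l = l' := h
        exact absurd hl' (Finset.mem_compl.1 hl)
      · exact congrArg Sum.inr (Subtype.ext h)
    · intro l
      by_cases hl : S.block l ∈ L
      · exact ⟨Sum.inl ⟨l, hl⟩, rfl⟩
      · exact ⟨Sum.inr ⟨l, Finset.mem_compl.2 hl⟩, rfl⟩

end BlockSpaces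

/-! ### The kernels and their quotients -/

section Kernels

/-- A multiplier with symbol bounds of size `t` has a kernel off the origin, with the estimates of
`𝓟₀` and constants that are linear in `t`. -/
theorem exists_block_kernel {α κ : Type*} [Fintype α] [DecidableEq κ] [Fintype κ] {b : α → κ}
    {d : α → ℝ} (hd : ∀ l, 0 < d l) {ν : κ → EuclideanSpace ℝ α → ℝ} (h : IsBlockNorm b d ν)
    {E : Matrix κ κ ℝ} (hE : BasicHypothesis E) (C : List α → ℝ) :
    ∃ D : ℕ → (α → ℕ) → ℝ, ∀ t, 0 ≤ t → ∀ m : EuclideanSpace ℝ α → ℂ, ContDiff ℝ ∞ m →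
      SymbolBound (coordMatrix b d E) C (fun _ => t) m →
      ∀ T : 𝓓((⊤ : Opens (EuclideanSpace ℝ α)), ℝ) → ℂ,
        (∀ φ, T φ = ∫ ξ, m ξ * osc (fun x => (φ x : ℂ)) ξ) →
        ∃ k : EuclideanSpace ℝ α → ℂ, GivenOffOriginBy T k ∧
          ∀ M γ x, x ≠ 0 → ‖multiDeriv γ k x‖ ≤ D M γ * t * (1 + ‖x‖) ^ (-(M : ℝ)) *
            ∏ j, (∑ k, ν k x ^ E j k) ^
              (-((∑ l with b l = j, d l) + ∑ l with b l = j, γ l * d l)) := by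
  rcases isEmpty_or_nonempty α with hα | hα
  · -- on a point, a function with support off the origin vanishes
    refine ⟨0, fun t _ m _ _ T hT => ⟨0, ⟨contDiffOn_const, fun φ hφ => ?_⟩,
      fun M γ x hx => absurd (Subsingleton.elim x 0) hx⟩⟩
    have h0 : ∀ x, φ x = 0 := fun x => image_eq_zero_of_notMem_tsupport
      (by rwa [Subsingleton.elim x 0])
    rw [hT]
    simp [h0, osc]
  · obtain ⟨K, hK⟩ := exists_kernel (basicHypothesis_coordMatrix (b := b) hE hd) C
    choose B hB0 hB using exists_decay_le hd hE h
    refine ⟨fun M γ => |K (directions γ) M| * B γ, fun t ht m hm hmb T hT => ?_⟩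
    obtain ⟨g, hg, hgb, hgi⟩ := hK t ht m hm hmb
    refine ⟨g [], ⟨hg.contDiffOn isOpen_compl_singleton [], fun φ hφ => ?_⟩, fun M γ x hx => ?_⟩
    · have hφd : ContDiff ℝ ∞ fun x => (φ x : ℂ) := Complex.ofRealCLM.contDiff.comp φ.contDiff
      have hφs : HasCompactSupport fun x => (φ x : ℂ) :=
        φ.hasCompactSupport.comp_left (g := fun r : ℝ => (r : ℂ)) Complex.ofReal_zero
      rw [hT]
      refine hgi _ hφd.continuous hφs (integrable_osc hφd hφs) fun h0 => hφ ?_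
      exact tsupport_comp_subset Complex.ofReal_zero _ h0
    · rw [hg.multiDeriv_eq isOpen_compl_singleton γ hx]
      refine (hgb (directions γ) M x hx).trans ?_
      calc K (directions γ) M * t * decay (coordMatrix b d E) (directions γ) M x
          ≤ |K (directions γ) M| * t * decay (coordMatrix b d E) (directions γ) M x := by
            have := decay_nonneg (coordMatrix b d E) (directions γ) M x
            gcongr
            exact le_abs_self _
        _ ≤ |K (directions γ) M| * t * _ :=
            mul_le_mul_of_nonneg_left (hB γ M x hx) (by positivity)
        _ = _ := by ring

variable {ι κ : Type*} [Fintype ι] [DecidableEq κ] [Fintype κ] (S : BlockSpace ι κ)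

/-- The cancellation conditions: the quotient distributions are kernels of averages of the
multiplier against the Fourier transform of `ψ_R`, whose `L¹` norm is controlled by a norm
`‖ψ‖_(p)`, uniformly in `R`. -/
theorem exists_quotient_kernel {E : Matrix κ κ ℝ} (hE : BasicHypothesis E) {m : S.Space → ℂ}
    (hm : ContDiff ℝ ∞ m) {C : List ι → ℝ}
    (hC : SymbolBound (coordMatrix S.block S.d E) C (fun _ => 1) m) {T : 𝓢'(S.Space, ℂ)}
    (hT : IsFourierTransformOf T m) (L : Finset κ) :
    ∃ (D : ℕ → ({l // S.block l ∈ L} → ℕ) → ℝ) (p : ℕ),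
      ∀ ψ : 𝓓((⊤ : Opens (S.SubSpace Lᶜ)), ℝ), tsupport ψ ⊆ S.subUnitBall Lᶜ →
      ∀ (R : κ → ℝ) (hR : ∀ j, 0 < R j),
        ∃ k : S.SubSpace L → ℂ,
          GivenOffOriginBy (fun φ => temperedToDistribution T (S.tensorTest L R hR ψ φ)) k ∧
          ∀ (M : ℕ) (γ : {l // S.block l ∈ L} → ℕ) (x : S.SubSpace L), x ≠ 0 →
            ‖multiDeriv γ k x‖ ≤ D M γ * testNorm p ψ * (1 + ‖x‖) ^ (-(M : ℝ)) *
              ∏ j ∈ L, S.subN E L j x ^ (-(S.Q j + S.subWlen L γ j)) := by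
  set e := splitEquiv S L
  have hLd : ∀ l : {l // S.block l ∈ L}, 0 < S.d l := fun l => S.d_pos l
  have hMd : ∀ l : {l // S.block l ∈ Lᶜ}, 0 < S.d l := fun l => S.d_pos l
  have hL := isBlockNorm_subComp S L
  have hM := isBlockNorm_subComp S Lᶜ
  obtain ⟨K, hK, hKs⟩ := exists_compact_of_isBlockNorm hMd hM
  obtain ⟨B, p, hB0, hB⟩ := exists_integral_norm_osc_dilate_le hK
  obtain ⟨D, hD⟩ := exists_block_kernel hLd hL
    (basicHypothesis_submatrix hE Subtype.val) fun L' => |C (L'.map fun i => e (Sum.inl i))|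
  refine ⟨fun M γ => D M γ * B, p, fun ψ hψ R hR => ?_⟩
  set c : {l // S.block l ∈ Lᶜ} → ℝ := fun l => R (S.block l) ^ S.d l with hc
  have hc0 : ∀ l, 0 < c l := fun l => Real.rpow_pos_of_pos (hR _) _
  set h := osc fun x => (ψ (diag c x) : ℂ) with hh
  have hsm : ContDiff ℝ ∞ fun x => (ψ (diag c x) : ℂ) :=
    Complex.ofRealCLM.contDiff.comp (ψ.contDiff.comp (diag c).contDiff)
  have hcs : HasCompactSupport fun x => (ψ (diag c x) : ℂ) :=
    (ψ.hasCompactSupport.comp_isClosedEmbedding (isClosedEmbedding_diag hc0)).comp_left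
      (g := fun r : ℝ => (r : ℂ)) Complex.ofReal_zero
  have hint : Integrable h := integrable_osc hsm hcs
  have hjet := isJet_avg hm hC e hint
  obtain ⟨k, hk, hkb⟩ := hD (B * testNorm p ψ) (mul_nonneg hB0 (testNorm_nonneg p ψ))
    (avg e m h []) (hjet.contDiff []) (symbolBound_avg hm hC e hint (hB ψ (hψ.trans hKs) c hc0))
    (fun φ => temperedToDistribution T (S.tensorTest L R hR ψ φ)) fun φ => by
      rw [temperedToDistribution_apply, hT]
      refine integral_mul_osc_tensor hm hC e (φ := fun x => (φ x : ℂ))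
        (ψ := fun x => (ψ (diag c x) : ℂ)) (χ := fun x => (S.tensorTest L R hR ψ φ x : ℂ))
        (fun z => ?_) (integrable_osc (Complex.ofRealCLM.contDiff.comp φ.contDiff)
          (φ.hasCompactSupport.comp_left (g := fun r : ℝ => (r : ℂ)) Complex.ofReal_zero)) hint
      have e1 : S.restr L (glue e z) = z.1 := by
        ext l
        exact glue_inl e z l
      have e2 : S.subDilate R Lᶜ (S.restr Lᶜ (glue e z)) = diag c z.2 := by
        ext l
        exact congrArg (fun y => c l * y) (glue_inr e z l)
      change ((φ (S.restr L (glue e z)) *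
        ψ (S.subDilate R Lᶜ (S.restr Lᶜ (glue e z))) : ℝ) : ℂ) = _
      rw [e1, e2, Complex.ofReal_mul]
  refine ⟨k, hk, fun M γ x hx => (hkb M γ x hx).trans (le_of_eq ?_)⟩
  rw [prod_sub_eq]
  ring

end Kernels

end MultiNorm

theorem mainTheorem1 {ι κ : Type*} [Fintype ι] [Fintype κ] [DecidableEq κ]
    (S : BlockSpace ι κ) (E : Matrix κ κ ℝ) (hE : BasicHypothesis E)
    (m : S.Space → ℂ) (hm : S.InMInfty E m) :
    ∃ T : 𝓢'(S.Space, ℂ), IsFourierTransformOf T m ∧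
      S.InP0 E (temperedToDistribution T) := by
  open MultiNorm in
  obtain ⟨hmd, hmb⟩ := hm
  have hS := isBlockNorm_comp S
  obtain ⟨C, hC⟩ := exists_symbolBound S.d_pos hE hS hmd hmb
  have hbd : ∀ ξ, ‖m ξ‖ ≤ |C []| := norm_pd_le_of_symbolBound hC []
  obtain ⟨T, hT⟩ := exists_isFourierTransformOf hmd.continuous hbd
  obtain ⟨D, hD⟩ := exists_block_kernel S.d_pos hS hE C
  obtain ⟨k, hk, hkb⟩ := hD 1 zero_le_one m hmd hC (temperedToDistribution T) fun φ => hT _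
  choose D' p hD' using exists_quotient_kernel S hE hmd hC hT
  refine ⟨T, hT, ⟨⟨k, hk, fun γ => ⟨D 0 γ, fun x hx => ?_⟩⟩, fun L => ⟨D' L 0, fun _ => p L,
    fun ψ hψ R hR => ?_⟩, ?_⟩, ⟨k, hk, fun M γ => ⟨D M γ, fun x hx => ?_⟩⟩, fun L =>
    ⟨D' L, fun _ _ => p L, hD' L⟩⟩
  · refine (hkb 0 γ x hx).trans (le_of_eq ?_)
    rw [Nat.cast_zero, neg_zero, Real.rpow_zero, mul_one, mul_one]
    rfl
  · obtain ⟨k, hk, hkb⟩ := hD' L ψ hψ R hR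
    refine ⟨k, hk, fun γ x hx => (hkb 0 γ x hx).trans (le_of_eq ?_)⟩
    rw [Nat.cast_zero, neg_zero, Real.rpow_zero, mul_one]
  · obtain ⟨K, hK, hKs⟩ := exists_compact_of_isBlockNorm S.d_pos hS
    obtain ⟨B, p, -, hB⟩ := exists_integral_norm_osc_dilate_le hK
    refine ⟨|C []| * B, p, fun ψ hψ R hR => ?_⟩
    set c : ι → ℝ := fun l => R (S.block l) ^ S.d l with hc
    have hc0 : ∀ l, 0 < c l := fun l => Real.rpow_pos_of_pos (hR _) _
    have hint : Integrable (osc fun x => (ψ (diag c x) : ℂ)) :=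
      integrable_osc (Complex.ofRealCLM.contDiff.comp (ψ.contDiff.comp (diag c).contDiff))
        ((ψ.hasCompactSupport.comp_isClosedEmbedding (isClosedEmbedding_diag hc0)).comp_left
          (g := fun r : ℝ => (r : ℂ)) Complex.ofReal_zero)
    have h1 : temperedToDistribution T (S.dilateTest R hR ψ) =
        ∫ ξ, m ξ * osc (fun x => (ψ (diag c x) : ℂ)) ξ := hT _
    calc ‖temperedToDistribution T (S.dilateTest R hR ψ)‖
        ≤ ∫ ξ, |C []| * ‖osc (fun x => (ψ (diag c x) : ℂ)) ξ‖ := by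
          rw [h1]
          refine norm_integral_le_of_norm_le (hint.norm.const_mul _)
            (Eventually.of_forall fun ξ => ?_)
          rw [norm_mul]
          exact mul_le_mul_of_nonneg_right (hbd ξ) (norm_nonneg _)
      _ ≤ |C []| * (B * testNorm p ψ) := by
          rw [integral_const_mul]
          exact mul_le_mul_of_nonneg_left (hB ψ (hψ.trans hKs) c hc0) (abs_nonneg _)
      _ = _ := by ring
  · refine (hkb M γ x hx).trans (le_of_eq ?_)
    rw [mul_one, mul_right_comm]
    rfl
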